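/- **Corollary 5.2 (Schnorr randomness and the $p$-variation norm).** Let $p\ge 1$ be a computable real and let $z\in[0,1]$. The following are equivalent: (i) $z$ is Schnorr random; (ii) every function in $A_p[0,1]$ that is computable in the $p$-variation norm is differentiable at $z$; (iii) every Lipschitz function $f\colon[0,1]\to\mathbb R$ that is computable in the $p$-variation norm is differentiable at $z$. Here the following definitions are used. A real $x$ is *computable* if there is a computable sequence of rationals $(q_n)$ with limit $x$ such that $|q_n-q_k|\le 2^{-n}$ for all $k\ge n$; a sequence of reals is uniformly computable if such sequences can be computed uniformly in the index. A *Schnorr test* is a sequence $(G_m)_{m\in\mathbb N}$ of sets $G_m=[0,1]\cap H_m$, where $H_m\subseteq\mathbb R$ is, uniformly in $m$, an effective union of open intervals with rational end points, such that the Lebesgue measure satisfies $\lambda G_m\le 2^{-m}$ and $\lambda G_m$ is a computable real uniformly in $m$. The point $z$ is *Schnorr random* if $z\notin\bigcap_m G_m$ for each Schnorr test $(G_m)$. For $f\colon[0,1]\to\mathbb R$ let $$V_p(f,[0,1])=\sup\Bigl\{\sum_{i=1}^{n-1}\frac{|f(t_{i+1})-f(t_i)|^p}{|t_{i+1}-t_i|^{p-1}}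 : 0\le t_1<t_2<\dots<t_n\le 1\Bigr\},\qquad \|f\|_{V_p}=|f(0)|+V_p(f,[0,1])^{1/p}$$ (for $p=1$ this is the usual variation norm). For $p>1$, $A_p[0,1]$ is the class of functions $f\colon[0,1]\to\mathbb R$ with $f(0)=0$ and $\|f\|_{V_p}<\infty$; $A_1[0,1]$ is the class of absolutely continuous functions $f\colon[0,1]\to\mathbb R$ with $f(0)=0$. A function $f$ is *computable in the $p$-variation norm* if there is a computable sequence $(q_n)_{n\in\mathbb N}$ of polynomials with rational coefficients such that $\|f-q_n\|_{V_p}\le 2^{-n}$ for all $n$. Differentiability at $z$ means that the limit of $\frac{f(x)-f(z)}{x-z}$, as $x\to z$ with $x\in[0,1]\setminus\{z\}$, exists and is finite (so it is one-sided if $z\in\{0,1\}$). -/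

import Mathlib

open Set Filter Topology MeasureTheory
open scoped ENNReal NNReal

noncomputable section

/-! ### Computable reals

Rational numbers are handed to Mathlib's `Computable` through explicit codes. -/

/-- A code of a rational number: `(a, b, d)` stands for `(a - b) / (d + 1)`. -/
abbrev RatCode : Type := ℕ × ℕ × ℕ

/-- The rational number with a given code. -/
def RatCode.val (c : RatCode) : ℚ := ((c.1 : ℚ) - (c.2.1 : ℚ)) / ((c.2.2 : ℚ) + 1)

/-- Every rational number has a code. -/
theorem RatCode.val_surjective : Function.Surjective RatCode.val := by
  intro q
  have hd : (q.den : ℚ) ≠ 0 := by exact_mod_cast q.den_nz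
  have h1 : (((q.den - 1 : ℕ) : ℚ)) + 1 = q.den := by
    exact_mod_cast Nat.sub_add_cancel q.den_pos
  have h2 : ((q.num.toNat : ℚ)) - (((-q.num).toNat : ℕ) : ℚ) = q.num := by
    exact_mod_cast Int.toNat_sub_toNat_neg q.num
  refine ⟨(q.num.toNat, (-q.num).toNat, q.den - 1), ?_⟩
  simp only [RatCode.val, h1, h2]
  exact Rat.num_div_den q

/-- The sequence of rationals coded by `a` is a Cauchy name for the real `x`. -/
def IsCauchyName (a : ℕ → RatCode) (x : ℝ) : Prop :=
  (∀ n k, n ≤ k → |((a n).val : ℝ) - ((a k).val : ℝ)| ≤ (2 : ℝ)⁻¹ ^ n) ∧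
    Tendsto (fun n => ((a n).val : ℝ)) atTop (𝓝 x)

/-- A real is computable if it has a computable Cauchy name. -/
def ComputableReal (x : ℝ) : Prop :=
  ∃ a : ℕ → RatCode, Computable a ∧ IsCauchyName a x

/-- The reals `x 0, x 1, …` are computable uniformly in the index. -/
def UniformlyComputableReals (x : ℕ → ℝ) : Prop :=
  ∃ a : ℕ → ℕ → RatCode, Computable₂ a ∧ ∀ m, IsCauchyName (a m) (x m)

/-! ### Schnorr randomness in `[0,1]` -/

/-- `G 0, G 1, …` is a uniformly `Σ⁰₁` sequence of subsets of `[0,1]`: uniformly in `m`, the set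
`G m` is the trace on `[0,1]` of an effective union of open intervals with rational end points
(an interval whose left end point is not below the right one is empty). -/
def UniformlySigma1 (G : ℕ → Set ℝ) : Prop :=
  ∃ c : ℕ → ℕ → RatCode × RatCode, Computable₂ c ∧
    ∀ m, G m = Icc (0 : ℝ) 1 ∩ ⋃ i, Ioo ((c m i).1.val : ℝ) ((c m i).2.val : ℝ)

/-- Schnorr tests in `[0,1]`. -/
def IsSchnorrTest (G : ℕ → Set ℝ) : Prop :=
  UniformlySigma1 G ∧ (∀ m, volume (G m) ≤ (2 : ℝ≥0∞)⁻¹ ^ m) ∧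
    UniformlyComputableReals (fun m => (volume (G m)).toReal)

/-- `z` is Schnorr random if it passes all Schnorr tests. -/
def SchnorrRandom (z : ℝ) : Prop :=
  ∀ G : ℕ → Set ℝ, IsSchnorrTest G → z ∉ ⋂ m, G m

/-! ### The `p`-variation norm

A function on `[0,1]` is a function on `ℝ` of which only the values on `[0,1]` matter. -/

/-- The `p`-variation of `g` in `[x,y]`, the supremum being over all finite strictly increasing
sequences `t 0 < ⋯ < t n` in `[x,y]`. For `p = 1` this is the usual variation. -/
def pVariation (p : ℝ) (g : ℝ → ℝ) (x y : ℝ) : ℝ≥0∞ :=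
  ⨆ (n : ℕ) (t : ℕ → ℝ) (_ : StrictMonoOn t (Iic n)) (_ : ∀ i ≤ n, t i ∈ Icc x y),
    ∑ i ∈ Finset.range n,
      ENNReal.ofReal (|g (t (i + 1)) - g (t i)| ^ p / |t (i + 1) - t i| ^ (p - 1))

/-- The `p`-variation norm `|f 0| + (V_p(f,[0,1]))^(1/p)`; it is `∞` if the `p`-variation is. -/
def pVarNorm (p : ℝ) (f : ℝ → ℝ) : ℝ≥0∞ :=
  ENNReal.ofReal |f 0| + pVariation p f 0 1 ^ (1 / p)

/-- The Riesz class `A_p[0,1]`: for `p > 1`, the functions with `f 0 = 0` and finite `p`-variation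
norm; for `p = 1`, the absolutely continuous functions with `f 0 = 0`. -/
def rieszClass (p : ℝ) : Set (ℝ → ℝ) :=
  {f | f 0 = 0 ∧
    ((1 < p ∧ pVarNorm p f < ∞) ∨ (p = 1 ∧ AbsolutelyContinuousOnInterval f 0 1))}

/-- The rational polynomial whose list of coefficients, constant coefficient first, is coded by
`l`. -/
def ratPoly : List RatCode → Polynomial ℚ
  | [] => 0
  | c :: l => Polynomial.C c.val + Polynomial.X * ratPoly l

/-- `f` is computable in the `p`-variation norm: there is an effective sequence of rational
polynomials `q 0, q 1, …` such that `f - q n` has norm at most `2^(-n)`. -/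
def ComputableInPVarNorm (p : ℝ) (f : ℝ → ℝ) : Prop :=
  ∃ q : ℕ → List RatCode, Computable q ∧
    ∀ n, pVarNorm p (fun x => f x - Polynomial.aeval x (ratPoly (q n))) ≤ (2 : ℝ≥0∞)⁻¹ ^ n

/-- Differentiability at `z` of a function on `[0,1]` (one-sided if `z` is `0` or `1`). -/
def DifferentiableOnUnitAt (f : ℝ → ℝ) (z : ℝ) : Prop :=
  DifferentiableWithinAt ℝ f (Icc 0 1) z

end

/-! Randomness implies differentiability. Rational polynomials q_k that converge fast in the
p-variation norm have consecutive differences with small total increment over every uniform grid, by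
the power mean inequality (`sum_abs_sub_le_of_pVarNorm_le`). On a fine enough dyadic grid the slopes
of q_{k+1} - q_k are therefore small on average, and a discrete maximal inequality
(`mul_card_largeAverage_le`) bounds the number of cells at which some average of slopes exceeds
2^(-k). These cells, slightly enlarged, are finite unions of rational intervals with summable
measures. Their tails form a Schnorr test, so a Schnorr random z avoids all but finitely many of
them (`SchnorrRandom.exists_forall_notMem`). From then on the chords of q_{k+1} - q_k through z have
slope at most 2^(-k) (`abs_sub_le_of_not_largeAverage`), and differentiability passes to the limit
(`differentiableWithinAt_of_slopes`).

Conversely, let a Schnorr test G catch z. Along the dyadic cells around a point, one component of G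
is watched at a time; when the cell enters it, at level t, a sign is flipped and G_{t+3} is watched
next. That component has at most an eighth of the measure of the current cell, so the new sign is
final on most of the cell. The final sign is a {0,1}-valued function `limFun`. Its averages over
certain cells shrinking to z are within 1/8 of 0, over others within 1/8 of 1, so its integral
`limIntegral` is 1-Lipschitz but not differentiable at z (`not_differentiableOnUnitAt_limIntegral`).

Computability of the measures of G yields computable levels after which the sign changes only on a
small set (`exists_computable_level`). Hence `limFun` is effectively approximated in L¹ by step
functions, and these by derivatives of rational polynomials with a common bound. If F' is bounded
and small in L¹, then F has small p-variation: in |ΔF|^p = |ΔF|^(p-1) |ΔF| the bound controls the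
first factor and the L¹ norm the second (`pVarNorm_le_of_lintegral_le`). -/

noncomputable section

/-! ### Computable functions with rational values -/

namespace RatCode

/-- Addition on codes. -/
def add (x y : RatCode) : RatCode :=
  (x.1 * (y.2.2 + 1) + y.1 * (x.2.2 + 1), x.2.1 * (y.2.2 + 1) + y.2.1 * (x.2.2 + 1),
    (x.2.2 + 1) * (y.2.2 + 1) - 1)

/-- Multiplication on codes. -/
def mul (x y : RatCode) : RatCode :=
  (x.1 * y.1 + x.2.1 * y.2.1, x.1 * y.2.1 + x.2.1 * y.1, (x.2.2 + 1) * (y.2.2 + 1) - 1)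

/-- Negation on codes. -/
def neg (x : RatCode) : RatCode := (x.2.1, x.1, x.2.2)

/-- Codes store denominators less one. The truncated subtraction is harmless because the product is
positive. -/
theorem cast_pred_mul_succ (a b : ℕ) :
    (((a + 1) * (b + 1) - 1 : ℕ) : ℚ) + 1 = ((a : ℚ) + 1) * (b + 1) := by
  have : 1 ≤ (a + 1) * (b + 1) := Nat.one_le_iff_ne_zero.2 (by positivity)
  push_cast [Nat.cast_sub this]; ring

theorem val_add (x y : RatCode) : (x.add y).val = x.val + y.val := by
  simp only [val, add, cast_pred_mul_succ]
  push_cast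
  field_simp
  ring

theorem val_mul (x y : RatCode) : (x.mul y).val = x.val * y.val := by
  simp only [val, mul, cast_pred_mul_succ]
  push_cast
  field_simp
  ring

theorem val_neg (x : RatCode) : x.neg.val = -x.val := by
  simp only [val, neg]
  ring

theorem val_le_val (x y : RatCode) : x.val ≤ y.val ↔
    x.1 * (y.2.2 + 1) + y.2.1 * (x.2.2 + 1) ≤ y.1 * (x.2.2 + 1) + x.2.1 * (y.2.2 + 1) := by
  simp only [val]
  rw [div_le_div_iff₀ (by positivity) (by positivity), ← Nat.cast_le (α := ℚ)]
  push_cast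
  constructor <;> intro h <;> linarith

theorem val_natCast (n : ℕ) : val (n, 0, 0) = n := by simp [val]

end RatCode

/-! ### Closure properties of computable functions -/

section Calculus

variable {α β γ σ : Type*} [Primcodable α] [Primcodable β] [Primcodable γ] [Primcodable σ]

attribute [fun_prop] Computable

namespace Computable

@[fun_prop]
theorem funprop_id : Computable (fun a : α => a) := Computable.id

@[fun_prop]
theorem funprop_const (b : β) : Computable (fun _ : α => b) := Computable.const b

@[fun_prop]
theorem funprop_comp {f : β → γ} {g : α → β} (hf : Computable f) (hg : Computable g) :
    Computable fun a => f (g a) := hf.comp hg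

@[fun_prop]
theorem funprop_fst {f : α → β × γ} (hf : Computable f) : Computable fun a => (f a).1 :=
  Computable.fst.comp hf

@[fun_prop]
theorem funprop_snd {f : α → β × γ} (hf : Computable f) : Computable fun a => (f a).2 :=
  Computable.snd.comp hf

@[fun_prop]
theorem funprop_mk {f : α → β} {g : α → γ} (hf : Computable f) (hg : Computable g) :
    Computable fun a => (f a, g a) := hf.pair hg

@[fun_prop]
theorem nat_add' {f g : α → ℕ} (hf : Computable f) (hg : Computable g) :
    Computable fun a => f a + g a := Primrec.nat_add.to_comp.comp hf hg

@[fun_prop]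
theorem nat_mul' {f g : α → ℕ} (hf : Computable f) (hg : Computable g) :
    Computable fun a => f a * g a := Primrec.nat_mul.to_comp.comp hf hg

@[fun_prop]
theorem nat_sub' {f g : α → ℕ} (hf : Computable f) (hg : Computable g) :
    Computable fun a => f a - g a := Primrec.nat_sub.to_comp.comp hf hg

@[fun_prop]
theorem nat_div' {f g : α → ℕ} (hf : Computable f) (hg : Computable g) :
    Computable fun a => f a / g a := Primrec.nat_div.to_comp.comp hf hg

theorem nat_rec' {f : α → ℕ} {g : α → σ} {h : α → ℕ → σ → σ} (hf : Computable f)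
    (hg : Computable g) (hh : Computable fun x : α × ℕ × σ => h x.1 x.2.1 x.2.2) :
    Computable fun a => Nat.rec (motive := fun _ => σ) (g a) (h a) (f a) :=
  Computable.nat_rec hf hg (h := fun a x => h a x.1 x.2) hh

@[fun_prop]
theorem nat_pow' {f g : α → ℕ} (hf : Computable f) (hg : Computable g) :
    Computable fun a => f a ^ g a := by
  refine (nat_rec' (h := fun a _ x => x * f a) hg (Computable.const 1) (by fun_prop)).of_eq
    fun a => ?_
  induction g a with
  | zero => simp
  | succ n ih => simp [pow_succ, ih]

end Computable

/-! ### Decidable relations, bounded and unbounded search -/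

namespace ComputablePred

theorem comp {P : β → Prop} {f : α → β} (hP : ComputablePred P) (hf : Computable f) :
    ComputablePred fun a => P (f a) := by
  classical
  exact (hP.decide.comp hf).computablePred

theorem and {P Q : α → Prop} (hP : ComputablePred P) (hQ : ComputablePred Q) :
    ComputablePred fun a => P a ∧ Q a := by
  classical
  exact Computable.computablePred
    ((Primrec.and.to_comp.comp hP.decide hQ.decide).of_eq fun a => by simp)

theorem or {P Q : α → Prop} (hP : ComputablePred P) (hQ : ComputablePred Q) :
    ComputablePred fun a => P a ∨ Q a := by
  classical
  exact Computable.computablePred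
    ((Primrec.or.to_comp.comp hP.decide hQ.decide).of_eq fun a => by simp)

theorem exists_lt {P : α → ℕ → Prop} {n : α → ℕ}
    (hP : ComputablePred fun x : α × ℕ => P x.1 x.2) (hn : Computable n) :
    ComputablePred fun a => ∃ i < n a, P a i := by
  classical
  have hP' : Computable fun x : α × ℕ => decide (P x.1 x.2) := hP.decide
  have h : Computable fun a => Nat.rec (motive := fun _ => Bool) false
      (fun i b => b || decide (P a i)) (n a) :=
    Computable.nat_rec' hn (Computable.const false)
      (Primrec.or.to_comp.comp (by fun_prop)
        (hP'.comp (f := fun x : α × ℕ => decide (P x.1 x.2))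
          (g := fun x : α × ℕ × Bool => (x.1, x.2.1)) (by fun_prop)))
  refine Computable.computablePred (h.of_eq fun a => ?_)
  induction n a with
  | zero => simp
  | succ n ih =>
    simp only [ih, ← Bool.decide_or]
    refine decide_eq_decide.2 ?_
    simp only [Order.lt_add_one_iff, le_iff_lt_or_eq]
    constructor
    · rintro (⟨i, hi, h⟩ | h)
      exacts [⟨i, .inl hi, h⟩, ⟨n, .inr rfl, h⟩]
    · rintro ⟨i, hi | rfl, h⟩
      exacts [.inl ⟨i, hi, h⟩, .inr h]

theorem forall_lt {P : α → ℕ → Prop} {n : α → ℕ}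
    (hP : ComputablePred fun x : α × ℕ => P x.1 x.2) (hn : Computable n) :
    ComputablePred fun a => ∀ i < n a, P a i :=
  (exists_lt (P := fun a i => ¬ P a i) hP.not hn).not.of_eq fun a => by simp

theorem ite' {P : α → Prop} [DecidablePred P] {f g : α → σ} (hP : ComputablePred P)
    (hf : Computable f) (hg : Computable g) : Computable fun a => if P a then f a else g a := by
  simpa [Bool.cond_decide] using hP.decide.cond hf hg

theorem nat_lt {f g : α → ℕ} (hf : Computable f) (hg : Computable g) :
    ComputablePred fun a => f a < g a :=
  (Primrec.nat_lt.comp .fst .snd).computablePred.comp (f := fun a => (f a, g a)) (hf.pair hg)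

theorem nat_le {f g : α → ℕ} (hf : Computable f) (hg : Computable g) :
    ComputablePred fun a => f a ≤ g a :=
  (Primrec.nat_le.comp .fst .snd).computablePred.comp (f := fun a => (f a, g a)) (hf.pair hg)

theorem bool_eq {f : α → Bool} (hf : Computable f) : ComputablePred fun a => f a = true :=
  Computable.computablePred (by simpa using hf)

/-- Unbounded search for a witness of a decidable relation. -/
theorem exists_choice {P : α → β → Prop} (hP : ComputablePred fun x : α × β => P x.1 x.2)
    (h : ∀ a, ∃ b, P a b) : ∃ f : α → β, Computable f ∧ ∀ a, P a (f a) := by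
  classical
  -- A point of `α` supplies a default value `b₀` for the decoder; if there is none, every function
  -- on `α` is computable.
  by_cases hα : Nonempty α
  swap
  · rw [not_nonempty_iff] at hα
    exact ⟨fun a => isEmptyElim a, (Computable.of_eq (f := fun a : α => (isEmptyElim a : β))
      (by
        refine Partrec.of_eq (f := fun _ => Part.none) Partrec.none fun a => isEmptyElim a)
      fun a => rfl), fun a => isEmptyElim a⟩
  obtain ⟨a₀⟩ := hα
  obtain ⟨b₀, -⟩ := h a₀
  -- The search runs through the codes of elements of `β`; a number that decodes to nothing counts
  -- as a failure.
  let Q : α → ℕ → Prop := fun a n =>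
    ((Encodable.decode (α := β) n).map fun b => decide (P a b)).getD false = true
  have hP' : Computable fun x : α × β => decide (P x.1 x.2) := hP.decide
  have hQ : ComputablePred fun x : α × ℕ => Q x.1 x.2 := by
    refine bool_eq (Computable.option_getD (Computable.option_map (Computable.decode.comp .snd)
      (g := fun (x : α × ℕ) b => decide (P x.1 b)) ?_) (Computable.const false))
    exact hP'.comp (f := fun x : α × β => decide (P x.1 x.2))
      (g := fun x : (α × ℕ) × β => (x.1.1, x.2)) (by fun_prop)
  have hex : ∀ a, ∃ n, Q a n := fun a => by
    obtain ⟨b, hb⟩ := h a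
    exact ⟨Encodable.encode b, by simpa [Q] using hb⟩
  refine ⟨fun a => (Encodable.decode (α := β) (Nat.find (hex a))).getD b₀,
    Computable.option_getD (Computable.decode.comp (Computable.find hQ hex)) (Computable.const b₀),
    fun a => ?_⟩
  have := Nat.find_spec (hex a)
  dsimp only [Q] at this
  cases hd : Encodable.decode (α := β) (Nat.find (hex a)) with
  | none => simp [hd] at this
  | some b => simpa [hd] using this

end ComputablePred

/-- A function with rational values is computable if its values have computable codes. -/
@[fun_prop]
def ComputableRat (f : α → ℚ) : Prop := ∃ c : α → RatCode, Computable c ∧ ∀ a, (c a).val = f a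

/-! ### Arithmetic and order of computable functions with rational values -/

namespace ComputableRat

@[fun_prop]
theorem funprop_const (q : ℚ) : ComputableRat (fun _ : α => q) :=
  let ⟨c, hc⟩ := RatCode.val_surjective q
  ⟨fun _ => c, Computable.const c, fun _ => hc⟩

@[fun_prop]
theorem comp {f : β → ℚ} {g : α → β} (hf : ComputableRat f) (hg : Computable g) :
    ComputableRat fun a => f (g a) :=
  let ⟨c, hc, h⟩ := hf
  ⟨fun a => c (g a), hc.comp hg, fun a => h (g a)⟩

@[fun_prop]
theorem val {c : α → RatCode} (hc : Computable c) : ComputableRat fun a => (c a).val :=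
  ⟨c, hc, fun _ => rfl⟩

@[fun_prop]
theorem natCast {n : α → ℕ} (hn : Computable n) : ComputableRat fun a => (n a : ℚ) :=
  ⟨fun a => (n a, 0, 0), by fun_prop, fun a => RatCode.val_natCast _⟩

@[fun_prop]
theorem add {f g : α → ℚ} (hf : ComputableRat f) (hg : ComputableRat g) :
    ComputableRat fun a => f a + g a := by
  obtain ⟨c, hc, h⟩ := hf
  obtain ⟨d, hd, h'⟩ := hg
  exact ⟨fun a => (c a).add (d a), by unfold RatCode.add; fun_prop, fun a => by
    rw [RatCode.val_add, h, h']⟩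

@[fun_prop]
theorem mul {f g : α → ℚ} (hf : ComputableRat f) (hg : ComputableRat g) :
    ComputableRat fun a => f a * g a := by
  obtain ⟨c, hc, h⟩ := hf
  obtain ⟨d, hd, h'⟩ := hg
  exact ⟨fun a => (c a).mul (d a), by unfold RatCode.mul; fun_prop, fun a => by
    rw [RatCode.val_mul, h, h']⟩

@[fun_prop]
theorem neg {f : α → ℚ} (hf : ComputableRat f) : ComputableRat fun a => -f a := by
  obtain ⟨c, hc, h⟩ := hf
  exact ⟨fun a => (c a).neg, by unfold RatCode.neg; fun_prop, fun a => by rw [RatCode.val_neg, h]⟩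

@[fun_prop]
theorem sub {f g : α → ℚ} (hf : ComputableRat f) (hg : ComputableRat g) :
    ComputableRat fun a => f a - g a := by
  simp only [sub_eq_add_neg]; fun_prop

theorem le {f g : α → ℚ} (hf : ComputableRat f) (hg : ComputableRat g) :
    ComputablePred fun a => f a ≤ g a := by
  obtain ⟨c, hc, h⟩ := hf
  obtain ⟨d, hd, h'⟩ := hg
  simp only [← h, ← h', RatCode.val_le_val]
  exact ComputablePred.nat_le (by fun_prop) (by fun_prop)

theorem lt {f g : α → ℚ} (hf : ComputableRat f) (hg : ComputableRat g) :
    ComputablePred fun a => f a < g a := by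
  simpa using (hg.le hf).not

theorem ite {P : α → Prop} [DecidablePred P] {f g : α → ℚ} (hP : ComputablePred P)
    (hf : ComputableRat f) (hg : ComputableRat g) :
    ComputableRat fun a => if P a then f a else g a := by
  obtain ⟨c, hc, h⟩ := hf
  obtain ⟨d, hd, h'⟩ := hg
  exact ⟨fun a => if P a then c a else d a, hP.ite' hc hd, fun a => by
    dsimp only; split_ifs <;> simp [h, h']⟩

@[fun_prop]
theorem abs {f : α → ℚ} (hf : ComputableRat f) : ComputableRat fun a => |f a| := by
  have : (fun a => |f a|) = fun a => if 0 ≤ f a then f a else -f a := by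
    ext a; split_ifs with h
    exacts [abs_of_nonneg h, abs_of_neg (not_le.1 h)]
  rw [this]
  exact ite ((funprop_const 0).le hf) hf hf.neg

/-- The recursion is run on codes, and `hs` says that `op` on codes realises the step on values, so
the values agree by induction. -/
theorem rec {n : α → ℕ} {f : α → ℕ → ℚ} {s : α → ℚ → ℚ → ℚ} {g : α → ℚ}
    (hn : Computable n) (hf : ComputableRat fun x : α × ℕ => f x.1 x.2) (hg : ComputableRat g)
    (op : RatCode → RatCode → RatCode) (hop : Computable fun x : RatCode × RatCode => op x.1 x.2)
    (hs : ∀ a x y, s a x.val y.val = (op x y).val) :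
    ComputableRat fun a =>
      Nat.rec (motive := fun _ => ℚ) (g a) (fun i x => s a x (f a i)) (n a) := by
  obtain ⟨c, hc, h⟩ := hf
  obtain ⟨d, hd, h'⟩ := hg
  refine ⟨_, Computable.nat_rec' (h := fun a i x => op x (c (a, i))) hn hd
    (hop.comp (f := fun x : RatCode × RatCode => op x.1 x.2)
      (g := fun x : α × ℕ × RatCode => (x.2.2, c (x.1, x.2.1))) (by fun_prop)), fun a => ?_⟩
  dsimp only
  generalize n a = m
  induction m with
  | zero => simp [h']
  | succ k ih =>
    simp only at ih ⊢
    rw [← hs a, ih, h]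

@[fun_prop]
theorem sum {n : α → ℕ} {f : α → ℕ → ℚ} (hf : ComputableRat fun x : α × ℕ => f x.1 x.2)
    (hn : Computable n) : ComputableRat fun a => ∑ i ∈ Finset.range (n a), f a i := by
  have := rec (s := fun _ x y => x + y) hn hf (funprop_const 0) RatCode.add
    (by unfold RatCode.add; fun_prop) fun _ _ _ => (RatCode.val_add _ _).symm
  convert this using 2 with a
  induction n a with
  | zero => simp
  | succ k ih => simp [Finset.sum_range_succ, ih]

@[fun_prop]
theorem pow {f : α → ℚ} {n : α → ℕ} (hf : ComputableRat f) (hn : Computable n) :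
    ComputableRat fun a => f a ^ n a := by
  have := rec (f := fun a _ => f a) (s := fun _ x y => x * y) hn
    (hf.comp .fst) (funprop_const 1) RatCode.mul
    (by unfold RatCode.mul; fun_prop) fun _ _ _ => (RatCode.val_mul _ _).symm
  convert this using 2 with a
  induction n a with
  | zero => simp
  | succ k ih => simp [pow_succ, ih]

@[fun_prop]
theorem div_pow {f : α → ℚ} {n : α → ℕ} (hf : ComputableRat f) (hn : Computable n) (q : ℚ) :
    ComputableRat fun a => f a / q ^ n a := by
  simp only [div_eq_mul_inv, ← inv_pow]; fun_prop

end ComputableRat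

end Calculus

/-! ### Rational polynomials given by codes -/

theorem aeval_ratPoly (l : List RatCode) (x : ℝ) :
    Polynomial.aeval x (ratPoly l) =
      ∑ i ∈ Finset.range l.length, ((l.getD i (0, 0, 0)).val : ℝ) * x ^ i := by
  induction l with
  | nil => simp [ratPoly]
  | cons c l ih =>
    simp only [ratPoly, map_add, map_mul, Polynomial.aeval_X, Polynomial.aeval_C, ih,
      List.length_cons, Finset.sum_range_succ', List.getD_cons_zero, List.getD_cons_succ,
      Finset.mul_sum, pow_zero, mul_one, eq_ratCast]
    rw [add_comm]
    congr 1
    exact Finset.sum_congr rfl fun i _ => by ring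

/-- The derivative of a coded polynomial at a rational point. -/
def ratDeriv (l : List RatCode) (x : ℚ) : ℚ :=
  ∑ i ∈ Finset.range l.length, (i : ℚ) * (l.getD i (0, 0, 0)).val * x ^ (i - 1)

/-- A Lipschitz constant on `[0,1]` of the derivative of a coded polynomial. -/
def ratLip (l : List RatCode) : ℚ :=
  ∑ i ∈ Finset.range l.length, (i : ℚ) * i * |(l.getD i (0, 0, 0)).val|

/-- The derivative of a coded polynomial. -/
def polyDeriv (l : List RatCode) (x : ℝ) : ℝ :=
  ∑ i ∈ Finset.range l.length, (i : ℝ) * ((l.getD i (0, 0, 0)).val : ℝ) * x ^ (i - 1)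

theorem ratDeriv_cast (l : List RatCode) (x : ℚ) : (ratDeriv l x : ℝ) = polyDeriv l x := by
  simp [ratDeriv, polyDeriv]

theorem hasDerivAt_ratPoly (l : List RatCode) (x : ℝ) :
    HasDerivAt (fun x : ℝ => Polynomial.aeval x (ratPoly l)) (polyDeriv l x) x := by
  simp only [aeval_ratPoly, polyDeriv]
  refine HasDerivAt.fun_sum fun i _ => ?_
  exact ((hasDerivAt_pow i x).const_mul ((l.getD i (0, 0, 0)).val : ℝ)).congr_deriv (by ring)

theorem continuous_polyDeriv (l : List RatCode) : Continuous (polyDeriv l) := by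
  unfold polyDeriv; fun_prop

theorem ratLip_nonneg (l : List RatCode) : 0 ≤ ratLip l :=
  Finset.sum_nonneg fun i _ => by positivity

/-- On `[0,1]` the monomial of exponent i - 1 has Lipschitz constant i - 1. The cruder factor i
keeps truncated subtraction out of `ratLip`. -/
theorem abs_polyDeriv_sub_le (l : List RatCode) {x y : ℝ} (hx : x ∈ Icc (0 : ℝ) 1)
    (hy : y ∈ Icc (0 : ℝ) 1) : |polyDeriv l x - polyDeriv l y| ≤ ratLip l * |x - y| := by
  simp only [polyDeriv, ratLip, ← Finset.sum_sub_distrib]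
  refine (Finset.abs_sum_le_sum_abs _ _).trans ?_
  push_cast
  rw [Finset.sum_mul]
  refine Finset.sum_le_sum fun i _ => ?_
  rw [← mul_sub, abs_mul, abs_mul, Nat.abs_cast]
  have h : |x ^ (i - 1) - y ^ (i - 1)| ≤ i * |x - y| := by
    refine (abs_pow_sub_pow_le x y (i - 1)).trans ?_
    have h1 : max |x| |y| ^ (i - 1 - 1) ≤ 1 := by
      refine pow_le_one₀ (by positivity) (max_le ?_ ?_) <;> rw [abs_le] <;> constructor <;>
        linarith [hx.1, hx.2, hy.1, hy.2]
    have h2 : ((i - 1 : ℕ) : ℝ) ≤ i := by exact_mod_cast Nat.sub_le i 1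
    calc |x - y| * ((i - 1 : ℕ) : ℝ) * max |x| |y| ^ (i - 1 - 1)
        ≤ |x - y| * i * 1 := by gcongr
      _ = i * |x - y| := by ring
  calc (i : ℝ) * |((l.getD i (0, 0, 0)).val : ℝ)| * |x ^ (i - 1) - y ^ (i - 1)|
      ≤ (i : ℝ) * |((l.getD i (0, 0, 0)).val : ℝ)| * (i * |x - y|) := by gcongr
    _ = _ := by ring

namespace ComputableRat

variable {α : Type*} [Primcodable α]

@[fun_prop]
theorem coeff {l : α → List RatCode} {i : α → ℕ} (hl : Computable l) (hi : Computable i) :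
    Computable fun a => (l a).getD (i a) (0, 0, 0) :=
  (Primrec.list_getD (α := RatCode) (0, 0, 0)).to_comp.comp hl hi

@[fun_prop]
theorem length {l : α → List RatCode} (hl : Computable l) : Computable fun a => (l a).length :=
  Computable.list_length.comp hl

@[fun_prop]
theorem ratDeriv {l : α → List RatCode} {x : α → ℚ} (hl : Computable l) (hx : ComputableRat x) :
    ComputableRat fun a => ratDeriv (l a) (x a) := by
  have := hx.comp (Computable.fst (α := α) (β := ℕ))
  unfold _root_.ratDeriv; fun_prop

@[fun_prop]
theorem ratLip {l : α → List RatCode} (hl : Computable l) :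
    ComputableRat fun a => ratLip (l a) := by
  unfold _root_.ratLip; fun_prop

end ComputableRat

/-! ### Dyadic cells -/

/-- The index of the dyadic cell of level `T` that contains `x ∈ [0,1]`; the last cell is closed. -/
def dyadicIndex (T : ℕ) (x : ℝ) : ℕ := min ⌊x * 2 ^ T⌋₊ (2 ^ T - 1)

/-- The dyadic cell of level `T` and index `j`. -/
def dyadicCell (T j : ℕ) : Set ℝ := {x | x ∈ Icc (0 : ℝ) 1 ∧ dyadicIndex T x = j}

theorem dyadicIndex_lt (T : ℕ) (x : ℝ) : dyadicIndex T x < 2 ^ T := by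
  have : 0 < 2 ^ T := by positivity
  unfold dyadicIndex; omega

theorem dyadicIndex_le {T : ℕ} {x : ℝ} (hx : x ∈ Icc (0 : ℝ) 1) :
    (dyadicIndex T x : ℝ) / 2 ^ T ≤ x := by
  rw [div_le_iff₀ (by positivity)]
  exact (Nat.cast_le.2 (min_le_left _ _)).trans (Nat.floor_le (mul_nonneg hx.1 (by positivity)))

theorem le_dyadicIndex {T : ℕ} {x : ℝ} (hx : x ∈ Icc (0 : ℝ) 1) :
    x ≤ ((dyadicIndex T x : ℝ) + 1) / 2 ^ T := by
  rw [le_div_iff₀ (by positivity)]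
  unfold dyadicIndex
  rcases min_cases ⌊x * 2 ^ T⌋₊ (2 ^ T - 1) with h | h <;> rw [h.1]
  · exact (Nat.lt_floor_add_one _).le
  · have : ((2 ^ T - 1 : ℕ) : ℝ) + 1 = 2 ^ T := by
      rw [Nat.cast_sub Nat.one_le_two_pow]; simp
    rw [this]
    exact mul_le_of_le_one_left (by positivity) hx.2

/-- Halving the index gives the parent cell. The cap at the last index is compatible with this,
since half of 2^(T+1) - 1 rounds down to 2^T - 1. -/
theorem dyadicIndex_div_two (T : ℕ) (x : ℝ) : dyadicIndex (T + 1) x / 2 = dyadicIndex T x := by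
  have h : ⌊x * 2 ^ (T + 1)⌋₊ / 2 = ⌊x * 2 ^ T⌋₊ := by
    have := Nat.floor_div_natCast (x * 2 ^ (T + 1)) 2
    rw [← this, pow_succ, ← mul_assoc]
    simp
  have : 0 < 2 ^ T := by positivity
  have h2 : 2 ^ (T + 1) = 2 * 2 ^ T := pow_succ' 2 T
  unfold dyadicIndex
  omega

theorem dyadicIndex_div_two_pow (T k : ℕ) (x : ℝ) :
    dyadicIndex (T + k) x / 2 ^ k = dyadicIndex T x := by
  induction k with
  | zero => simp
  | succ k ih => rw [pow_succ', ← Nat.div_div_eq_div_mul, ← add_assoc, dyadicIndex_div_two, ih]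

theorem dyadicIndex_div_le_of_le {T T' : ℕ} (h : T ≤ T') (x : ℝ) :
    (dyadicIndex T x : ℚ) / 2 ^ T ≤ dyadicIndex T' x / 2 ^ T' ∧
      ((dyadicIndex T' x : ℚ) + 1) / 2 ^ T' ≤ (dyadicIndex T x + 1) / 2 ^ T := by
  obtain ⟨k, rfl⟩ := Nat.exists_eq_add_of_le h
  have h1 := dyadicIndex_div_two_pow T k x
  have h2 : dyadicIndex T x * 2 ^ k ≤ dyadicIndex (T + k) x := by
    rw [← h1]; exact Nat.div_mul_le_self _ _
  have h3 : dyadicIndex (T + k) x + 1 ≤ (dyadicIndex T x + 1) * 2 ^ k := by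
    rw [← h1]; exact Nat.lt_mul_of_div_lt (Nat.lt_succ_self _) (by positivity)
  have h2' : (dyadicIndex T x : ℚ) * 2 ^ k ≤ dyadicIndex (T + k) x := by exact_mod_cast h2
  have h3' : (dyadicIndex (T + k) x : ℚ) + 1 ≤ (dyadicIndex T x + 1) * 2 ^ k := by
    exact_mod_cast h3
  rw [pow_add]
  constructor
  · rw [div_le_div_iff₀ (by positivity) (by positivity)]
    calc (dyadicIndex T x : ℚ) * (2 ^ T * 2 ^ k) = (dyadicIndex T x * 2 ^ k) * 2 ^ T := by ring
      _ ≤ _ := by gcongr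
  · rw [div_le_div_iff₀ (by positivity) (by positivity)]
    calc ((dyadicIndex (T + k) x : ℚ) + 1) * 2 ^ T ≤ ((dyadicIndex T x + 1) * 2 ^ k) * 2 ^ T := by
          gcongr
      _ = _ := by ring

theorem measurable_dyadicIndex (T : ℕ) : Measurable (dyadicIndex T) :=
  (Nat.measurable_floor.comp (measurable_id.mul_const _)).min measurable_const

theorem measurableSet_dyadicIndex (T : ℕ) (P : ℕ → Prop) :
    MeasurableSet {x | P (dyadicIndex T x)} :=
  measurable_dyadicIndex T (MeasurableSet.of_discrete (s := {j | P j}))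

theorem measurableSet_dyadicCell (T j : ℕ) : MeasurableSet (dyadicCell T j) :=
  measurableSet_Icc.inter (measurableSet_dyadicIndex T (· = j))

theorem dyadicCell_subset (T j : ℕ) :
    dyadicCell T j ⊆ Icc ((j : ℝ) / 2 ^ T) (((j : ℝ) + 1) / 2 ^ T) := by
  rintro x ⟨hx, rfl⟩
  exact ⟨dyadicIndex_le hx, le_dyadicIndex hx⟩

theorem div_two_pow_mem {T j : ℕ} (hj : j ≤ 2 ^ T) : (j : ℝ) / 2 ^ T ∈ Icc (0 : ℝ) 1 := by
  refine ⟨by positivity, ?_⟩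
  rw [div_le_one (by positivity)]
  exact_mod_cast hj

theorem Ico_subset_dyadicCell {T j : ℕ} (hj : j < 2 ^ T) :
    Ico ((j : ℝ) / 2 ^ T) (((j : ℝ) + 1) / 2 ^ T) ⊆ dyadicCell T j := by
  intro x hx
  have h0 := (div_two_pow_mem hj.le).1
  have h1 := (div_two_pow_mem (T := T) (j := j + 1) hj).2
  push_cast at h1
  refine ⟨⟨h0.trans hx.1, hx.2.le.trans h1⟩, ?_⟩
  have : ⌊x * 2 ^ T⌋₊ = j := by
    rw [Nat.floor_eq_iff (mul_nonneg (h0.trans hx.1) (by positivity))]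
    exact ⟨(div_le_iff₀ (by positivity)).1 hx.1, (lt_div_iff₀ (by positivity)).1 hx.2⟩
  unfold dyadicIndex
  omega

theorem volume_dyadicCell {T j : ℕ} (hj : j < 2 ^ T) :
    volume (dyadicCell T j) = (2 : ℝ≥0∞)⁻¹ ^ T := by
  have e : ENNReal.ofReal (((j : ℝ) + 1) / 2 ^ T - j / 2 ^ T) = (2 : ℝ≥0∞)⁻¹ ^ T := by
    rw [← sub_div, add_sub_cancel_left, one_div, ← inv_pow, ENNReal.ofReal_pow (by positivity),
      ENNReal.ofReal_inv_of_pos (by positivity)]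
    simp
  apply le_antisymm
  · refine (measure_mono (dyadicCell_subset T j)).trans ?_
    rw [Real.volume_Icc, e]
  · refine le_trans ?_ (measure_mono (Ico_subset_dyadicCell hj))
    rw [Real.volume_Ico, e]

theorem pairwiseDisjoint_dyadicCell (T : ℕ) (s : Set ℕ) : s.PairwiseDisjoint (dyadicCell T) := by
  intro i _ j _ hij
  refine Set.disjoint_left.2 fun x hx hx' => hij (hx.2.symm.trans hx'.2)

theorem setOf_dyadicIndex_eq (T : ℕ) (P : ℕ → Prop) [DecidablePred P] :
    {x | x ∈ Icc (0 : ℝ) 1 ∧ P (dyadicIndex T x)} =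
      ⋃ j ∈ (Finset.range (2 ^ T)).filter P, dyadicCell T j := by
  ext x
  simp only [mem_ofPred_eq, Finset.mem_filter, Finset.mem_range, mem_iUnion, dyadicCell,
    exists_prop]
  exact ⟨fun h => ⟨_, ⟨dyadicIndex_lt T x, h.2⟩, h.1, rfl⟩, fun ⟨j, h, hx, e⟩ => ⟨hx, e ▸ h.2⟩⟩

theorem volume_setOf_dyadicIndex (T : ℕ) (P : ℕ → Prop) [DecidablePred P] :
    volume {x | x ∈ Icc (0 : ℝ) 1 ∧ P (dyadicIndex T x)} =
      ((Finset.range (2 ^ T)).filter P).card * (2 : ℝ≥0∞)⁻¹ ^ T := by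
  rw [setOf_dyadicIndex_eq, measure_biUnion_finset (pairwiseDisjoint_dyadicCell T _)
    fun j _ => measurableSet_dyadicCell T j, Finset.sum_congr rfl fun j hj => volume_dyadicCell
    (Finset.mem_range.1 (Finset.mem_filter.1 hj).1), Finset.sum_const, nsmul_eq_mul]

theorem volume_setOf_dyadicIndex_toReal (T : ℕ) (P : ℕ → Prop) [DecidablePred P] :
    (volume {x | x ∈ Icc (0 : ℝ) 1 ∧ P (dyadicIndex T x)}).toReal =
      ((∑ j ∈ Finset.range (2 ^ T), if P j then (1 : ℚ) else 0) / 2 ^ T : ℚ) := by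
  rw [volume_setOf_dyadicIndex, Finset.sum_boole]
  simp [div_eq_mul_inv]

theorem lintegral_eq_sum_dyadicCell (T : ℕ) (F : ℝ → ℝ≥0∞) :
    ∫⁻ x in Icc (0 : ℝ) 1, F x = ∑ j ∈ Finset.range (2 ^ T), ∫⁻ x in dyadicCell T j, F x := by
  have : Icc (0 : ℝ) 1 = ⋃ j ∈ Finset.range (2 ^ T), dyadicCell T j := by
    have := setOf_dyadicIndex_eq T fun _ => True
    simp only [and_true, Finset.filter_true] at this
    exact this
  rw [this, lintegral_biUnion_finset (pairwiseDisjoint_dyadicCell T _)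
    fun j _ => measurableSet_dyadicCell T j]

/-! ### Approximation of effective unions by dyadic cells -/

/-- The dyadic cell of level `T` and index `j` is well inside one of the first `s` intervals. -/
def InCell (c : ℕ → RatCode × RatCode) (s T j : ℕ) : Prop :=
  ∃ i < s, (c i).1.val < (j : ℚ) / 2 ^ T ∧ ((j : ℚ) + 1) / 2 ^ T < (c i).2.val

theorem computablePred_inCell {α : Type*} [Primcodable α] {c : α → ℕ → RatCode × RatCode}
    {s T j : α → ℕ} (hc : Computable₂ c) (hs : Computable s) (hT : Computable T)
    (hj : Computable j) : ComputablePred fun a => InCell (c a) (s a) (T a) (j a) := by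
  have hc' : Computable fun x : α × ℕ => c x.1 x.2 := hc
  refine ComputablePred.exists_lt (ComputablePred.and ?_ ?_) hs
  · exact ComputableRat.lt (by fun_prop) (by fun_prop)
  · exact ComputableRat.lt (by fun_prop) (by fun_prop)

theorem InCell.mono {c : ℕ → RatCode × RatCode} {s s' T T' : ℕ} {x : ℝ} (hs : s ≤ s')
    (hT : T ≤ T') (h : InCell c s T (dyadicIndex T x)) : InCell c s' T' (dyadicIndex T' x) := by
  obtain ⟨i, hi, h1, h2⟩ := h
  obtain ⟨h3, h4⟩ := dyadicIndex_div_le_of_le hT x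
  exact ⟨i, hi.trans_le hs, h1.trans_le h3, h4.trans_lt h2⟩

theorem InCell.mem {c : ℕ → RatCode × RatCode} {s T : ℕ} {x : ℝ} (hx : x ∈ Icc (0 : ℝ) 1)
    (h : InCell c s T (dyadicIndex T x)) :
    ∃ i < s, x ∈ Ioo ((c i).1.val : ℝ) ((c i).2.val : ℝ) := by
  obtain ⟨i, hi, h1, h2⟩ := h
  refine ⟨i, hi, ?_, ?_⟩
  · refine lt_of_lt_of_le ?_ (dyadicIndex_le (T := T) hx)
    simpa using (Rat.cast_lt (K := ℝ)).2 h1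
  · refine (le_dyadicIndex (T := T) hx).trans_lt ?_
    simpa using (Rat.cast_lt (K := ℝ)).2 h2

/-- The union of the dyadic cells of level `T` that are inside one of the first `s` intervals. -/
def cellUnion (c : ℕ → RatCode × RatCode) (s T : ℕ) : Set ℝ :=
  {x | x ∈ Icc (0 : ℝ) 1 ∧ InCell c s T (dyadicIndex T x)}

theorem measurableSet_cellUnion (c : ℕ → RatCode × RatCode) (s T : ℕ) :
    MeasurableSet (cellUnion c s T) :=
  measurableSet_Icc.inter (measurableSet_dyadicIndex T (InCell c s T))

/-- The measure of `cellUnion`. -/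
def cellVolume (c : ℕ → RatCode × RatCode) (s T : ℕ) : ℚ :=
  open Classical in (∑ j ∈ Finset.range (2 ^ T), if InCell c s T j then (1 : ℚ) else 0) / 2 ^ T

theorem volume_cellUnion (c : ℕ → RatCode × RatCode) (s T : ℕ) :
    (volume (cellUnion c s T)).toReal = cellVolume c s T := by
  classical
  rw [cellUnion, volume_setOf_dyadicIndex_toReal, cellVolume]

theorem computableRat_cellVolume {α : Type*} [Primcodable α] {c : α → ℕ → RatCode × RatCode}
    {s T : α → ℕ} (hc : Computable₂ c) (hs : Computable s) (hT : Computable T) :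
    ComputableRat fun a => cellVolume (c a) (s a) (T a) := by
  classical
  have hc' : Computable fun x : α × ℕ => c x.1 x.2 := hc
  unfold cellVolume
  refine ComputableRat.div_pow (ComputableRat.sum (ComputableRat.ite ?_ (by fun_prop)
    (by fun_prop)) (by fun_prop)) hT 2
  exact computablePred_inCell (c := fun x : α × ℕ => c x.1)
    (hc'.comp (f := fun x : α × ℕ => c x.1 x.2) (g := fun x : (α × ℕ) × ℕ => (x.1.1, x.2))
      (by fun_prop)) (by fun_prop) (by fun_prop) (by fun_prop)

/-- The interval is open, so a cell around `x` that is shorter than the distance to both end points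
lies strictly inside; cells are nested, so this persists at later stages. -/
theorem exists_inCell {c : ℕ → RatCode × RatCode} {x : ℝ} (hx : x ∈ Icc (0 : ℝ) 1) {i : ℕ}
    (h : x ∈ Ioo ((c i).1.val : ℝ) ((c i).2.val : ℝ)) :
    ∃ s, ∀ t, s ≤ t → InCell c t t (dyadicIndex t x) := by
  obtain ⟨n, hn⟩ := exists_pow_lt_of_lt_one (lt_min (sub_pos.2 h.1) (sub_pos.2 h.2))
    (by norm_num : (2 : ℝ)⁻¹ < 1)
  have hs : InCell c (max n (i + 1)) n (dyadicIndex n x) := by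
    refine ⟨i, by omega, ?_, ?_⟩
    · rw [← Rat.cast_lt (K := ℝ)]
      have h1 := le_dyadicIndex (T := n) hx
      have h2 := hn.trans_le (min_le_left _ _)
      push_cast
      rw [inv_pow, ← one_div] at h2
      rw [add_div] at h1
      linarith
    · rw [← Rat.cast_lt (K := ℝ)]
      have h1 := dyadicIndex_le (T := n) hx
      have h2 := hn.trans_le (min_le_right _ _)
      push_cast
      rw [inv_pow, ← one_div] at h2
      rw [add_div]
      linarith
  exact ⟨max n (i + 1), fun t ht => hs.mono ht (by omega)⟩

/-- A point of an interval whose cell is not well inside it is within 2^(-T) of an end point. This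
gives two strips of width 2^(-T) for each interval. -/
theorem volume_sdiff_cellUnion_le (c : ℕ → RatCode × RatCode) (s T : ℕ) :
    volume ((Icc (0 : ℝ) 1 ∩ ⋃ i < s, Ioo ((c i).1.val : ℝ) ((c i).2.val : ℝ)) \ cellUnion c s T)
      ≤ s * (2 * (2 : ℝ≥0∞)⁻¹ ^ T) := by
  have key : (Icc (0 : ℝ) 1 ∩ ⋃ i < s, Ioo ((c i).1.val : ℝ) ((c i).2.val : ℝ)) \ cellUnion c s T ⊆
      ⋃ i ∈ Finset.range s, (Icc ((c i).1.val : ℝ) ((c i).1.val + (2 : ℝ)⁻¹ ^ T) ∪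
        Icc ((c i).2.val - (2 : ℝ)⁻¹ ^ T : ℝ) ((c i).2.val)) := by
    rintro x ⟨⟨hx, hxU⟩, hxC⟩
    simp only [mem_iUnion, exists_prop] at hxU
    obtain ⟨i, hi, hxi⟩ := hxU
    simp only [mem_iUnion, Finset.mem_range, exists_prop]
    refine ⟨i, hi, ?_⟩
    by_contra hcon
    simp only [mem_union, mem_Icc, not_or, not_and, not_le] at hcon
    have h1 := hcon.1 hxi.1.le
    have h2 : x < (c i).2.val - (2 : ℝ)⁻¹ ^ T := by
      by_contra h
      exact absurd (hcon.2 (not_lt.1 h)) (not_lt.2 hxi.2.le)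
    refine hxC ⟨hx, i, hi, ?_, ?_⟩ <;> rw [← Rat.cast_lt (K := ℝ)] <;> push_cast
    · have h3 := le_dyadicIndex (T := T) hx
      rw [add_div] at h3
      rw [inv_pow, ← one_div] at h1
      linarith
    · have h3 := dyadicIndex_le (T := T) hx
      rw [inv_pow, ← one_div] at h2
      rw [add_div]
      linarith
  refine (measure_mono key).trans ((measure_biUnion_finset_le _ _).trans ?_)
  refine (Finset.sum_le_card_nsmul _ _ (2 * (2 : ℝ≥0∞)⁻¹ ^ T) fun i _ => ?_).trans (by simp)
  refine (measure_union_le _ _).trans ?_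
  simp only [Real.volume_Icc, add_sub_cancel_left, sub_sub_cancel]
  rw [ENNReal.ofReal_pow (by positivity), ENNReal.ofReal_inv_of_pos (by positivity), two_mul]
  simp

theorem cellUnion_subset (c : ℕ → RatCode × RatCode) (s T : ℕ) :
    cellUnion c s T ⊆ Icc (0 : ℝ) 1 ∩ ⋃ i < s, Ioo ((c i).1.val : ℝ) ((c i).2.val : ℝ) := by
  rintro x ⟨hx, h⟩
  obtain ⟨i, hi, h⟩ := h.mem hx
  exact ⟨hx, mem_iUnion₂.2 ⟨i, hi, h⟩⟩

theorem isCauchyName_of_abs_sub_le {a : ℕ → RatCode} {x : ℝ}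
    (h : ∀ n, |((a n).val : ℝ) - x| ≤ (2 : ℝ)⁻¹ ^ (n + 1)) : IsCauchyName a x := by
  refine ⟨fun n k hnk => ?_, ?_⟩
  · have h1 := h n
    have h2 := h k
    have h3 : (2 : ℝ)⁻¹ ^ (k + 1) ≤ (2 : ℝ)⁻¹ ^ (n + 1) :=
      pow_le_pow_of_le_one (by norm_num) (by norm_num) (by omega)
    have h4 : (2 : ℝ)⁻¹ ^ n = (2 : ℝ)⁻¹ ^ (n + 1) + (2 : ℝ)⁻¹ ^ (n + 1) := by ring
    rw [abs_le] at *
    constructor <;> linarith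
  · rw [tendsto_iff_dist_tendsto_zero]
    refine squeeze_zero (g := fun n => (2 : ℝ)⁻¹ ^ (n + 1)) (fun _ => dist_nonneg) h ?_
    exact (tendsto_pow_atTop_nhds_zero_of_lt_one (r := (2 : ℝ)⁻¹) (by norm_num)
      (by norm_num)).comp (tendsto_add_atTop_nat 1)

theorem IsCauchyName.abs_sub_le {a : ℕ → RatCode} {x : ℝ} (h : IsCauchyName a x) (n : ℕ) :
    |((a n).val : ℝ) - x| ≤ (2 : ℝ)⁻¹ ^ n := by
  refine le_of_tendsto ((tendsto_const_nhds.sub h.2).abs) ?_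
  filter_upwards [eventually_ge_atTop n] with k hk using h.1 n k hk

/-- If the measure of an effective union is approximated at a computable rate by that of its finite
stages, it is computable. -/
theorem uniformlyComputableReals_volume {c : ℕ → ℕ → RatCode × RatCode} (hc : Computable₂ c)
    {h : ℕ × ℕ → ℕ} (hh : Computable h)
    (hvol : ∀ m n, volume ((Icc (0 : ℝ) 1 ∩ ⋃ i, Ioo ((c m i).1.val : ℝ) ((c m i).2.val : ℝ)) \
      ⋃ i < h (m, n), Ioo ((c m i).1.val : ℝ) ((c m i).2.val : ℝ)) ≤ (2 : ℝ≥0∞)⁻¹ ^ n) :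
    UniformlyComputableReals fun m =>
      (volume (Icc (0 : ℝ) 1 ∩ ⋃ i, Ioo ((c m i).1.val : ℝ) ((c m i).2.val : ℝ))).toReal := by
  have hc' : Computable fun x : ℕ × ℕ => c x.1 x.2 := hc
  -- With s intervals the cells miss at most s · 2 · 2^(-T) ≤ 2^s · 2^(1-T), which is 2^(-(n+2)) for
  -- T = s + n + 3. The intervals after the first s account for the same amount, and together this
  -- is the error 2^(-(n+1)) that a Cauchy name tolerates.
  let T : ℕ × ℕ → ℕ := fun x => h (x.1, x.2 + 2) + x.2 + 3
  obtain ⟨a, ha, hav⟩ := computableRat_cellVolume (c := fun x : ℕ × ℕ => c x.1)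
    (s := fun x => h (x.1, x.2 + 2)) (T := T)
    (hc'.comp (f := fun x : ℕ × ℕ => c x.1 x.2) (g := fun x : (ℕ × ℕ) × ℕ => (x.1.1, x.2))
      (by fun_prop)) (by fun_prop) (by fun_prop)
  refine ⟨fun m n => a (m, n), ha, fun m => isCauchyName_of_abs_sub_le fun n => ?_⟩
  rw [hav, ← volume_cellUnion]
  set G := Icc (0 : ℝ) 1 ∩ ⋃ i, Ioo ((c m i).1.val : ℝ) ((c m i).2.val : ℝ) with hG
  set s := h (m, n + 2)
  set F := ⋃ i < s, Ioo ((c m i).1.val : ℝ) ((c m i).2.val : ℝ) with hF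
  have hsub : cellUnion (c m) s (T (m, n)) ⊆ G :=
    (cellUnion_subset _ _ _).trans (inter_subset_inter_right _
      (iUnion_mono fun i => iUnion_subset fun _ => subset_rfl))
  have hGfin : volume G ≠ ∞ :=
    ne_top_of_le_ne_top (by simp) (measure_mono (inter_subset_left (s := Icc (0 : ℝ) 1)))
  have hCfin := ne_top_of_le_ne_top hGfin (measure_mono hsub)
  have hdiff : volume (G \ cellUnion (c m) s (T (m, n))) ≤ (2 : ℝ≥0∞)⁻¹ ^ (n + 1) := by
    have h1 : G \ cellUnion (c m) s (T (m, n)) ⊆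
        (G \ F) ∪ ((Icc (0 : ℝ) 1 ∩ F) \ cellUnion (c m) s (T (m, n))) := by
      rintro x ⟨hx, hx'⟩
      by_cases hxF : x ∈ F
      exacts [.inr ⟨⟨hx.1, hxF⟩, hx'⟩, .inl ⟨hx, hxF⟩]
    refine (measure_mono h1).trans ((measure_union_le _ _).trans ?_)
    have e : (2 : ℝ≥0∞)⁻¹ ^ (n + 1) = (2 : ℝ≥0∞)⁻¹ ^ (n + 2) + (2 : ℝ≥0∞)⁻¹ ^ (n + 2) := by
      rw [← two_mul, pow_succ _ (n + 1), mul_comm (2 : ℝ≥0∞), mul_assoc,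
        ENNReal.inv_mul_cancel (by simp) (by simp), mul_one]
    rw [e]
    refine add_le_add (hvol m (n + 2)) ((volume_sdiff_cellUnion_le (c m) s _).trans ?_)
    have h2 : (s : ℝ≥0∞) ≤ 2 ^ s := by exact_mod_cast s.lt_two_pow_self.le
    have h3 : (2 : ℝ≥0∞) ^ s * (2 : ℝ≥0∞)⁻¹ ^ s = 1 := by
      rw [← mul_pow, ENNReal.mul_inv_cancel (by simp) (by simp), one_pow]
    calc (s : ℝ≥0∞) * (2 * (2 : ℝ≥0∞)⁻¹ ^ (s + n + 3))
        ≤ 2 ^ s * (2 * (2 : ℝ≥0∞)⁻¹ ^ (s + n + 3)) := by gcongr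
      _ = (2 ^ s * (2 : ℝ≥0∞)⁻¹ ^ s) * (2 * 2⁻¹) * (2 : ℝ≥0∞)⁻¹ ^ (n + 2) := by
          rw [pow_add, pow_add, pow_add _ n 2]; ring
      _ = (2 : ℝ≥0∞)⁻¹ ^ (n + 2) := by
          rw [h3, ENNReal.mul_inv_cancel (by simp) (by simp), one_mul, one_mul]
  have hle : volume G ≤ volume (cellUnion (c m) s (T (m, n))) + (2 : ℝ≥0∞)⁻¹ ^ (n + 1) := by
    refine (measure_mono (t := cellUnion (c m) s (T (m, n)) ∪ (G \ cellUnion (c m) s (T (m, n))))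
      (by simp)).trans ((measure_union_le _ _).trans ?_)
    gcongr
  have hle' := ENNReal.toReal_mono (by finiteness) hle
  rw [ENNReal.toReal_add hCfin (by finiteness)] at hle'
  have hge := ENNReal.toReal_mono hGfin (measure_mono hsub)
  simp only [ENNReal.toReal_pow, ENNReal.toReal_inv, ENNReal.toReal_ofNat] at hle'
  rw [abs_le]
  constructor
  · linarith
  · have : (0 : ℝ) ≤ (2 : ℝ)⁻¹ ^ (n + 1) := by positivity
    linarith

/-! ### A discrete maximal inequality -/

/-- Some average of `a` over a block of indices below `N` that starts at `i` exceeds `δ`. -/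
def LargeAverageRight (a : ℕ → ℚ) (δ : ℚ) (N i : ℕ) : Prop :=
  ∃ j < N + 1, i < j ∧ δ * ((j - i : ℕ) : ℚ) < ∑ k ∈ Finset.range (j - i), a (i + k)

/-- Some average of `a` over a block of indices that starts or ends at `i` exceeds `δ`. -/
def LargeAverage (a : ℕ → ℚ) (δ : ℚ) (N i : ℕ) : Prop :=
  LargeAverageRight a δ N i ∨ LargeAverageRight (fun k => a (N - 1 - k)) δ N (N - 1 - i)

theorem sum_le_of_not_largeAverageRight {a : ℕ → ℚ} {δ : ℚ} {N i j : ℕ}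
    (h : ¬ LargeAverageRight a δ N i) (hij : i ≤ j) (hj : j ≤ N) :
    ∑ k ∈ Finset.Ico i j, a k ≤ δ * ((j : ℚ) - i) := by
  rcases hij.eq_or_lt with rfl | hij
  · simp
  by_contra hcon
  refine h ⟨j, by omega, hij, ?_⟩
  rw [← Finset.sum_Ico_eq_sum_range, Nat.cast_sub hij.le]
  exact not_le.1 hcon

-- Greedy covering from left to right. If a block starting at `s` has a large average, its sum pays
-- for all of its indices at once and the count resumes at its end `j`; otherwise `s` is not counted
-- and the term `a s ≥ 0` is dropped.
open Classical in
theorem mul_card_largeAverageRight_Ico_le {a : ℕ → ℚ} (ha : ∀ i, 0 ≤ a i) {δ : ℚ} (hδ : 0 ≤ δ)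
    (N : ℕ) (d s : ℕ) (hs : s + d = N) :
    δ * ((Finset.Ico s N).filter (LargeAverageRight a δ N)).card ≤ ∑ i ∈ Finset.Ico s N, a i := by
  induction d using Nat.strong_induction_on generalizing s with
  | _ d ih =>
    rcases Nat.eq_zero_or_pos d with rfl | hd
    · simp [show s = N by omega]
    by_cases hb : LargeAverageRight a δ N s
    · obtain ⟨j, hjN, hsj, hj⟩ := hb
      rw [← Finset.sum_Ico_eq_sum_range] at hj
      have h1 := ih (N - j) (by omega) j (by omega)
      rw [← Finset.sum_Ico_consecutive a hsj.le (Nat.lt_succ_iff.1 hjN)]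
      have h2 : ((Finset.Ico s N).filter (LargeAverageRight a δ N)).card ≤
          (j - s) + ((Finset.Ico j N).filter (LargeAverageRight a δ N)).card := by
        rw [← Nat.card_Ico s j]
        refine (Finset.card_le_card ?_).trans (Finset.card_union_le _ _)
        intro i hi
        simp only [Finset.mem_union, Finset.mem_Ico, Finset.mem_filter] at hi ⊢
        by_cases hij : i < j
        exacts [.inl ⟨hi.1.1, hij⟩, .inr ⟨⟨not_lt.1 hij, hi.1.2⟩, hi.2⟩]
      have h3 : (((Finset.Ico s N).filter (LargeAverageRight a δ N)).card : ℚ) ≤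
          ((j - s : ℕ) : ℚ) + ((Finset.Ico j N).filter (LargeAverageRight a δ N)).card := by
        exact_mod_cast h2
      calc _ ≤ δ * (((j - s : ℕ) : ℚ) +
            ((Finset.Ico j N).filter (LargeAverageRight a δ N)).card) := by gcongr
        _ ≤ _ := by rw [mul_add]; exact add_le_add hj.le h1
    · have h1 := ih (d - 1) (by omega) (s + 1) (by omega)
      have h2 : (Finset.Ico s N).filter (LargeAverageRight a δ N) =
          (Finset.Ico (s + 1) N).filter (LargeAverageRight a δ N) := by
        ext i
        simp only [Finset.mem_Ico, Finset.mem_filter]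
        constructor
        · rintro ⟨⟨h, h'⟩, hi⟩
          refine ⟨⟨?_, h'⟩, hi⟩
          rcases h.eq_or_lt with rfl | h
          exacts [absurd hi hb, h]
        · rintro ⟨⟨h, h'⟩, hi⟩
          exact ⟨⟨by omega, h'⟩, hi⟩
      rw [h2, Finset.sum_eq_sum_Ico_succ_bot (by omega : s < N)]
      linarith [ha s]

-- The one-sided inequality is applied to `a` and to its reflection i ↦ N - 1 - i, whence the factor
-- 2.
open Classical in
theorem mul_card_largeAverage_le {a : ℕ → ℚ} (ha : ∀ i, 0 ≤ a i) {δ : ℚ} (hδ : 0 ≤ δ) (N : ℕ) :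
    δ * ((Finset.range N).filter (LargeAverage a δ N)).card ≤ 2 * ∑ i ∈ Finset.range N, a i := by
  have h1 := mul_card_largeAverageRight_Ico_le ha hδ N N 0 (by omega)
  have h2 := mul_card_largeAverageRight_Ico_le (a := fun k => a (N - 1 - k)) (fun i => ha _) hδ N N
    0 (by omega)
  rw [← Finset.range_eq_Ico] at h1 h2
  rw [Finset.sum_range_reflect] at h2
  have h3 : ((Finset.range N).filter (LargeAverage a δ N)).card ≤
      ((Finset.range N).filter (LargeAverageRight a δ N)).card +
      ((Finset.range N).filter (LargeAverageRight (fun k => a (N - 1 - k)) δ N)).card := by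
    have : ((Finset.range N).filter (LargeAverage a δ N)) =
        (Finset.range N).filter (LargeAverageRight a δ N) ∪
        ((Finset.range N).filter fun i =>
          LargeAverageRight (fun k => a (N - 1 - k)) δ N (N - 1 - i)) := by
      ext i
      simp only [Finset.mem_filter, Finset.mem_union, LargeAverage, and_or_left]
    rw [this]
    refine (Finset.card_union_le _ _).trans (Nat.add_le_add_left ?_ _)
    refine Finset.card_le_card_of_injOn (fun i => N - 1 - i) ?_ ?_
    · intro i hi
      simp only [Finset.coe_filter, Finset.mem_range, mem_ofPred_eq] at hi ⊢
      exact ⟨by omega, hi.2⟩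
    · intro i hi j hj hij
      simp only [Finset.coe_filter, Finset.mem_range, mem_ofPred_eq] at hi hj hij
      omega
  have h4 : (((Finset.range N).filter (LargeAverage a δ N)).card : ℚ) ≤
      ((Finset.range N).filter (LargeAverageRight a δ N)).card +
      ((Finset.range N).filter (LargeAverageRight (fun k => a (N - 1 - k)) δ N)).card := by
    exact_mod_cast h3
  have h5 := mul_le_mul_of_nonneg_left h4 hδ
  rw [mul_add] at h5
  linarith

theorem computablePred_largeAverageRight {α : Type*} [Primcodable α] {a : α → ℕ → ℚ} {δ : α → ℚ}
    {N i : α → ℕ} (ha : ComputableRat fun x : α × ℕ => a x.1 x.2) (hδ : ComputableRat δ)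
    (hN : Computable N) (hi : Computable i) :
    ComputablePred fun x => LargeAverageRight (a x) (δ x) (N x) (i x) := by
  refine ComputablePred.exists_lt (ComputablePred.and (ComputablePred.nat_lt (by fun_prop)
    (by fun_prop)) (ComputableRat.lt ?_ ?_)) (by fun_prop)
  · exact (hδ.comp (g := fun x : α × ℕ => x.1) (by fun_prop)).mul (by fun_prop)
  · refine ComputableRat.sum ?_ (by fun_prop)
    exact ha.comp (f := fun x : α × ℕ => a x.1 x.2)
      (g := fun x : (α × ℕ) × ℕ => (x.1.1, i x.1.1 + x.2)) (by fun_prop)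

theorem computablePred_largeAverage {α : Type*} [Primcodable α] {a : α → ℕ → ℚ} {δ : α → ℚ}
    {N i : α → ℕ} (ha : ComputableRat fun x : α × ℕ => a x.1 x.2) (hδ : ComputableRat δ)
    (hN : Computable N) (hi : Computable i) :
    ComputablePred fun x => LargeAverage (a x) (δ x) (N x) (i x) := by
  refine (computablePred_largeAverageRight ha hδ hN hi).or
    (computablePred_largeAverageRight ?_ hδ hN (by fun_prop))
  exact ha.comp (f := fun x : α × ℕ => a x.1 x.2)
    (g := fun x : α × ℕ => (x.1, N x.1 - 1 - x.2)) (by fun_prop)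

theorem exists_cell {N : ℕ} (hN : 0 < N) {y : ℝ} (hy : y ∈ Icc (0 : ℝ) 1) :
    ∃ j < N, y ∈ Icc ((j : ℝ) / N) (((j : ℝ) + 1) / N) := by
  have hN' : (0 : ℝ) < N := by exact_mod_cast hN
  rcases hy.2.eq_or_lt with rfl | h1
  · refine ⟨N - 1, by omega, ?_, ?_⟩
    · rw [div_le_one hN']; exact_mod_cast Nat.sub_le N 1
    · rw [le_div_iff₀ hN', Nat.cast_sub hN]; simp
  · refine ⟨⌊y * N⌋₊, ?_, ?_, ?_⟩
    · rw [Nat.floor_lt (mul_nonneg hy.1 hN'.le)]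
      exact mul_lt_of_lt_one_left hN' h1
    · rw [div_le_iff₀ hN']; exact Nat.floor_le (mul_nonneg hy.1 hN'.le)
    · rw [le_div_iff₀ hN']; exact (Nat.lt_floor_add_one _).le

/-- The increment from `x` to `y` splits into the rest of cell `i`, some full cells, and an initial
part of cell `j`. The assumption at `i` gives slope at most `δ` on cell `i`; the one at `i + 1`
controls the blocks that follow. -/
theorem abs_sub_le_of_not_largeAverageRight {a : ℕ → ℚ} {δ : ℚ} {N : ℕ} (hN : 0 < N) {g : ℝ → ℝ}
    (hg : ∀ i < N, ∀ x ∈ Icc ((i : ℝ) / N) (((i : ℝ) + 1) / N),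
      ∀ y ∈ Icc ((i : ℝ) / N) (((i : ℝ) + 1) / N), |g x - g y| ≤ a i * |x - y|)
    {i : ℕ} (hi : i < N) (h₀ : ¬ LargeAverageRight a δ N i)
    (h₁ : ¬ LargeAverageRight a δ N (i + 1)) {x y : ℝ}
    (hx : x ∈ Icc ((i : ℝ) / N) (((i : ℝ) + 1) / N)) (hxy : x ≤ y) (hy : y ∈ Icc (0 : ℝ) 1) :
    |g y - g x| ≤ δ * (y - x) := by
  have hN' : (0 : ℝ) < N := by exact_mod_cast hN
  have hai : (a i : ℝ) ≤ δ := by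
    have := sum_le_of_not_largeAverageRight h₀ (Nat.le_succ i) hi
    simp at this
    exact_mod_cast this
  rcases le_or_gt y (((i : ℝ) + 1) / N) with hyi | hyi
  · refine (hg i hi y ⟨hx.1.trans hxy, hyi⟩ x hx).trans ?_
    rw [abs_of_nonneg (sub_nonneg.2 hxy)]
    exact mul_le_mul_of_nonneg_right hai (sub_nonneg.2 hxy)
  obtain ⟨j, hjN, hj⟩ := exists_cell hN hy
  have hij : i + 1 ≤ j := by
    have := hyi.trans_le hj.2
    rw [div_lt_div_iff_of_pos_right hN'] at this
    have : i < j := by exact_mod_cast (by linarith : (i : ℝ) < j)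
    exact this
  have chain : ∀ k, i + 1 ≤ k → k ≤ N → |g ((k : ℝ) / N) - g (((i : ℝ) + 1) / N)| ≤
      (∑ l ∈ Finset.Ico (i + 1) k, (a l : ℝ)) / N := by
    intro k hk
    induction k, hk using Nat.le_induction with
    | base => intro; simp
    | succ k hk ih =>
      intro hkN
      have h1 := ih (by omega)
      have h2 := hg k (by omega) (((k : ℝ) + 1) / N) ⟨by gcongr; linarith, le_rfl⟩ ((k : ℝ) / N)
        ⟨le_rfl, by gcongr; linarith⟩
      rw [← sub_div, add_sub_cancel_left, abs_of_pos (by positivity : (0 : ℝ) < 1 / N)] at h2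
      rw [Finset.sum_Ico_succ_top hk]
      push_cast
      calc _ ≤ |g ((k : ℝ) / N) - g (((i : ℝ) + 1) / N)| +
            |g (((k : ℝ) + 1) / N) - g ((k : ℝ) / N)| := by
              rw [add_comm (|g ((k : ℝ) / N) - g (((i : ℝ) + 1) / N)|)]; exact abs_sub_le _ _ _
        _ ≤ _ := (add_le_add h1 h2).trans_eq (by ring)
  have c1 := chain j hij hjN.le
  have c2 := hg j hjN y hj ((j : ℝ) / N) ⟨le_rfl, by gcongr; linarith⟩
  rw [abs_of_nonneg (sub_nonneg.2 hj.1)] at c2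
  have c3 := hg i hi (((i : ℝ) + 1) / N) ⟨by gcongr; linarith, le_rfl⟩ x hx
  rw [abs_of_nonneg (sub_nonneg.2 hx.2)] at c3
  have s1 : (∑ l ∈ Finset.Ico (i + 1) j, (a l : ℝ)) ≤ δ * ((j : ℝ) - (i + 1)) := by
    have := sum_le_of_not_largeAverageRight h₁ hij hjN.le
    exact_mod_cast this
  have s2 : (∑ l ∈ Finset.Ico (i + 1) j, (a l : ℝ)) + a j ≤ δ * ((j : ℝ) + 1 - (i + 1)) := by
    have := sum_le_of_not_largeAverageRight h₁ (Nat.le_succ_of_le hij) hjN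
    rw [Finset.sum_Ico_succ_top hij] at this
    exact_mod_cast this
  set S := ∑ l ∈ Finset.Ico (i + 1) j, (a l : ℝ)
  set t := y * N - j with ht
  have ht0 : 0 ≤ t := by have := (div_le_iff₀ hN').1 hj.1; linarith
  have ht1 : 0 ≤ 1 - t := by have := (le_div_iff₀ hN').1 hj.2; linarith
  have e1 : y - (j : ℝ) / N = t / N := by rw [ht]; field_simp
  have e2 : y - ((i : ℝ) + 1) / N = (j - (i + 1) + t) / N := by rw [ht]; field_simp; ring
  -- The point `y` divides cell `j` in the ratio t : 1 - t, so this is the convex combination of the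
  -- bounds for the blocks that exclude and include cell `j`.
  have s3 : S + a j * t ≤ δ * (j - (i + 1) + t) := by
    nlinarith [mul_le_mul_of_nonneg_left s1 ht1, mul_le_mul_of_nonneg_left s2 ht0]
  have s4 : S / N + a j * (y - (j : ℝ) / N) ≤ δ * (y - ((i : ℝ) + 1) / N) := by
    rw [e1, e2, ← mul_div_assoc, ← add_div, ← mul_div_assoc]
    gcongr
  have s5 : (a i : ℝ) * (((i : ℝ) + 1) / N - x) ≤ δ * (((i : ℝ) + 1) / N - x) :=
    mul_le_mul_of_nonneg_right hai (sub_nonneg.2 hx.2)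
  calc |g y - g x| ≤ |g y - g ((j : ℝ) / N)| + (|g ((j : ℝ) / N) - g (((i : ℝ) + 1) / N)| +
        |g (((i : ℝ) + 1) / N) - g x|) :=
        (abs_sub_le _ (g ((j : ℝ) / N)) _).trans (by gcongr; exact abs_sub_le _ _ _)
    _ ≤ a j * (y - (j : ℝ) / N) + (S / N + a i * (((i : ℝ) + 1) / N - x)) := by gcongr
    _ ≤ δ * (y - x) := by linarith

/-- Away from the cells where some average of `a` is large, the function `g` has small slopes, if
`a` bounds the slopes of `g` on the cells. -/
theorem abs_sub_le_of_not_largeAverage {a : ℕ → ℚ} {δ : ℚ} {N : ℕ} (hN : 0 < N) {g : ℝ → ℝ}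
    (hg : ∀ i < N, ∀ x ∈ Icc ((i : ℝ) / N) (((i : ℝ) + 1) / N),
      ∀ y ∈ Icc ((i : ℝ) / N) (((i : ℝ) + 1) / N), |g x - g y| ≤ a i * |x - y|)
    {x : ℝ} (hx : x ∈ Icc (0 : ℝ) 1)
    (h : ∀ i < N, x ∈ Ioo (((i : ℝ) - 2) / N) (((i : ℝ) + 3) / N) → ¬ LargeAverage a δ N i)
    {y : ℝ} (hy : y ∈ Icc (0 : ℝ) 1) : |g y - g x| ≤ δ * |y - x| := by
  have hN' : (0 : ℝ) < N := by exact_mod_cast hN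
  obtain ⟨i, hi, hxi⟩ := exists_cell hN hx
  -- A neighbour `k` of the cell of `x` has `x` within [(k-1)/N, (k+2)/N]; the hypothesis leaves one
  -- spare cell on each side so that its intervals can be open.
  have hgood : ∀ k < N, k ≤ i + 1 → i ≤ k + 1 → ¬ LargeAverage a δ N k := by
    intro k hk h1 h2
    have h1' : (k : ℝ) ≤ i + 1 := by exact_mod_cast h1
    have h2' : (i : ℝ) ≤ k + 1 := by exact_mod_cast h2
    refine h k hk ⟨lt_of_lt_of_le ?_ hxi.1, lt_of_le_of_lt hxi.2 ?_⟩ <;>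
      exact (div_lt_div_iff_of_pos_right hN').2 (by linarith)
  have hN1 : ∀ b : ℕ → ℚ, ¬ LargeAverageRight b δ N N := by
    rintro b ⟨j, h1, h2, -⟩
    omega
  rcases le_total x y with hxy | hxy
  · rw [abs_of_nonneg (sub_nonneg.2 hxy)]
    refine abs_sub_le_of_not_largeAverageRight hN hg hi
      (fun hc => hgood i hi (by omega) (by omega) (.inl hc)) ?_ hxi hxy hy
    rcases (show i + 1 ≤ N from hi).eq_or_lt with h' | h'
    · rw [h']; exact hN1 a
    · exact fun hc => hgood (i + 1) h' (by omega) (by omega) (.inl hc)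
  -- For `y ≤ x` everything is reflected by u ↦ 1 - u, which turns blocks ending at `i` into blocks
  -- starting at `N - 1 - i`.
  · have hrev : ∀ k < N, ((N - 1 - k : ℕ) : ℝ) = N - 1 - k := by
      intro k hk
      rw [Nat.sub_sub, Nat.cast_sub (by omega)]
      push_cast
      ring
    have hcell : ∀ k < N, ∀ u, u ∈ Icc ((k : ℝ) / N) (((k : ℝ) + 1) / N) →
        1 - u ∈ Icc (((N - 1 - k : ℕ) : ℝ) / N) ((((N - 1 - k : ℕ) : ℝ) + 1) / N) := by
      intro k hk u hu
      rw [hrev k hk]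
      have h1 := (div_le_iff₀ hN').1 hu.1
      have h2 := (le_div_iff₀ hN').1 hu.2
      constructor
      · rw [div_le_iff₀ hN']; linarith
      · rw [le_div_iff₀ hN']; linarith
    have key := abs_sub_le_of_not_largeAverageRight (a := fun k => a (N - 1 - k)) (δ := δ) hN
      (g := fun u => g (1 - u)) (fun k hk u hu v hv => by
        have := hg (N - 1 - k) (by omega) (1 - u) (hcell k hk u hu) (1 - v) (hcell k hk v hv)
        rwa [sub_sub_sub_cancel_left, abs_sub_comm v u] at this)
      (i := N - 1 - i) (by omega) (fun hc => hgood i hi (by omega) (by omega) (.inr hc))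
      (by
        rcases Nat.eq_zero_or_pos i with rfl | h0
        -- The first cell has no left neighbour; its reflected neighbour has index `N`, where no
        -- block can start.
        · rw [show N - 1 - 0 + 1 = N by omega]; exact hN1 _
        · rw [show N - 1 - i + 1 = N - 1 - (i - 1) by omega]
          exact fun hc => hgood (i - 1) (by omega) (by omega) (by omega) (.inr hc))
      (x := 1 - x) (y := 1 - y) (hcell i hi x hxi) (by linarith)
      ⟨by linarith [hy.2], by linarith [hy.1]⟩
    simp only [sub_sub_cancel, sub_sub_sub_cancel_left] at key
    rwa [abs_sub_comm y x, abs_of_nonneg (sub_nonneg.2 hxy)]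

/-! ### Effective Borel–Cantelli -/

theorem tsum_inv_two_pow_succ_add (m : ℕ) :
    ∑' k : ℕ, (2 : ℝ≥0∞)⁻¹ ^ (m + k + 1) = (2 : ℝ≥0∞)⁻¹ ^ m := by
  have : ∀ k : ℕ, (2 : ℝ≥0∞)⁻¹ ^ (m + k + 1) = (2 : ℝ≥0∞)⁻¹ ^ m * (2 : ℝ≥0∞)⁻¹ ^ (k + 1) :=
    fun k => by rw [add_assoc, pow_add]
  simp_rw [this]
  rw [ENNReal.tsum_mul_left, ENNReal.tsum_geometric_add_one, ENNReal.one_sub_inv_two, inv_inv,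
    ENNReal.inv_mul_cancel (by simp) (by simp), mul_one]

/-- A Schnorr random point is in only finitely many of the finite unions of intervals that are given
effectively and have measures at most `2^(-k-1)`. -/
theorem SchnorrRandom.exists_forall_notMem {z : ℝ} (hz : SchnorrRandom z)
    (hz01 : z ∈ Icc (0 : ℝ) 1) {N : ℕ → ℕ} (hN : Computable N) {c : ℕ → ℕ → RatCode × RatCode}
    (hc : Computable₂ c)
    (hvol : ∀ k, volume (⋃ j < N k, Ioo ((c k j).1.val : ℝ) ((c k j).2.val : ℝ)) ≤
      (2 : ℝ≥0∞)⁻¹ ^ (k + 1)) :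
    ∃ m, ∀ k, m ≤ k → ∀ j < N k, z ∉ Ioo ((c k j).1.val : ℝ) ((c k j).2.val : ℝ) := by
  have hc' : Computable fun x : ℕ × ℕ => c x.1 x.2 := hc
  -- Component `m` lists, through the pairing function, the intervals of all stages from `m` on;
  -- indices that name no interval give the empty interval (0,0).
  let C : ℕ → ℕ → RatCode × RatCode := fun m i =>
    if i.unpair.2 < N (m + i.unpair.1) then c (m + i.unpair.1) i.unpair.2
    else ((0, 0, 0), (0, 0, 0))
  have hunp : Computable Nat.unpair := Computable.unpair
  have hC : Computable₂ C := by
    refine ComputablePred.ite' (α := ℕ × ℕ)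
      (P := fun x => x.2.unpair.2 < N (x.1 + x.2.unpair.1)) (ComputablePred.nat_lt (by fun_prop)
        (by fun_prop)) ?_ (by fun_prop)
    exact hc'.comp (f := fun x : ℕ × ℕ => c x.1 x.2)
      (g := fun x : ℕ × ℕ => (x.1 + x.2.unpair.1, x.2.unpair.2)) (by fun_prop)
  let W : ℕ → Set ℝ := fun k => ⋃ j < N k, Ioo ((c k j).1.val : ℝ) ((c k j).2.val : ℝ)
  have hCW : ∀ m i x, x ∈ Ioo ((C m i).1.val : ℝ) ((C m i).2.val : ℝ) →
      i.unpair.2 < N (m + i.unpair.1) ∧ x ∈ Ioo ((c (m + i.unpair.1) i.unpair.2).1.val : ℝ)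
        ((c (m + i.unpair.1) i.unpair.2).2.val : ℝ) := by
    intro m i x hx
    by_cases h : i.unpair.2 < N (m + i.unpair.1)
    · simp only [C, if_pos h] at hx
      exact ⟨h, hx⟩
    · simp [C, if_neg h] at hx
  have hWC : ∀ m k j, j < N (m + k) → C m (Nat.pair k j) = c (m + k) j := by
    intro m k j h
    simp [C, h]
  let G : ℕ → Set ℝ := fun m => Icc (0 : ℝ) 1 ∩ ⋃ i, Ioo ((C m i).1.val : ℝ) ((C m i).2.val : ℝ)
  have hvolW : ∀ m, volume (⋃ k, W (m + k)) ≤ (2 : ℝ≥0∞)⁻¹ ^ m := fun m =>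
    (measure_iUnion_le _).trans ((ENNReal.tsum_le_tsum fun k => hvol (m + k)).trans
      (tsum_inv_two_pow_succ_add m).le)
  have hGW : ∀ m, G m ⊆ ⋃ k, W (m + k) := by
    rintro m x ⟨-, hx⟩
    obtain ⟨i, hi⟩ := mem_iUnion.1 hx
    obtain ⟨h1, h2⟩ := hCW m i x hi
    exact mem_iUnion.2 ⟨_, mem_iUnion₂.2 ⟨_, h1, h2⟩⟩
  -- The bound `h (m, n)` exceeds the codes of all intervals of the stages m, ..., m + n - 1. What
  -- comes later lies in stages from m + n on and has measure at most 2^(-(m+n)), which makes the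
  -- measure of `G m` computable.
  obtain ⟨h, hh, hspec⟩ := ComputablePred.exists_choice (α := ℕ × ℕ) (β := ℕ)
    (P := fun x b => ∀ k < x.2, ∀ j < N (x.1 + k), Nat.pair k j < b)
    (by
      refine ComputablePred.forall_lt (α := (ℕ × ℕ) × ℕ) (n := fun x => x.1.2)
        (P := fun x k => ∀ j < N (x.1.1 + k), Nat.pair k j < x.2) ?_ (by fun_prop)
      refine ComputablePred.forall_lt (α := ((ℕ × ℕ) × ℕ) × ℕ) (n := fun x => N (x.1.1.1 + x.2))
        (P := fun x j => Nat.pair x.2 j < x.1.2) ?_ (by fun_prop)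
      have hp : Computable fun x : ℕ × ℕ => Nat.pair x.1 x.2 := Primrec₂.natPair.to_comp
      exact ComputablePred.nat_lt (hp.comp (f := fun x : ℕ × ℕ => Nat.pair x.1 x.2)
        (g := fun x : (((ℕ × ℕ) × ℕ) × ℕ) × ℕ => (x.1.2, x.2)) (by fun_prop)) (by fun_prop))
    (by
      rintro ⟨m, n⟩
      refine ⟨((Finset.range n).sup fun k => (Finset.range (N (m + k))).sup fun j =>
        Nat.pair k j + 1), fun k hk j hj => ?_⟩
      refine Nat.lt_of_succ_le ?_
      exact (Finset.le_sup (f := fun j => Nat.pair k j + 1) (Finset.mem_range.2 hj)).trans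
        (Finset.le_sup (f := fun k => (Finset.range (N (m + k))).sup fun j => Nat.pair k j + 1)
          (Finset.mem_range.2 hk)))
  have htest : IsSchnorrTest G := by
    refine ⟨⟨C, hC, fun m => rfl⟩, fun m => (measure_mono (hGW m)).trans (hvolW m),
      uniformlyComputableReals_volume hC hh fun m n => ?_⟩
    refine (measure_mono (t := ⋃ k, W (m + n + k)) ?_).trans ((hvolW (m + n)).trans
      (pow_le_pow_right_of_le_one' (by simp) (by omega)))
    rintro x ⟨⟨-, hx⟩, hx'⟩
    obtain ⟨i, hi⟩ := mem_iUnion.1 hx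
    obtain ⟨h1, h2⟩ := hCW m i x hi
    have hn : n ≤ i.unpair.1 := by
      by_contra hlt
      refine hx' (mem_iUnion₂.2 ⟨i, ?_, hi⟩)
      have := hspec (m, n) i.unpair.1 (not_le.1 hlt) i.unpair.2 h1
      rwa [Nat.pair_unpair] at this
    refine mem_iUnion.2 ⟨i.unpair.1 - n, ?_⟩
    rw [show m + n + (i.unpair.1 - n) = m + i.unpair.1 by omega]
    exact mem_iUnion₂.2 ⟨_, h1, h2⟩
  have := hz G htest
  simp only [mem_iInter, not_forall] at this
  obtain ⟨m, hm⟩ := this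
  refine ⟨m, fun k hk j hj hzj => hm ⟨hz01, mem_iUnion.2 ⟨Nat.pair (k - m) j, ?_⟩⟩⟩
  rw [hWC m (k - m) j (by rwa [Nat.add_sub_cancel' hk]), Nat.add_sub_cancel' hk]
  exact hzj

/-! ### Consequences of a bound on the `p`-variation norm -/

theorem sum_le_of_pVarNorm_le {p : ℝ} (hp : 1 ≤ p) {h : ℝ → ℝ} {ε : ℝ} (hε : 0 ≤ ε)
    (hh : pVarNorm p h ≤ ENNReal.ofReal ε) {n : ℕ} {t : ℕ → ℝ} (ht : StrictMonoOn t (Iic n))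
    (ht' : ∀ i ≤ n, t i ∈ Icc (0 : ℝ) 1) :
    ∑ i ∈ Finset.range n, |h (t (i + 1)) - h (t i)| ^ p / |t (i + 1) - t i| ^ (p - 1) ≤ ε ^ p := by
  have hp0 : 0 < p := by linarith
  have h1 : pVariation p h 0 1 ^ (1 / p) ≤ ENNReal.ofReal ε := le_trans le_add_self hh
  rw [one_div, ENNReal.rpow_inv_le_iff hp0, ENNReal.ofReal_rpow_of_nonneg hε hp0.le] at h1
  have h2 : ∑ i ∈ Finset.range n, ENNReal.ofReal
      (|h (t (i + 1)) - h (t i)| ^ p / |t (i + 1) - t i| ^ (p - 1)) ≤ pVariation p h 0 1 :=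
    le_iSup_of_le n (le_iSup_of_le t (le_iSup_of_le ht (le_iSup_of_le ht' le_rfl)))
  rw [← ENNReal.ofReal_sum_of_nonneg fun i _ => by positivity] at h2
  exact (ENNReal.ofReal_le_ofReal_iff (by positivity)).1 (h2.trans h1)

/-- For a two-point partition the denominator is at most 1, because `[0,1]` has length 1, so it can
be discarded. -/
theorem abs_sub_le_of_pVarNorm_le {p : ℝ} (hp : 1 ≤ p) {h : ℝ → ℝ} {ε : ℝ} (hε : 0 ≤ ε)
    (hh : pVarNorm p h ≤ ENNReal.ofReal ε) {x y : ℝ} (hx : x ∈ Icc (0 : ℝ) 1)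
    (hy : y ∈ Icc (0 : ℝ) 1) : |h y - h x| ≤ ε := by
  wlog hxy : x ≤ y generalizing x y
  · rw [abs_sub_comm]
    exact this hy hx (le_of_not_ge hxy)
  rcases hxy.eq_or_lt with rfl | hxy
  · simpa using hε
  have hp0 : 0 < p := by linarith
  have key := sum_le_of_pVarNorm_le hp hε hh (n := 1) (t := fun i => if i = 0 then x else y)
    (by
      intro i hi j hj hij
      simp only [mem_Iic] at hi hj
      obtain ⟨rfl, rfl⟩ : i = 0 ∧ j = 1 := by omega
      simpa using hxy)
    (by intro i _; split_ifs <;> assumption)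
  simp only [Finset.range_one, Finset.sum_singleton, zero_add, one_ne_zero, if_true, if_false] at key
  have h1 : |y - x| ^ (p - 1) ≤ 1 := by
    refine Real.rpow_le_one (abs_nonneg _) ?_ (by linarith)
    rw [abs_of_pos (sub_pos.2 hxy)]
    linarith [hx.1, hy.2]
  have h2 : 0 < |y - x| ^ (p - 1) := Real.rpow_pos_of_pos (abs_pos.2 (sub_pos.2 hxy).ne') _
  refine (Real.rpow_le_rpow_iff (abs_nonneg _) hε hp0).1 (le_trans ?_ key)
  rw [le_div_iff₀ h2]
  exact mul_le_of_le_one_right (by positivity) h1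

/-- On the uniform grid each denominator contributes N^(p-1), exactly the constant of the power mean
inequality (Σ|Δ|)^p ≤ N^(p-1) Σ|Δ|^p. The bound is therefore independent of `N`. -/
theorem sum_abs_sub_le_of_pVarNorm_le {p : ℝ} (hp : 1 ≤ p) {h : ℝ → ℝ} {ε : ℝ} (hε : 0 ≤ ε)
    (hh : pVarNorm p h ≤ ENNReal.ofReal ε) {N : ℕ} (hN : 0 < N) :
    ∑ i ∈ Finset.range N, |h (((i : ℝ) + 1) / N) - h ((i : ℝ) / N)| ≤ ε := by
  have hp0 : 0 < p := by linarith
  have hN' : (0 : ℝ) < N := by exact_mod_cast hN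
  have key := sum_le_of_pVarNorm_le hp hε hh (n := N) (t := fun i => (i : ℝ) / N)
    (by
      intro i _ j _ hij
      exact (div_lt_div_iff_of_pos_right hN').2 (by exact_mod_cast hij))
    (by
      intro i hi
      exact ⟨by positivity, (div_le_one hN').2 (by exact_mod_cast hi)⟩)
  push_cast at key
  have e : ∀ i : ℕ, |((i : ℝ) + 1) / N - (i : ℝ) / N| ^ (p - 1) = ((N : ℝ) ^ (p - 1))⁻¹ := by
    intro i
    rw [← sub_div, add_sub_cancel_left, abs_of_pos (by positivity), one_div,
      Real.inv_rpow hN'.le]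
  simp only [e, div_inv_eq_mul, ← Finset.sum_mul] at key
  have h1 := Real.rpow_sum_le_const_mul_sum_rpow (Finset.range N)
    (fun i : ℕ => h (((i : ℝ) + 1) / N) - h ((i : ℝ) / N)) hp
  rw [Finset.card_range, mul_comm] at h1
  exact (Real.rpow_le_rpow_iff (Finset.sum_nonneg fun i _ => abs_nonneg _) hε hp0).1 (h1.trans key)

/-! ### Differentiability at Schnorr random points -/

theorem inv_two_pow_eq_ofReal (n : ℕ) : (2 : ℝ≥0∞)⁻¹ ^ n = ENNReal.ofReal ((2 : ℝ)⁻¹ ^ n) := by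
  rw [ENNReal.ofReal_pow (by positivity), ENNReal.ofReal_inv_of_pos (by positivity)]
  simp

/-- The difference of two coded polynomials. -/
def polyDiff (l l' : List RatCode) (x : ℝ) : ℝ :=
  Polynomial.aeval x (ratPoly l) - Polynomial.aeval x (ratPoly l')

/-- A bound on cell `j` of level `T` for the derivative of a difference of coded polynomials. -/
def slopeBound (l l' : List RatCode) (T j : ℕ) : ℚ :=
  |ratDeriv l (j / 2 ^ T) - ratDeriv l' (j / 2 ^ T)| + (ratLip l + ratLip l') / 2 ^ T

theorem slopeBound_nonneg (l l' : List RatCode) (T j : ℕ) : 0 ≤ slopeBound l l' T j := by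
  have := ratLip_nonneg l
  have := ratLip_nonneg l'
  unfold slopeBound; positivity

theorem hasDerivAt_polyDiff (l l' : List RatCode) (x : ℝ) :
    HasDerivAt (polyDiff l l') (polyDeriv l x - polyDeriv l' x) x :=
  (hasDerivAt_ratPoly l x).sub (hasDerivAt_ratPoly l' x)

theorem abs_polyDeriv_sub_sub_le (l l' : List RatCode) {x y : ℝ} (hx : x ∈ Icc (0 : ℝ) 1)
    (hy : y ∈ Icc (0 : ℝ) 1) :
    |(polyDeriv l x - polyDeriv l' x) - (polyDeriv l y - polyDeriv l' y)| ≤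
      (ratLip l + ratLip l') * |x - y| := by
  have h1 := abs_polyDeriv_sub_le l hx hy
  have h2 := abs_polyDeriv_sub_le l' hx hy
  have e : (polyDeriv l x - polyDeriv l' x) - (polyDeriv l y - polyDeriv l' y) =
    (polyDeriv l x - polyDeriv l y) - (polyDeriv l' x - polyDeriv l' y) := by ring
  rw [e, add_mul]
  exact (abs_sub _ _).trans (add_le_add h1 h2)

theorem cell_subset_Icc {N i : ℕ} (hi : i < N) :
    Icc ((i : ℝ) / N) (((i : ℝ) + 1) / N) ⊆ Icc (0 : ℝ) 1 := by
  have hN : (0 : ℝ) < N := by exact_mod_cast (Nat.zero_le i).trans_lt hi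
  refine Icc_subset_Icc (by positivity) ((div_le_one hN).2 ?_)
  exact_mod_cast hi

theorem abs_deriv_polyDiff_le_slopeBound (l l' : List RatCode) {T j : ℕ} (hj : j < 2 ^ T) {x : ℝ}
    (hx : x ∈ Icc ((j : ℝ) / (2 ^ T : ℕ)) (((j : ℝ) + 1) / (2 ^ T : ℕ))) :
    |polyDeriv l x - polyDeriv l' x| ≤ slopeBound l l' T j := by
  have hN : (0 : ℝ) < (2 ^ T : ℕ) := by positivity
  have hj0 : (j : ℝ) / (2 ^ T : ℕ) ∈ Icc ((j : ℝ) / (2 ^ T : ℕ)) (((j : ℝ) + 1) / (2 ^ T : ℕ)) :=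
    ⟨le_rfl, hx.1.trans hx.2⟩
  have h1 := abs_polyDeriv_sub_sub_le l l' (cell_subset_Icc hj hx) (cell_subset_Icc hj hj0)
  have h2 : |x - (j : ℝ) / (2 ^ T : ℕ)| ≤ 1 / (2 ^ T : ℕ) := by
    rw [abs_of_nonneg (sub_nonneg.2 hx.1)]
    have := hx.2
    rw [add_div] at this
    linarith
  have h3 : (0 : ℝ) ≤ ratLip l + ratLip l' := by
    exact_mod_cast add_nonneg (ratLip_nonneg l) (ratLip_nonneg l')
  have h4 := h1.trans (mul_le_mul_of_nonneg_left h2 h3)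
  have h5 := abs_sub_abs_le_abs_sub (polyDeriv l x - polyDeriv l' x)
    (polyDeriv l ((j : ℝ) / (2 ^ T : ℕ)) - polyDeriv l' ((j : ℝ) / (2 ^ T : ℕ)))
  have e : (slopeBound l l' T j : ℝ) = |polyDeriv l ((j : ℝ) / (2 ^ T : ℕ)) -
      polyDeriv l' ((j : ℝ) / (2 ^ T : ℕ))| + (ratLip l + ratLip l') * (1 / (2 ^ T : ℕ)) := by
    unfold slopeBound
    push_cast [ratDeriv_cast]
    ring
  rw [e]
  linarith

theorem abs_polyDiff_sub_le (l l' : List RatCode) {T j : ℕ} (hj : j < 2 ^ T) {x y : ℝ}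
    (hx : x ∈ Icc ((j : ℝ) / (2 ^ T : ℕ)) (((j : ℝ) + 1) / (2 ^ T : ℕ)))
    (hy : y ∈ Icc ((j : ℝ) / (2 ^ T : ℕ)) (((j : ℝ) + 1) / (2 ^ T : ℕ))) :
    |polyDiff l l' x - polyDiff l l' y| ≤ slopeBound l l' T j * |x - y| :=
  (convex_Icc _ _).norm_image_sub_le_of_norm_hasDerivWithin_le
    (fun u _ => (hasDerivAt_polyDiff l l' u).hasDerivWithinAt)
    (fun _ hu => abs_deriv_polyDiff_le_slopeBound l l' hj hu) hy hx

/-- The mean value inequality for `polyDiff` minus its tangent at the left end shows that the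
derivative there differs from the chord slope of the cell by at most B/2^T, B being the sum of the
two `ratLip`. The definition of `slopeBound` adds another B/2^T. After averaging, the error 2B/2^T
vanishes as `T` grows. -/
theorem sum_slopeBound_le (l l' : List RatCode) (T : ℕ) :
    ((∑ j ∈ Finset.range (2 ^ T), slopeBound l l' T j : ℚ) : ℝ) ≤
      2 ^ T * ∑ j ∈ Finset.range (2 ^ T), |polyDiff l l' (((j : ℝ) + 1) / (2 ^ T : ℕ)) -
        polyDiff l l' ((j : ℝ) / (2 ^ T : ℕ))| + 2 * (ratLip l + ratLip l') := by
  have hN : (0 : ℝ) < (2 ^ T : ℕ) := by positivity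
  have h3 : (0 : ℝ) ≤ ratLip l + ratLip l' := by
    exact_mod_cast add_nonneg (ratLip_nonneg l) (ratLip_nonneg l')
  have key : ∀ j ∈ Finset.range (2 ^ T), (slopeBound l l' T j : ℝ) ≤
      2 ^ T * |polyDiff l l' (((j : ℝ) + 1) / (2 ^ T : ℕ)) - polyDiff l l' ((j : ℝ) / (2 ^ T : ℕ))|
        + 2 * (ratLip l + ratLip l') / 2 ^ T := by
    intro j hj
    have hj := Finset.mem_range.1 hj
    set x : ℝ := (j : ℝ) / (2 ^ T : ℕ) with hx
    set y : ℝ := ((j : ℝ) + 1) / (2 ^ T : ℕ) with hy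
    set D := polyDeriv l x - polyDeriv l' x with hD
    have hyx : y - x = 1 / (2 ^ T : ℕ) := by rw [hx, hy]; ring
    have hxy : x ≤ y := by
      have : (0 : ℝ) < 1 / (2 ^ T : ℕ) := by positivity
      linarith
    have h1 : |(polyDiff l l' y - D * y) - (polyDiff l l' x - D * x)| ≤
        (ratLip l + ratLip l') * (1 / (2 ^ T : ℕ)) * |y - x| := by
      refine (convex_Icc x y).norm_image_sub_le_of_norm_hasDerivWithin_le
        (f := fun u => polyDiff l l' u - D * u)
        (fun u _ => ((hasDerivAt_polyDiff l l' u).sub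
          ((hasDerivAt_id u).const_mul D)).hasDerivWithinAt)
        (fun u hu => ?_) ⟨le_rfl, hxy⟩ ⟨hxy, le_rfl⟩
      rw [mul_one, Real.norm_eq_abs]
      refine (abs_polyDeriv_sub_sub_le l l' (cell_subset_Icc hj hu)
        (cell_subset_Icc hj ⟨le_rfl, hxy⟩)).trans ?_
      refine mul_le_mul_of_nonneg_left ?_ h3
      rw [abs_of_nonneg (sub_nonneg.2 hu.1), ← hyx]
      linarith [hu.2]
    rw [abs_of_nonneg (sub_nonneg.2 hxy), hyx] at h1
    have h2 : |D| * (1 / (2 ^ T : ℕ)) ≤ |polyDiff l l' y - polyDiff l l' x| +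
        (ratLip l + ratLip l') * (1 / (2 ^ T : ℕ)) * (1 / (2 ^ T : ℕ)) := by
      have e : D * (1 / (2 ^ T : ℕ)) = (polyDiff l l' y - polyDiff l l' x) -
        ((polyDiff l l' y - D * y) - (polyDiff l l' x - D * x)) := by rw [← hyx]; ring
      rw [← abs_of_pos (by positivity : (0 : ℝ) < 1 / (2 ^ T : ℕ)), ← abs_mul,
        abs_of_pos (by positivity : (0 : ℝ) < 1 / (2 ^ T : ℕ)), e]
      exact (abs_sub _ _).trans (by gcongr)
    have e : (slopeBound l l' T j : ℝ) = |D| + (ratLip l + ratLip l') / 2 ^ T := by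
      unfold slopeBound
      push_cast [ratDeriv_cast, hD, hx]
      ring
    have h4 := mul_le_mul_of_nonneg_left h2 hN.le
    have e1 : ((2 ^ T : ℕ) : ℝ) * (|D| * (1 / (2 ^ T : ℕ))) = |D| := by field_simp
    have e2 : ((2 ^ T : ℕ) : ℝ) * (|polyDiff l l' y - polyDiff l l' x| +
        (ratLip l + ratLip l') * (1 / (2 ^ T : ℕ)) * (1 / (2 ^ T : ℕ))) =
        2 ^ T * |polyDiff l l' y - polyDiff l l' x| + (ratLip l + ratLip l') / 2 ^ T := by
      push_cast; field_simp
    rw [e1, e2] at h4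
    rw [e, mul_div_assoc]
    linarith
  push_cast
  refine (Finset.sum_le_sum key).trans_eq ?_
  rw [Finset.sum_add_distrib, ← Finset.mul_sum]
  simp [mul_div_cancel₀]

theorem computableRat_slopeBound {α : Type*} [Primcodable α] {l l' : α → List RatCode}
    {T j : α → ℕ} (hl : Computable l) (hl' : Computable l') (hT : Computable T)
    (hj : Computable j) : ComputableRat fun a => slopeBound (l a) (l' a) (T a) (j a) := by
  unfold slopeBound; fun_prop

/-- A sequence of differentiable functions whose consecutive differences have slopes at `z` bounded
by `2^(-k)` has a limit that is differentiable at `z`. -/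
theorem differentiableWithinAt_of_slopes {f : ℝ → ℝ} {s : Set ℝ} {z : ℝ} {Q Q' : ℕ → ℝ → ℝ}
    {m : ℕ} (hQ : ∀ k, HasDerivAt (Q k) (Q' k z) z)
    (hlim : ∀ y ∈ s, Tendsto (fun k => Q k y - Q k z) atTop (𝓝 (f y - f z)))
    (hslope : ∀ k, m ≤ k → ∀ y ∈ s, |(Q (k + 1) y - Q k y) - (Q (k + 1) z - Q k z)| ≤
      (2 : ℝ)⁻¹ ^ k * |y - z|) :
    DifferentiableWithinAt ℝ f s z := by
  have htail : ∀ k, m ≤ k → ∀ n, ∀ y ∈ s,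
      |(Q (k + n) y - Q k y) - (Q (k + n) z - Q k z)| ≤ 2 * (2 : ℝ)⁻¹ ^ k * |y - z| := by
    intro k hk n y hy
    -- The sharper bound is the exact geometric sum, for which the induction closes.
    have : |(Q (k + n) y - Q k y) - (Q (k + n) z - Q k z)| ≤
        (2 * (2 : ℝ)⁻¹ ^ k - 2 * (2 : ℝ)⁻¹ ^ (k + n)) * |y - z| := by
      induction n with
      | zero => simp
      | succ n ih =>
        have h1 := hslope (k + n) (by omega) y hy
        have e : (Q (k + (n + 1)) y - Q k y) - (Q (k + (n + 1)) z - Q k z) =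
          ((Q (k + n) y - Q k y) - (Q (k + n) z - Q k z)) +
          ((Q (k + n + 1) y - Q (k + n) y) - (Q (k + n + 1) z - Q (k + n) z)) := by
            rw [← add_assoc]; ring
        rw [e]
        refine (abs_add_le _ _).trans ((add_le_add ih h1).trans_eq ?_)
        rw [← add_assoc, pow_succ]
        ring
    refine this.trans ?_
    gcongr
    have : (0 : ℝ) < (2 : ℝ)⁻¹ ^ (k + n) := by positivity
    linarith
  have hf : ∀ k, m ≤ k → ∀ y ∈ s, |(f y - f z) - (Q k y - Q k z)| ≤
      2 * (2 : ℝ)⁻¹ ^ k * |y - z| := by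
    intro k hk y hy
    refine le_of_tendsto (((hlim y hy).sub_const (Q k y - Q k z)).abs) ?_
    filter_upwards [eventually_ge_atTop k] with n hn
    obtain ⟨d, rfl⟩ := Nat.exists_eq_add_of_le hn
    have := htail k hk d y hy
    rwa [show (Q (k + d) y - Q (k + d) z) - (Q k y - Q k z) =
      (Q (k + d) y - Q k y) - (Q (k + d) z - Q k z) by ring]
  -- At an isolated point of `s` differentiability is automatic; otherwise bounds on slopes pass to
  -- bounds on derivatives.
  by_cases hacc : AccPt z (𝓟 s)
  swap
  · exact (HasFDerivWithinAt.of_not_accPt (f' := 0) hacc).differentiableWithinAt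
  have hcau : ∀ k, m ≤ k → ∀ n, |Q' (k + n) z - Q' k z| ≤ 2 * (2 : ℝ)⁻¹ ^ k := by
    intro k hk n
    have hd : HasDerivWithinAt (fun y => Q (k + n) y - Q k y) (Q' (k + n) z - Q' k z) s z :=
      ((hQ _).sub (hQ _)).hasDerivWithinAt
    rw [hasDerivWithinAt_iff_tendsto_slope] at hd
    have : (𝓝[s \ {z}] z).NeBot := by
      rwa [accPt_principal_iff_nhdsWithin] at hacc
    refine le_of_tendsto hd.abs ?_
    filter_upwards [self_mem_nhdsWithin] with y hy
    have hne : y - z ≠ 0 := sub_ne_zero.2 hy.2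
    rw [slope_def_field, abs_div, div_le_iff₀ (abs_pos.2 hne)]
    exact htail k hk n y hy.1
  have hcs : CauchySeq fun k => Q' k z := by
    rw [Metric.cauchySeq_iff']
    intro ε hε
    obtain ⟨n, hn⟩ := exists_pow_lt_of_lt_one (half_pos hε) (by norm_num : (2 : ℝ)⁻¹ < 1)
    refine ⟨max n m, fun k hk => ?_⟩
    obtain ⟨d, rfl⟩ := Nat.exists_eq_add_of_le hk
    rw [Real.dist_eq]
    refine (hcau _ (le_max_right _ _) d).trans_lt ?_
    have : (2 : ℝ)⁻¹ ^ max n m ≤ (2 : ℝ)⁻¹ ^ n :=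
      pow_le_pow_of_le_one (by norm_num) (by norm_num) (le_max_left _ _)
    linarith
  obtain ⟨D, hD⟩ := cauchySeq_tendsto_of_complete hcs
  have hDk : ∀ k, m ≤ k → |D - Q' k z| ≤ 2 * (2 : ℝ)⁻¹ ^ k := by
    intro k hk
    refine le_of_tendsto ((hD.sub_const (Q' k z)).abs) ?_
    filter_upwards [eventually_ge_atTop k] with n hn
    obtain ⟨d, rfl⟩ := Nat.exists_eq_add_of_le hn
    exact hcau k hk d
  refine HasDerivWithinAt.differentiableWithinAt (f' := D) ?_
  rw [hasDerivWithinAt_iff_isLittleO, Asymptotics.isLittleO_iff]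
  intro ε hε
  -- Error budget: ε/4 for replacing `f` by `Q k`, ε/2 for the derivative of `Q k`, and ε/4 for
  -- replacing `Q' k z` by `D`.
  obtain ⟨n, hn⟩ := exists_pow_lt_of_lt_one (by positivity : 0 < ε / 8)
    (by norm_num : (2 : ℝ)⁻¹ < 1)
  set k := max n m
  have hk : (2 : ℝ)⁻¹ ^ k ≤ ε / 8 :=
    (pow_le_pow_of_le_one (by norm_num) (by norm_num) (le_max_left _ _)).trans hn.le
  have hQo := (hasDerivWithinAt_iff_isLittleO.1 ((hQ k).hasDerivWithinAt (s := s))).def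
    (by positivity : 0 < ε / 2)
  filter_upwards [hQo, self_mem_nhdsWithin] with y hy hys
  simp only [smul_eq_mul, Real.norm_eq_abs] at hy ⊢
  have h1 := hf k (le_max_right _ _) y hys
  have h2 := hDk k (le_max_right _ _)
  have e : f y - f z - (y - z) * D = ((f y - f z) - (Q k y - Q k z)) +
    (Q k y - Q k z - (y - z) * Q' k z) - (D - Q' k z) * (y - z) := by ring
  rw [e]
  have h3 : |(D - Q' k z) * (y - z)| ≤ 2 * (2 : ℝ)⁻¹ ^ k * |y - z| := by
    rw [abs_mul]; gcongr
  have h4 : (2 : ℝ)⁻¹ ^ k * |y - z| ≤ ε / 8 * |y - z| := by gcongr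
  refine (abs_sub _ _).trans ((add_le_add (abs_add_le _ _) le_rfl).trans ?_)
  linarith

theorem volume_biUnion_ite_le {N : ℕ} {P : ℕ → Prop} {I : ℕ → Set ℝ} {v : ℝ≥0∞}
    [DecidablePred P] (h₀ : ∀ j, ¬ P j → I j = ∅) (h₁ : ∀ j, P j → volume (I j) ≤ v) :
    volume (⋃ j < N, I j) ≤ ((Finset.range N).filter P).card * v := by
  have : (⋃ j < N, I j) ⊆ ⋃ j ∈ (Finset.range N).filter P, I j := by
    intro x hx
    obtain ⟨j, hj, hxj⟩ := mem_iUnion₂.1 hx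
    have hP : P j := by
      by_contra hP
      rw [h₀ j hP] at hxj
      exact hxj
    exact mem_iUnion₂.2 ⟨j, by simp [hj, hP], hxj⟩
  refine (measure_mono this).trans ((measure_biUnion_finset_le _ _).trans ?_)
  refine (Finset.sum_le_card_nsmul _ _ v fun j hj => h₁ j ?_).trans (by simp)
  exact (Finset.mem_filter.1 hj).2

/-- A function that is computable in the `p`-variation norm is differentiable at each Schnorr random
point. -/
theorem SchnorrRandom.differentiableOnUnitAt {p : ℝ} (hp : 1 ≤ p) {z : ℝ}
    (hz01 : z ∈ Icc (0 : ℝ) 1) (hz : SchnorrRandom z) {f : ℝ → ℝ}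
    (hf : ComputableInPVarNorm p f) : DifferentiableOnUnitAt f z := by
  classical
  obtain ⟨q, hq, hqf⟩ := hf
  -- The exponent grows like 2k because a factor 2^k is lost when the threshold 2^(-k) is imposed on
  -- the averages.
  let Q : ℕ → List RatCode := fun k => q (2 * k + 8)
  have hQ : Computable Q := by fun_prop
  have hQf : ∀ k, pVarNorm p (fun x => f x - Polynomial.aeval x (ratPoly (Q k))) ≤
      ENNReal.ofReal ((2 : ℝ)⁻¹ ^ (2 * k + 8)) := fun k => by
    rw [← inv_two_pow_eq_ofReal]; exact hqf _
  -- Total increments of `Q (k + 1) - Q k` are at most 2^(-(2k+7)), and a large `T` makes the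
  -- discretisation error as small. The condition compares rationals, so a computable `T` is found
  -- by search.
  have hex : ∀ k, ∃ T, ∑ j ∈ Finset.range (2 ^ T), slopeBound (Q (k + 1)) (Q k) T j ≤
      2 ^ T * (1 / 2) ^ (2 * k + 6) := by
    intro k
    have hB : (0 : ℝ) ≤ ratLip (Q (k + 1)) + ratLip (Q k) := by
      exact_mod_cast add_nonneg (ratLip_nonneg _) (ratLip_nonneg _)
    obtain ⟨T, hT⟩ := pow_unbounded_of_one_lt
      (2 * (ratLip (Q (k + 1)) + ratLip (Q k) : ℝ) / (2 : ℝ)⁻¹ ^ (2 * k + 7)) one_lt_two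
    refine ⟨T, ?_⟩
    rw [div_lt_iff₀ (by positivity)] at hT
    have h1 := sum_slopeBound_le (Q (k + 1)) (Q k) T
    have h2 : ∑ j ∈ Finset.range (2 ^ T),
        |polyDiff (Q (k + 1)) (Q k) (((j : ℝ) + 1) / (2 ^ T : ℕ)) -
          polyDiff (Q (k + 1)) (Q k) ((j : ℝ) / (2 ^ T : ℕ))| ≤ (2 : ℝ)⁻¹ ^ (2 * k + 7) := by
      have h3 := sum_abs_sub_le_of_pVarNorm_le hp (by positivity) (hQf k)
        (N := 2 ^ T) (by positivity)
      have h4 := sum_abs_sub_le_of_pVarNorm_le hp (by positivity) (hQf (k + 1))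
        (N := 2 ^ T) (by positivity)
      have h5 : (2 : ℝ)⁻¹ ^ (2 * (k + 1) + 8) ≤ (2 : ℝ)⁻¹ ^ (2 * k + 8) :=
        pow_le_pow_of_le_one (by norm_num) (by norm_num) (by omega)
      have h6 : (2 : ℝ)⁻¹ ^ (2 * k + 7) = (2 : ℝ)⁻¹ ^ (2 * k + 8) + (2 : ℝ)⁻¹ ^ (2 * k + 8) := by
        ring
      rw [h6]
      refine le_trans ?_ (add_le_add h3 (h4.trans h5))
      rw [← Finset.sum_add_distrib]
      refine Finset.sum_le_sum fun j _ => ?_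
      refine le_trans (le_of_eq ?_) (abs_sub _ _)
      congr 1
      unfold polyDiff
      ring
    have h7 : (2 : ℝ) ^ T * (1 / 2) ^ (2 * k + 6) =
        2 ^ T * (2 : ℝ)⁻¹ ^ (2 * k + 7) + 2 ^ T * (2 : ℝ)⁻¹ ^ (2 * k + 7) := by
      rw [one_div]; ring
    have h8 : (2 : ℝ) ^ T * ∑ j ∈ Finset.range (2 ^ T),
        |polyDiff (Q (k + 1)) (Q k) (((j : ℝ) + 1) / (2 ^ T : ℕ)) -
          polyDiff (Q (k + 1)) (Q k) ((j : ℝ) / (2 ^ T : ℕ))| ≤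
        2 ^ T * (2 : ℝ)⁻¹ ^ (2 * k + 7) := by gcongr
    have h9 : ((∑ j ∈ Finset.range (2 ^ T), slopeBound (Q (k + 1)) (Q k) T j : ℚ) : ℝ) ≤
        ((2 ^ T * (1 / 2) ^ (2 * k + 6) : ℚ) : ℝ) := by
      push_cast at h1 h8 ⊢
      linarith
    exact_mod_cast h9
  have hslopeC : ComputableRat fun x : (ℕ × ℕ) × ℕ =>
      slopeBound (Q (x.1.1 + 1)) (Q x.1.1) x.1.2 x.2 :=
    computableRat_slopeBound (by fun_prop) (by fun_prop) (by fun_prop) (by fun_prop)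
  obtain ⟨T, hTc, hT⟩ := ComputablePred.exists_choice (α := ℕ) (β := ℕ)
    (P := fun k T => ∑ j ∈ Finset.range (2 ^ T), slopeBound (Q (k + 1)) (Q k) T j ≤
      2 ^ T * (1 / 2) ^ (2 * k + 6))
    (ComputableRat.le (ComputableRat.sum hslopeC (by fun_prop)) (by fun_prop)) hex
  let a : ℕ → ℕ → ℚ := fun k j => slopeBound (Q (k + 1)) (Q k) (T k) j
  have ha : ComputableRat fun x : ℕ × ℕ => a x.1 x.2 :=
    computableRat_slopeBound (by fun_prop) (by fun_prop) (by fun_prop) (by fun_prop)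
  let P : ℕ → ℕ → Prop := fun k j => LargeAverage (a k) ((1 / 2) ^ k) (2 ^ T k) j
  have hP : ComputablePred fun x : ℕ × ℕ => P x.1 x.2 :=
    computablePred_largeAverage (a := fun x : ℕ × ℕ => a x.1)
      (ha.comp (f := fun x : ℕ × ℕ => a x.1 x.2) (g := fun x : (ℕ × ℕ) × ℕ => (x.1.1, x.2))
        (by fun_prop)) (by fun_prop) (by fun_prop) (by fun_prop)
  obtain ⟨lo, hlo, hlov⟩ : ComputableRat fun x : ℕ × ℕ => ((x.2 : ℚ) - 2) / 2 ^ T x.1 := by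
    fun_prop
  obtain ⟨hi, hhi, hhiv⟩ : ComputableRat fun x : ℕ × ℕ => ((x.2 : ℚ) + 3) / 2 ^ T x.1 := by
    fun_prop
  let c : ℕ → ℕ → RatCode × RatCode := fun k j =>
    if P k j then (lo (k, j), hi (k, j)) else ((0, 0, 0), (0, 0, 0))
  have hc : Computable₂ c := hP.ite' (by fun_prop) (by fun_prop)
  have hcP : ∀ k j, P k j → Ioo ((c k j).1.val : ℝ) ((c k j).2.val : ℝ) =
      Ioo (((j : ℝ) - 2) / 2 ^ T k) (((j : ℝ) + 3) / 2 ^ T k) := by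
    intro k j h
    simp only [c, if_pos h, hlov, hhiv]
    push_cast
    rfl
  have hcnP : ∀ k j, ¬ P k j → Ioo ((c k j).1.val : ℝ) ((c k j).2.val : ℝ) = ∅ := by
    intro k j h
    simp [c, if_neg h]
  -- The number of bad cells is at most 2 · 2^T · 2^(-(2k+6)) / 2^(-k) = 2^T · 2^(-(k+5)). Each is
  -- enlarged to length 5/2^T, and 5 · 2^(-(k+5)) ≤ 16 · 2^(-(k+5)) = 2^(-(k+1)).
  have hvol : ∀ k, volume (⋃ j < 2 ^ T k, Ioo ((c k j).1.val : ℝ) ((c k j).2.val : ℝ)) ≤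
      (2 : ℝ≥0∞)⁻¹ ^ (k + 1) := by
    intro k
    refine (volume_biUnion_ite_le (P := P k) (v := ENNReal.ofReal (5 / 2 ^ T k)) (hcnP k)
      fun j hj => ?_).trans ?_
    · rw [hcP k j hj, Real.volume_Ioo, ← sub_div]
      refine ENNReal.ofReal_le_ofReal (le_of_eq ?_)
      ring
    · rw [inv_two_pow_eq_ofReal, ← ENNReal.ofReal_natCast, ← ENNReal.ofReal_mul (by positivity)]
      refine ENNReal.ofReal_le_ofReal ?_
      have h1 := mul_card_largeAverage_le (a := a k) (fun i => slopeBound_nonneg _ _ _ _)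
        (δ := (1 / 2) ^ k) (by positivity) (2 ^ T k)
      have h2 := h1.trans (mul_le_mul_of_nonneg_left (hT k) zero_le_two)
      have h3 : ((1 / 2 : ℝ)) ^ k * (((Finset.range (2 ^ T k)).filter (P k)).card : ℝ) ≤
          2 * (2 ^ T k * (1 / 2) ^ (2 * k + 6)) := by
        have h2' := (Rat.cast_le (K := ℝ)).2 h2
        push_cast at h2'
        exact h2'
      have e : (2 : ℝ) * (2 ^ T k * (1 / 2) ^ (2 * k + 6)) =
          (1 / 2) ^ k * (2 ^ T k * (2 : ℝ)⁻¹ ^ (k + 5)) := by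
        rw [one_div, show 2 * k + 6 = k + (k + 5) + 1 by ring, pow_succ, pow_add]
        ring
      rw [e] at h3
      have h4 := le_of_mul_le_mul_left h3 (by positivity)
      rw [mul_div_assoc', div_le_iff₀ (by positivity)]
      have h5 : (2 : ℝ)⁻¹ ^ (k + 1) = 16 * (2 : ℝ)⁻¹ ^ (k + 5) := by ring
      rw [h5]
      have h6 : (0 : ℝ) < (2 : ℝ)⁻¹ ^ (k + 5) * 2 ^ T k := by positivity
      nlinarith
  obtain ⟨m, hm⟩ := hz.exists_forall_notMem hz01 (N := fun k => 2 ^ T k) (by fun_prop) hc hvol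
  refine differentiableWithinAt_of_slopes (m := m)
    (Q := fun k x => Polynomial.aeval x (ratPoly (Q k))) (Q' := fun k => polyDeriv (Q k))
    (fun k => hasDerivAt_ratPoly _ _) (fun y hy => ?_) fun k hk y hy => ?_
  · rw [tendsto_iff_dist_tendsto_zero]
    refine squeeze_zero (g := fun k => (2 : ℝ)⁻¹ ^ (2 * k + 8)) (fun _ => dist_nonneg)
      (fun k => ?_) ?_
    · have := abs_sub_le_of_pVarNorm_le hp (by positivity) (hQf k) hz01 hy
      rw [dist_comm, Real.dist_eq]
      refine le_trans (le_of_eq ?_) this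
      congr 1
      ring
    · refine (tendsto_pow_atTop_nhds_zero_of_lt_one (r := (2 : ℝ)⁻¹) (by norm_num)
        (by norm_num)).comp (tendsto_atTop_mono (fun k => ?_) tendsto_id)
      simp only [id]
      omega
  · have := abs_sub_le_of_not_largeAverage (a := a k) (δ := (1 / 2) ^ k) (N := 2 ^ T k)
      (by positivity) (g := polyDiff (Q (k + 1)) (Q k))
      (fun i hi x hx y hy => abs_polyDiff_sub_le _ _ hi hx hy) hz01
      (fun i hi hzi hP' => by
        have h1 := hm k hk i hi
        rw [hcP k i hP'] at h1
        push_cast at hzi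
        exact h1 hzi) hy
    simp only [polyDiff] at this
    push_cast at this
    rwa [one_div] at this

/-! ### Bounds for the `p`-variation norm -/

/-- Increments of a control function `Φ` telescope along every partition, and `Φ` is monotone
because it dominates nonnegative terms. -/
theorem pVariation_le_of_le_sub {p : ℝ} {h Φ : ℝ → ℝ}
    (hΦ : ∀ x y, 0 ≤ x → x < y → y ≤ 1 → |h y - h x| ^ p / |y - x| ^ (p - 1) ≤ Φ y - Φ x) :
    pVariation p h 0 1 ≤ ENNReal.ofReal (Φ 1 - Φ 0) := by
  have hmono : ∀ x y, 0 ≤ x → x ≤ y → y ≤ 1 → Φ x ≤ Φ y := by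
    intro x y hx hxy hy
    rcases hxy.eq_or_lt with rfl | hxy
    · exact le_rfl
    · have := (by positivity : 0 ≤ |h y - h x| ^ p / |y - x| ^ (p - 1)).trans (hΦ x y hx hxy hy)
      linarith
  refine iSup_le fun n => iSup_le fun t => iSup_le fun ht => iSup_le fun ht' => ?_
  rw [← ENNReal.ofReal_sum_of_nonneg fun i _ => by positivity]
  refine ENNReal.ofReal_le_ofReal ?_
  calc _ ≤ ∑ i ∈ Finset.range n, (Φ (t (i + 1)) - Φ (t i)) := by
        refine Finset.sum_le_sum fun i hi => ?_
        have hi := Finset.mem_range.1 hi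
        exact hΦ _ _ (ht' i hi.le).1 (ht (mem_Iic.2 hi.le) (mem_Iic.2 hi) (Nat.lt_succ_self i))
          (ht' (i + 1) hi).2
    _ = Φ (t n) - Φ (t 0) := Finset.sum_range_sub (fun i => Φ (t i)) n
    _ ≤ Φ 1 - Φ 0 := by
        have h1 := hmono (t n) 1 (ht' n le_rfl).1 (ht' n le_rfl).2 le_rfl
        have h2 := hmono 0 (t 0) le_rfl (ht' 0 (Nat.zero_le n)).1 (ht' 0 (Nat.zero_le n)).2
        linarith

theorem pVariation_sub_const (p : ℝ) (h : ℝ → ℝ) (a : ℝ) :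
    pVariation p (fun x => h x - a) 0 1 = pVariation p h 0 1 := by
  simp [pVariation]

theorem pVarNorm_lt_top_of_lipschitzOnWith {p : ℝ} (hp : 1 ≤ p) {h : ℝ → ℝ} {K : ℝ≥0}
    (hK : LipschitzOnWith K h (Icc 0 1)) : pVarNorm p h < ∞ := by
  have h1 : pVariation p h 0 1 ≤ ENNReal.ofReal ((K : ℝ) ^ p * 1 - (K : ℝ) ^ p * 0) := by
    refine pVariation_le_of_le_sub (Φ := fun x => (K : ℝ) ^ p * x) fun x y hx hxy hy => ?_
    have h2 := hK.dist_le_mul y ⟨hx.trans hxy.le, hy⟩ x ⟨hx, hxy.le.trans hy⟩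
    rw [Real.dist_eq, Real.dist_eq] at h2
    have h3 : 0 < |y - x| := abs_pos.2 (sub_pos.2 hxy).ne'
    rw [div_le_iff₀ (Real.rpow_pos_of_pos h3 _), ← mul_sub]
    calc |h y - h x| ^ p ≤ (K * |y - x|) ^ p :=
          Real.rpow_le_rpow (abs_nonneg _) h2 (by linarith)
      _ = (K : ℝ) ^ p * |y - x| * |y - x| ^ (p - 1) := by
          rw [Real.mul_rpow K.coe_nonneg h3.le, mul_assoc, ← Real.rpow_one_add' h3.le (by linarith),
            add_sub_cancel]
      _ = _ := by rw [abs_of_pos (sub_pos.2 hxy)]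
  refine ENNReal.add_lt_top.2 ⟨ENNReal.ofReal_lt_top, ?_⟩
  exact ENNReal.rpow_lt_top_of_nonneg (by positivity) (ne_top_of_le_ne_top (by simp) h1)

theorem aeval_ratPoly_zero_cons_tail (l : List RatCode) (x : ℝ) :
    Polynomial.aeval x (ratPoly ((0, 0, 0) :: l.tail)) =
      Polynomial.aeval x (ratPoly l) - Polynomial.aeval (0 : ℝ) (ratPoly l) := by
  cases l <;> simp [ratPoly, RatCode.val]

/-- Erasing the constant coefficients changes each error function by a constant only: its variation
is unaffected and its value at 0 becomes 0. -/
theorem ComputableInPVarNorm.sub_apply_zero {p : ℝ} {f : ℝ → ℝ} (hf : ComputableInPVarNorm p f) :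
    ComputableInPVarNorm p fun x => f x - f 0 := by
  obtain ⟨q, hq, h⟩ := hf
  refine ⟨fun n => (0, 0, 0) :: (q n).tail,
    Computable.list_cons.comp (Computable.const _) (Primrec.list_tail.to_comp.comp hq),
    fun n => le_trans ?_ (h n)⟩
  have e : (fun x => f x - f 0 - Polynomial.aeval x (ratPoly ((0, 0, 0) :: (q n).tail))) =
      fun x => (f x - Polynomial.aeval x (ratPoly (q n))) -
        (f 0 - Polynomial.aeval (0 : ℝ) (ratPoly (q n))) := by
    ext x
    rw [aeval_ratPoly_zero_cons_tail]
    ring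
  rw [e, pVarNorm, pVarNorm,
    pVariation_sub_const p (fun x => f x - Polynomial.aeval x (ratPoly (q n)))]
  simp

theorem sub_apply_zero_mem_rieszClass {p : ℝ} (hp : 1 ≤ p) {f : ℝ → ℝ} {K : ℝ≥0}
    (hK : LipschitzOnWith K f (Icc 0 1)) : (fun x => f x - f 0) ∈ rieszClass p := by
  have hK' : LipschitzOnWith K (fun x => f x - f 0) (Icc 0 1) := fun x hx y hy => by
    simpa [edist_sub_right] using hK hx hy
  refine ⟨sub_self _, ?_⟩
  rcases hp.eq_or_lt with rfl | hp'
  · refine .inr ⟨rfl, LipschitzOnWith.absolutelyContinuousOnInterval (K := K) ?_⟩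
    rwa [uIcc_of_le zero_le_one]
  · exact .inl ⟨hp', pVarNorm_lt_top_of_lipschitzOnWith hp hK'⟩

theorem DifferentiableOnUnitAt.of_sub_const {f : ℝ → ℝ} {a z : ℝ}
    (h : DifferentiableOnUnitAt (fun x => f x - a) z) : DifferentiableOnUnitAt f z := by
  have := DifferentiableWithinAt.add_const a h
  simpa [DifferentiableOnUnitAt] using this

/-! ### Polynomial approximation of step functions -/

/-- The leading zero makes the polynomial vanish at 0, so that it is the integral of its derivative,
while the coefficients of that derivative can still be any rationals. -/
theorem polyDeriv_zero_cons (l : List RatCode) (x : ℝ) :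
    polyDeriv ((0, 0, 0) :: l) x =
      ∑ i ∈ Finset.range l.length, ((i : ℝ) + 1) * ((l.getD i (0, 0, 0)).val : ℝ) * x ^ i := by
  simp only [polyDeriv, List.length_cons, Finset.sum_range_succ', List.getD_cons_succ]
  simp

theorem exists_ratCode_near (r : ℝ) {ε : ℝ} (hε : 0 < ε) : ∃ c : RatCode, |(c.val : ℝ) - r| < ε := by
  obtain ⟨q, hq⟩ := exists_rat_btwn (show r - ε < r + ε by linarith)
  obtain ⟨c, rfl⟩ := RatCode.val_surjective q
  exact ⟨c, abs_lt.2 ⟨by linarith [hq.1], by linarith [hq.2]⟩⟩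

/-- Weierstrass gives a real polynomial within ε/2. Its coefficients divided by i + 1, as in an
antiderivative, are rounded to rationals so that each of the d terms of the derivative loses at most
ε/(2d). -/
theorem exists_abs_polyDeriv_sub_lt {φ : ℝ → ℝ} (hφ : ContinuousOn φ (Icc 0 1)) {ε : ℝ}
    (hε : 0 < ε) :
    ∃ l : List RatCode, ∀ x ∈ Icc (0 : ℝ) 1, |polyDeriv ((0, 0, 0) :: l) x - φ x| < ε := by
  obtain ⟨P, hP⟩ := exists_polynomial_near_of_continuousOn 0 1 φ hφ (ε / 2) (half_pos hε)
  set d := P.natDegree + 1 with hd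
  have hd0 : (0 : ℝ) < d := by positivity
  choose r hr using fun i : ℕ => exists_ratCode_near (P.coeff i / (i + 1))
    (show 0 < ε / 2 / d / (i + 1) by positivity)
  refine ⟨(List.range d).map r, fun x hx => ?_⟩
  rw [polyDeriv_zero_cons]
  simp only [List.length_map, List.length_range]
  have h1 : |∑ i ∈ Finset.range d, ((i : ℝ) + 1) *
      ((((List.range d).map r).getD i (0, 0, 0)).val : ℝ) * x ^ i - P.eval x| ≤ ε / 2 := by
    rw [Polynomial.eval_eq_sum_range, ← hd, ← Finset.sum_sub_distrib]
    refine (Finset.abs_sum_le_sum_abs _ _).trans ?_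
    refine (Finset.sum_le_card_nsmul _ _ (ε / 2 / d) fun i hi => ?_).trans_eq ?_
    · have e : ((List.range d).map r).getD i (0, 0, 0) = r i := by
        simp [List.getD_eq_getElem?_getD, List.getElem?_range (Finset.mem_range.1 hi)]
      rw [e, ← sub_mul, abs_mul]
      have h2 : |x ^ i| ≤ 1 := by
        rw [abs_pow]
        exact pow_le_one₀ (abs_nonneg _) (abs_le.2 ⟨by linarith [hx.1], hx.2⟩)
      have h3 : |((i : ℝ) + 1) * ((r i).val : ℝ) - P.coeff i| ≤ ε / 2 / d := by
        have h4 := (hr i).le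
        have e2 : ((i : ℝ) + 1) * ((r i).val : ℝ) - P.coeff i =
            (((r i).val : ℝ) - P.coeff i / (i + 1)) * ((i : ℝ) + 1) := by field_simp
        rw [e2, abs_mul, abs_of_pos (by positivity : (0 : ℝ) < (i : ℝ) + 1)]
        exact (le_div_iff₀ (by positivity)).1 h4
      exact (mul_le_mul h3 h2 (abs_nonneg _) (by positivity)).trans_eq (mul_one _)
    · simp only [Finset.card_range, nsmul_eq_mul]
      field_simp
  have h2 := hP x hx
  refine (abs_sub_le _ (P.eval x) _).trans_lt ?_
  linarith

/-- An L¹-close continuous function is truncated to `[0,1]`, which does not increase its distance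
from `u`. A uniform approximation within 1/2 then keeps the derivative below 3/2. -/
theorem exists_lintegral_sub_polyDeriv_le {u : ℝ → ℝ} (hu : Measurable u)
    (hu01 : ∀ x, u x ∈ Icc (0 : ℝ) 1) {η : ℝ} (hη : 0 < η) :
    ∃ l : List RatCode, (∀ x ∈ Icc (0 : ℝ) 1, |polyDeriv ((0, 0, 0) :: l) x| ≤ 3 / 2) ∧
      ∫⁻ x in Icc (0 : ℝ) 1, ‖u x - polyDeriv ((0, 0, 0) :: l) x‖ₑ ≤ ENNReal.ofReal η := by
  have hint : Integrable u (volume.restrict (Icc (0 : ℝ) 1)) := by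
    refine Integrable.of_bound hu.aestronglyMeasurable 1 (Eventually.of_forall fun x => ?_)
    rw [Real.norm_eq_abs, abs_le]
    constructor <;> linarith [(hu01 x).1, (hu01 x).2]
  obtain ⟨φ, hφ, -⟩ := hint.exists_boundedContinuous_lintegral_sub_le
    (ε := ENNReal.ofReal (η / 2)) (by simpa using half_pos hη)
  let ψ : ℝ → ℝ := fun x => max 0 (min 1 (φ x))
  have hψ : Continuous ψ := by fun_prop
  obtain ⟨l, hl⟩ := exists_abs_polyDeriv_sub_lt (φ := ψ) hψ.continuousOn
    (ε := min (η / 2) (1 / 2)) (by positivity)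
  have hψ01 : ∀ x, ψ x ∈ Icc (0 : ℝ) 1 := fun x =>
    ⟨le_max_left _ _, max_le zero_le_one (min_le_left _ _)⟩
  have huψ : ∀ x, |u x - ψ x| ≤ |u x - φ x| := by
    intro x
    have h1 := hu01 x
    have e : u x = max 0 (min 1 (u x)) := by rw [min_eq_right h1.2, max_eq_right h1.1]
    calc |u x - ψ x| = |max 0 (min 1 (u x)) - max 0 (min 1 (φ x))| := by rw [← e]
      _ ≤ |min 1 (u x) - min 1 (φ x)| := by
          simpa using abs_max_sub_max_le_max 0 (min 1 (u x)) 0 (min 1 (φ x))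
      _ ≤ |u x - φ x| := by simpa using abs_min_sub_min_le_max 1 (u x) 1 (φ x)
  refine ⟨l, fun x hx => ?_, ?_⟩
  · have h1 := (hl x hx).le.trans (min_le_right _ _)
    have h2 := hψ01 x
    rw [abs_le] at h1 ⊢
    constructor <;> linarith [h1.1, h1.2, h2.1, h2.2]
  · calc ∫⁻ x in Icc (0 : ℝ) 1, ‖u x - polyDeriv ((0, 0, 0) :: l) x‖ₑ
        ≤ ∫⁻ x in Icc (0 : ℝ) 1, (‖u x - φ x‖ₑ + ENNReal.ofReal (η / 2)) := by
          refine setLIntegral_mono' measurableSet_Icc fun x hx => ?_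
          have h1 := (hl x hx).le.trans (min_le_left _ _)
          rw [Real.enorm_eq_ofReal_abs, Real.enorm_eq_ofReal_abs,
            ← ENNReal.ofReal_add (abs_nonneg _) (half_pos hη).le]
          refine ENNReal.ofReal_le_ofReal ((abs_sub_le _ (ψ x) _).trans ?_)
          rw [abs_sub_comm] at h1
          exact add_le_add (huψ x) h1
      _ = (∫⁻ x in Icc (0 : ℝ) 1, ‖u x - φ x‖ₑ) + ENNReal.ofReal (η / 2) := by
          rw [lintegral_add_right _ measurable_const]
          simp
      _ ≤ ENNReal.ofReal (η / 2) + ENNReal.ofReal (η / 2) := by gcongr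
      _ = ENNReal.ofReal η := by
          rw [← ENNReal.ofReal_add (half_pos hη).le (half_pos hη).le, add_halves]

/-- A Riemann sum that bounds the `L¹` distance on `[0,1]` of the derivative of a coded polynomial
and the step function with values `v j` on the cells of level `T`. -/
def stepDist (v : ℕ → ℚ) (l : List RatCode) (T : ℕ) : ℚ :=
  (∑ j ∈ Finset.range (2 ^ T), (|v j - ratDeriv l (j / 2 ^ T)| + ratLip l / 2 ^ T)) / 2 ^ T

theorem abs_polyDeriv_sub_ratDeriv_le (l : List RatCode) {T j : ℕ} (hj : j < 2 ^ T) {x : ℝ}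
    (hx : x ∈ dyadicCell T j) :
    |polyDeriv l x - (ratDeriv l (j / 2 ^ T) : ℚ)| ≤ ratLip l / 2 ^ T := by
  have h1 := dyadicCell_subset T j hx
  have h2 := abs_polyDeriv_sub_le l hx.1 (div_two_pow_mem hj.le)
  rw [ratDeriv_cast]
  push_cast
  refine h2.trans ?_
  rw [div_eq_mul_one_div (ratLip l : ℝ)]
  refine mul_le_mul_of_nonneg_left ?_ (by exact_mod_cast ratLip_nonneg l)
  rw [abs_of_nonneg (sub_nonneg.2 h1.1)]
  have := h1.2
  rw [add_div] at this
  linarith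

theorem lintegral_step_sub_polyDeriv_le (v : ℕ → ℚ) (l : List RatCode) (T : ℕ) :
    ∫⁻ x in Icc (0 : ℝ) 1, ‖(v (dyadicIndex T x) : ℝ) - polyDeriv l x‖ₑ ≤
      ENNReal.ofReal (stepDist v l T) := by
  have hB : (0 : ℝ) ≤ ratLip l := by exact_mod_cast ratLip_nonneg l
  have e : (stepDist v l T : ℝ) = ∑ j ∈ Finset.range (2 ^ T),
      (|(v j : ℝ) - (ratDeriv l (j / 2 ^ T) : ℚ)| + ratLip l / 2 ^ T) * (2 : ℝ)⁻¹ ^ T := by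
    unfold stepDist
    push_cast
    rw [Finset.sum_div]
    refine Finset.sum_congr rfl fun j _ => ?_
    rw [inv_pow, div_eq_mul_inv]
  rw [e, lintegral_eq_sum_dyadicCell T, ENNReal.ofReal_sum_of_nonneg fun j _ => by positivity]
  refine Finset.sum_le_sum fun j hj => ?_
  have hj := Finset.mem_range.1 hj
  rw [ENNReal.ofReal_mul (by positivity), ← inv_two_pow_eq_ofReal, ← volume_dyadicCell hj,
    ← setLIntegral_const]
  refine setLIntegral_mono' (measurableSet_dyadicCell T j) fun x hx => ?_
  rw [hx.2, Real.enorm_eq_ofReal_abs]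
  refine ENNReal.ofReal_le_ofReal ((abs_sub_le _ ((ratDeriv l (j / 2 ^ T) : ℚ) : ℝ) _).trans ?_)
  have := abs_polyDeriv_sub_ratDeriv_le l hj hx
  rw [abs_sub_comm] at this
  gcongr

/-- The Riemann sum overestimates the L¹ distance only by twice the Lipschitz error. Hence a search
for a small `stepDist` succeeds once a close polynomial exists. -/
theorem stepDist_le (v : ℕ → ℚ) (l : List RatCode) (T : ℕ) {η : ℝ} (hη : 0 ≤ η)
    (h : ∫⁻ x in Icc (0 : ℝ) 1, ‖(v (dyadicIndex T x) : ℝ) - polyDeriv l x‖ₑ ≤ ENNReal.ofReal η) :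
    (stepDist v l T : ℝ) ≤ η + 2 * (ratLip l / 2 ^ T) := by
  have hB : (0 : ℝ) ≤ ratLip l := by exact_mod_cast ratLip_nonneg l
  have e : (stepDist v l T : ℝ) = ∑ j ∈ Finset.range (2 ^ T),
      |(v j : ℝ) - (ratDeriv l (j / 2 ^ T) : ℚ)| * (2 : ℝ)⁻¹ ^ T + ratLip l / 2 ^ T := by
    unfold stepDist
    push_cast
    rw [Finset.sum_add_distrib, add_div, Finset.sum_div]
    congr 1
    · refine Finset.sum_congr rfl fun j _ => ?_
      rw [inv_pow, div_eq_mul_inv]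
    · simp
  have key : ENNReal.ofReal (∑ j ∈ Finset.range (2 ^ T),
      |(v j : ℝ) - (ratDeriv l (j / 2 ^ T) : ℚ)| * (2 : ℝ)⁻¹ ^ T) ≤
      ENNReal.ofReal (η + ratLip l / 2 ^ T) := by
    rw [ENNReal.ofReal_sum_of_nonneg fun j _ => by positivity]
    calc _ ≤ ∑ j ∈ Finset.range (2 ^ T), ∫⁻ x in dyadicCell T j,
          (‖(v (dyadicIndex T x) : ℝ) - polyDeriv l x‖ₑ + ENNReal.ofReal (ratLip l / 2 ^ T)) := by
          refine Finset.sum_le_sum fun j hj => ?_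
          have hj := Finset.mem_range.1 hj
          rw [ENNReal.ofReal_mul (by positivity), ← inv_two_pow_eq_ofReal, ← volume_dyadicCell hj,
            ← setLIntegral_const]
          refine setLIntegral_mono' (measurableSet_dyadicCell T j) fun x hx => ?_
          rw [hx.2, Real.enorm_eq_ofReal_abs, ← ENNReal.ofReal_add (by positivity) (by positivity)]
          exact ENNReal.ofReal_le_ofReal ((abs_sub_le _ (polyDeriv l x) _).trans
            (add_le_add le_rfl (abs_polyDeriv_sub_ratDeriv_le l hj hx)))
      _ = (∫⁻ x in Icc (0 : ℝ) 1, ‖(v (dyadicIndex T x) : ℝ) - polyDeriv l x‖ₑ) +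
          ENNReal.ofReal (ratLip l / 2 ^ T) := by
          rw [← lintegral_eq_sum_dyadicCell, lintegral_add_right _ measurable_const]
          simp
      _ ≤ ENNReal.ofReal η + ENNReal.ofReal (ratLip l / 2 ^ T) := by gcongr
      _ = _ := (ENNReal.ofReal_add hη (by positivity)).symm
  have := (ENNReal.ofReal_le_ofReal_iff (by positivity)).1 key
  rw [e]
  linarith

/-- A function with a bounded derivative that is small in `L¹` has small `p`-variation norm. -/
theorem pVarNorm_le_of_lintegral_le {p : ℝ} (hp : 1 ≤ p) {P : ℕ} (hP : p ≤ P) {h F : ℝ → ℝ}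
    (hint : IntervalIntegrable h volume 0 1) (hbd : ∀ x ∈ Icc (0 : ℝ) 1, |h x| ≤ 4)
    (hF : ∀ x ∈ Icc (0 : ℝ) 1, F x = ∫ t in (0 : ℝ)..x, h t) {n : ℕ}
    (hL : ∫⁻ x in Icc (0 : ℝ) 1, ‖h x‖ₑ ≤ ENNReal.ofReal ((2 : ℝ)⁻¹ ^ ((n + 2) * P))) :
    pVarNorm p F ≤ (2 : ℝ≥0∞)⁻¹ ^ n := by
  have hp0 : 0 < p := by linarith
  have hsub : ∀ x y, 0 ≤ x → x ≤ y → y ≤ 1 → IntervalIntegrable h volume x y := by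
    intro x y hx hxy hy
    refine hint.mono_set ?_
    rw [uIcc_of_le hxy, uIcc_of_le zero_le_one]
    exact Icc_subset_Icc hx hy
  have hF0 : F 0 = 0 := by simpa using hF 0 ⟨le_rfl, zero_le_one⟩
  have hV : pVariation p F 0 1 ≤ ENNReal.ofReal
      ((4 : ℝ) ^ (p - 1) * (∫ t in (0 : ℝ)..1, |h t|) -
        (4 : ℝ) ^ (p - 1) * (∫ t in (0 : ℝ)..0, |h t|)) := by
    -- The factor |ΔF|^(p-1) is at most (4|y-x|)^(p-1), which cancels the denominator; the remaining
    -- |ΔF| is at most the integral of |h| and hence additive.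
    refine pVariation_le_of_le_sub (Φ := fun x => (4 : ℝ) ^ (p - 1) * ∫ t in (0 : ℝ)..x, |h t|)
      fun x y hx hxy hy => ?_
    have hx1 := hxy.le.trans hy
    have e1 : F y - F x = ∫ t in x..y, h t := by
      rw [hF y ⟨hx.trans hxy.le, hy⟩, hF x ⟨hx, hx1⟩]
      exact intervalIntegral.integral_interval_sub_left (hsub 0 y le_rfl (hx.trans hxy.le) hy)
        (hsub 0 x le_rfl hx hx1)
    have e2 : (∫ t in (0 : ℝ)..y, |h t|) - ∫ t in (0 : ℝ)..x, |h t| = ∫ t in x..y, |h t| :=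
      intervalIntegral.integral_interval_sub_left (hsub 0 y le_rfl (hx.trans hxy.le) hy).abs
        (hsub 0 x le_rfl hx hx1).abs
    have h1 : |F y - F x| ≤ ∫ t in x..y, |h t| := by
      rw [e1]
      exact intervalIntegral.abs_integral_le_integral_abs hxy.le
    have h2 : |F y - F x| ≤ 4 * (y - x) := by
      rw [e1, ← Real.norm_eq_abs, ← abs_of_pos (sub_pos.2 hxy)]
      refine intervalIntegral.norm_integral_le_of_norm_le_const fun t ht => hbd t ?_
      rw [uIoc_of_le hxy.le] at ht
      exact ⟨hx.trans ht.1.le, ht.2.trans hy⟩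
    have h3 : 0 < |y - x| := abs_pos.2 (sub_pos.2 hxy).ne'
    rw [← mul_sub, e2, div_le_iff₀ (Real.rpow_pos_of_pos h3 _)]
    calc |F y - F x| ^ p = |F y - F x| ^ (p - 1) * |F y - F x| := by
          rw [← Real.rpow_add_one' (abs_nonneg _) (by linarith), sub_add_cancel]
      _ ≤ (4 * (y - x)) ^ (p - 1) * ∫ t in x..y, |h t| := by
          gcongr
      _ = _ := by
          rw [Real.mul_rpow (by norm_num) (sub_pos.2 hxy).le, abs_of_pos (sub_pos.2 hxy)]
          ring
  have hI : ∫ t in (0 : ℝ)..1, |h t| ≤ (2 : ℝ)⁻¹ ^ ((n + 2) * P) := by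
    rw [intervalIntegral.integral_of_le zero_le_one, ← integral_Icc_eq_integral_Ioc]
    have hi : Integrable h (volume.restrict (Icc 0 1)) :=
      (intervalIntegrable_iff_integrableOn_Icc_of_le zero_le_one).1 hint
    rw [← ofReal_integral_norm_eq_lintegral_enorm hi] at hL
    exact (ENNReal.ofReal_le_ofReal_iff (by positivity)).1 hL
  have hV' : pVariation p F 0 1 ≤ ENNReal.ofReal (((2 : ℝ)⁻¹ ^ n) ^ p) := by
    refine hV.trans (ENNReal.ofReal_le_ofReal ?_)
    rw [intervalIntegral.integral_same, mul_zero, sub_zero]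
    have h1 : (4 : ℝ) ^ (p - 1) ≤ 4 ^ P := by
      rw [← Real.rpow_natCast]
      exact Real.rpow_le_rpow_of_exponent_le (by norm_num) (by linarith)
    -- Of the exponent (n+2)P, the part 2P absorbs the constant 4^(p-1) and the part nP gives
    -- (2^(-n))^p.
    have h2 : (2 : ℝ)⁻¹ ^ ((n + 2) * P) = ((2 : ℝ)⁻¹ ^ n) ^ (P : ℝ) * ((4 : ℝ) ^ P)⁻¹ := by
      rw [Real.rpow_natCast, add_mul, pow_add, ← pow_mul, pow_mul _ 2 P, ← inv_pow]
      norm_num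
    have h3 : ((2 : ℝ)⁻¹ ^ n) ^ (P : ℝ) ≤ ((2 : ℝ)⁻¹ ^ n) ^ p :=
      Real.rpow_le_rpow_of_exponent_ge (by positivity)
        (pow_le_one₀ (by norm_num) (by norm_num)) hP
    calc (4 : ℝ) ^ (p - 1) * ∫ t in (0 : ℝ)..1, |h t|
        ≤ 4 ^ P * (((2 : ℝ)⁻¹ ^ n) ^ (P : ℝ) * ((4 : ℝ) ^ P)⁻¹) := by
          rw [← h2]
          exact mul_le_mul h1 hI (intervalIntegral.integral_nonneg zero_le_one
            fun _ _ => abs_nonneg _) (by positivity)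
      _ = ((2 : ℝ)⁻¹ ^ n) ^ (P : ℝ) := by field_simp
      _ ≤ _ := h3
  rw [pVarNorm, hF0, abs_zero, ENNReal.ofReal_zero, zero_add, one_div,
    ENNReal.rpow_inv_le_iff hp0, inv_two_pow_eq_ofReal,
    ENNReal.ofReal_rpow_of_nonneg (by positivity) hp0.le]
  exact hV'

/-! ### The alternating stopping times of a Schnorr test -/

open Classical in
/-- Follow a path `π` through the dyadic cells. The state consists of the index of a component of
the test and of a sign. When the path enters that component, at level `i + 1`, the sign is changed,
and the next component to be watched is the one with index `i + 4`. -/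
def pathState (c : ℕ → ℕ → RatCode × RatCode) (π : ℕ → ℕ) : ℕ → ℕ × Bool
  | 0 => (3, false)
  | i + 1 =>
    if InCell (c (pathState c π i).1) (i + 1) (i + 1) (π (i + 1))
    then (i + 4, !(pathState c π i).2) else pathState c π i

theorem pathState_congr (c : ℕ → ℕ → RatCode × RatCode) {π π' : ℕ → ℕ} {s : ℕ}
    (h : ∀ i ≤ s, π i = π' i) : pathState c π s = pathState c π' s := by
  induction s with
  | zero => rfl
  | succ s ih =>
    simp only [pathState]
    rw [ih fun i hi => h i (by omega), h (s + 1) le_rfl]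

/-- The state at the cell of level `s` and index `j`. -/
def cellState (c : ℕ → ℕ → RatCode × RatCode) (s j : ℕ) : ℕ × Bool :=
  pathState c (fun i => j / 2 ^ (s - i)) s

/-- The state at level `s` on the path of the point `x`. -/
def pointState (c : ℕ → ℕ → RatCode × RatCode) (s : ℕ) (x : ℝ) : ℕ × Bool :=
  pathState c (fun i => dyadicIndex i x) s

theorem pointState_eq_cellState (c : ℕ → ℕ → RatCode × RatCode) (s : ℕ) (x : ℝ) :
    pointState c s x = cellState c s (dyadicIndex s x) := by
  refine pathState_congr c fun i hi => ?_
  have := dyadicIndex_div_two_pow i (s - i) x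
  rw [Nat.add_sub_cancel' hi] at this
  exact this.symm

open Classical in
theorem pointState_succ (c : ℕ → ℕ → RatCode × RatCode) (s : ℕ) (x : ℝ) :
    pointState c (s + 1) x =
      if InCell (c (pointState c s x).1) (s + 1) (s + 1) (dyadicIndex (s + 1) x)
      then (s + 4, !(pointState c s x).2) else pointState c s x := rfl

/-- The ancestors of cell `j` have indices j / 2^(s-i), so the state arises by recursion on the
level with a decidable test at each step. -/
theorem computable_cellState {α : Type*} [Primcodable α] {c : ℕ → ℕ → RatCode × RatCode}
    (hc : Computable₂ c) {s j : α → ℕ} (hs : Computable s) (hj : Computable j) :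
    Computable fun a => cellState c (s a) (j a) := by
  classical
  have hc' : Computable fun x : ℕ × ℕ => c x.1 x.2 := hc
  have hnot : Computable fun b : Bool => !b := Primrec.not.to_comp
  have hstep : Computable fun x : α × ℕ × ℕ × Bool =>
      if InCell (c x.2.2.1) (x.2.1 + 1) (x.2.1 + 1) (j x.1 / 2 ^ (s x.1 - (x.2.1 + 1)))
      then (x.2.1 + 4, !x.2.2.2) else x.2.2 := by
    refine ComputablePred.ite' ?_ (by fun_prop) (by fun_prop)
    refine computablePred_inCell (c := fun x : α × ℕ × ℕ × Bool => c x.2.2.1) ?_ (by fun_prop)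
      (by fun_prop) (by fun_prop)
    exact hc'.comp (f := fun x : ℕ × ℕ => c x.1 x.2)
      (g := fun x : (α × ℕ × ℕ × Bool) × ℕ => (x.1.2.2.1, x.2)) (by fun_prop)
  refine (Computable.nat_rec' (σ := ℕ × Bool) (f := s) (g := fun _ => (3, false))
    (h := fun a i q => if InCell (c q.1) (i + 1) (i + 1) (j a / 2 ^ (s a - (i + 1)))
      then (i + 4, !q.2) else q) hs (by fun_prop) hstep).of_eq fun a => ?_
  unfold cellState
  generalize hπ : (fun i => j a / 2 ^ (s a - i)) = π
  have : ∀ i, j a / 2 ^ (s a - i) = π i := fun i => congrFun hπ i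
  simp only [this]
  generalize s a = n
  induction n with
  | zero => rfl
  | succ n ih => simp only [pathState, ← ih]

/-! ### How long the state stays constant along a Schnorr test -/

section Test

variable {c : ℕ → ℕ → RatCode × RatCode} {G : ℕ → Set ℝ}

theorem InCell.mem_iUnion {s T r : ℕ} {x : ℝ}
    (hG : ∀ m, G m = Icc (0 : ℝ) 1 ∩ ⋃ i, Ioo ((c m i).1.val : ℝ) ((c m i).2.val : ℝ))
    (hx : x ∈ Icc (0 : ℝ) 1) (h : InCell (c r) s T (dyadicIndex T x)) : x ∈ G r := by
  obtain ⟨i, -, hi⟩ := h.mem hx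
  rw [hG]
  exact ⟨hx, Set.mem_iUnion.2 ⟨i, hi⟩⟩

/-- A cell of measure 2^(-T) inside `G r` forces 2^(-T) ≤ 2^(-r). -/
theorem InCell.le_level {s T r j : ℕ} (hj : j < 2 ^ T)
    (hG : ∀ m, G m = Icc (0 : ℝ) 1 ∩ ⋃ i, Ioo ((c m i).1.val : ℝ) ((c m i).2.val : ℝ))
    (hvol : ∀ m, volume (G m) ≤ (2 : ℝ≥0∞)⁻¹ ^ m) (h : InCell (c r) s T j) : r ≤ T := by
  have h1 : dyadicCell T j ⊆ G r := by
    rintro x ⟨hx, rfl⟩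
    exact h.mem_iUnion hG hx
  have h2 := (measure_mono h1).trans (hvol r)
  rw [volume_dyadicCell hj, inv_two_pow_eq_ofReal, inv_two_pow_eq_ofReal,
    ENNReal.ofReal_le_ofReal_iff (by positivity)] at h2
  exact (pow_le_pow_iff_right_of_lt_one₀ (by norm_num) (by norm_num)).1 h2

/-- The watched component has not been entered yet: right after a change at level s + 1 its index is
s + 4, too large for it to contain the present cell, and the initial index 3 is too large for level
0. -/
theorem not_inCell_pointState
    (hG : ∀ m, G m = Icc (0 : ℝ) 1 ∩ ⋃ i, Ioo ((c m i).1.val : ℝ) ((c m i).2.val : ℝ))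
    (hvol : ∀ m, volume (G m) ≤ (2 : ℝ≥0∞)⁻¹ ^ m) (s : ℕ) (x : ℝ) :
    ¬ InCell (c (pointState c s x).1) s s (dyadicIndex s x) := by
  induction s with
  | zero =>
    intro h
    have := h.le_level (dyadicIndex_lt 0 x) hG hvol
    simp [pointState, pathState] at this
  | succ s ih =>
    rw [pointState_succ]
    split_ifs with h
    · intro h'
      have := h'.le_level (dyadicIndex_lt _ x) hG hvol
      simp at this
    · exact h

/-- The points of `[0,1]` at which the state changes after level `s`. -/
def changeSet (c : ℕ → ℕ → RatCode × RatCode) (s : ℕ) : Set ℝ :=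
  {x | x ∈ Icc (0 : ℝ) 1 ∧ ∃ t, s ≤ t ∧ pointState c t x ≠ pointState c s x}

theorem exists_change {s : ℕ} {x : ℝ} (h : ∃ t, s ≤ t ∧ pointState c t x ≠ pointState c s x) :
    ∃ u, s ≤ u ∧ pointState c u x = pointState c s x ∧
      InCell (c (pointState c s x).1) (u + 1) (u + 1) (dyadicIndex (u + 1) x) ∧
      pointState c (u + 1) x = (u + 4, !(pointState c s x).2) := by
  classical
  obtain ⟨h1, h2⟩ := Nat.find_spec h
  set t := Nat.find h with ht
  have hst : s < t := lt_of_le_of_ne h1 fun e => h2 (by rw [← e])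
  obtain ⟨u, hu⟩ : ∃ u, t = u + 1 := ⟨t - 1, by omega⟩
  have h3 : pointState c u x = pointState c s x := by
    by_contra hne
    exact Nat.find_min h (m := u) (by omega) ⟨by omega, hne⟩
  rw [hu, pointState_succ, h3] at h2
  refine ⟨u, by omega, h3, ?_, ?_⟩
  · by_contra hn
    rw [if_neg hn] at h2
    exact h2 rfl
  · rw [pointState_succ, h3]
    split_ifs with hn
    · rfl
    · rw [if_neg hn] at h2
      exact absurd rfl h2

/-- A later change means entering the component watched at level `s`, and by `not_inCell_pointState`
this has not happened by level `s`. -/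
theorem changeSet_subset
    (hG : ∀ m, G m = Icc (0 : ℝ) 1 ∩ ⋃ i, Ioo ((c m i).1.val : ℝ) ((c m i).2.val : ℝ))
    (hvol : ∀ m, volume (G m) ≤ (2 : ℝ≥0∞)⁻¹ ^ m) {s : ℕ} {x : ℝ} (hx : x ∈ changeSet c s) :
    x ∈ G (pointState c s x).1 \ cellUnion (c (pointState c s x).1) s s := by
  obtain ⟨u, -, -, h, -⟩ := exists_change hx.2
  exact ⟨h.mem_iUnion hG hx.1, fun h' => not_inCell_pointState hG hvol s x h'.2⟩

/-- The watched index may depend on the point. Indices below `R` contribute at most R · 2^(-2R) ≤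
2^(-R), and all others lie in the tail of the test, of measure at most 2 · 2^(-R). -/
theorem volume_changeSet_le
    (hG : ∀ m, G m = Icc (0 : ℝ) 1 ∩ ⋃ i, Ioo ((c m i).1.val : ℝ) ((c m i).2.val : ℝ))
    (hvol : ∀ m, volume (G m) ≤ (2 : ℝ≥0∞)⁻¹ ^ m) {s R : ℕ}
    (h : ∀ r < R, volume (G r \ cellUnion (c r) s s) ≤ (2 : ℝ≥0∞)⁻¹ ^ (2 * R)) :
    volume (changeSet c s) ≤ 3 * (2 : ℝ≥0∞)⁻¹ ^ R := by
  have hsub : changeSet c s ⊆ (⋃ r ∈ Finset.range R, G r \ cellUnion (c r) s s) ∪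
      ⋃ k, G (R + k) := by
    intro x hx
    have h1 := changeSet_subset hG hvol hx
    by_cases hR : (pointState c s x).1 < R
    · exact .inl (mem_iUnion₂.2 ⟨_, Finset.mem_range.2 hR, h1⟩)
    · refine .inr (mem_iUnion.2 ⟨(pointState c s x).1 - R, ?_⟩)
      rw [Nat.add_sub_cancel' (not_lt.1 hR)]
      exact h1.1
  have e : (3 : ℝ≥0∞) * (2 : ℝ≥0∞)⁻¹ ^ R = (2 : ℝ≥0∞)⁻¹ ^ R + 2 * (2 : ℝ≥0∞)⁻¹ ^ R := by ring
  rw [e]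
  refine (measure_mono hsub).trans ((measure_union_le _ _).trans (add_le_add ?_ ?_))
  · refine (measure_biUnion_finset_le _ _).trans ?_
    refine (Finset.sum_le_card_nsmul _ _ _ fun r hr => h r (Finset.mem_range.1 hr)).trans ?_
    rw [Finset.card_range, nsmul_eq_mul, two_mul, pow_add, ← mul_assoc]
    have h2 : (R : ℝ≥0∞) ≤ 2 ^ R := by exact_mod_cast R.lt_two_pow_self.le
    have h3 : (2 : ℝ≥0∞) ^ R * (2 : ℝ≥0∞)⁻¹ ^ R = 1 := by
      rw [← mul_pow, ENNReal.mul_inv_cancel (by simp) (by simp), one_pow]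
    calc _ ≤ (2 : ℝ≥0∞) ^ R * (2 : ℝ≥0∞)⁻¹ ^ R * (2 : ℝ≥0∞)⁻¹ ^ R := by gcongr
      _ = _ := by rw [h3, one_mul]
  · refine (measure_iUnion_le _).trans ((ENNReal.tsum_le_tsum fun k => hvol (R + k)).trans ?_)
    have h1 : ∀ k : ℕ, (2 : ℝ≥0∞)⁻¹ ^ (R + k) = 2 * (2 : ℝ≥0∞)⁻¹ ^ (R + k + 1) := fun k => by
      rw [pow_succ' _ (R + k), ← mul_assoc, ENNReal.mul_inv_cancel (by simp) (by simp), one_mul]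
    simp_rw [h1]
    rw [ENNReal.tsum_mul_left, tsum_inv_two_pow_succ_add]

theorem tendsto_volume_cellUnion
    (hG : ∀ m, G m = Icc (0 : ℝ) 1 ∩ ⋃ i, Ioo ((c m i).1.val : ℝ) ((c m i).2.val : ℝ)) (r : ℕ) :
    Tendsto (fun s => (cellVolume (c r) s s : ℝ)) atTop (𝓝 (volume (G r)).toReal) := by
  have e : G r = ⋃ s, cellUnion (c r) s s := by
    ext x
    constructor
    · intro hx
      rw [hG] at hx
      obtain ⟨i, hi⟩ := mem_iUnion.1 hx.2
      obtain ⟨s, hs⟩ := exists_inCell hx.1 hi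
      exact mem_iUnion.2 ⟨s, hx.1, hs s le_rfl⟩
    · intro hx
      obtain ⟨s, hs⟩ := mem_iUnion.1 hx
      exact hs.2.mem_iUnion hG hs.1
  have hmono : Monotone fun s => cellUnion (c r) s s := fun s t hst x hx =>
    ⟨hx.1, hx.2.mono hst hst⟩
  have hfin : volume (G r) ≠ ∞ := by
    rw [hG]
    exact ne_top_of_le_ne_top (by simp) (measure_mono (inter_subset_left (s := Icc (0 : ℝ) 1)))
  have h1 := (ENNReal.tendsto_toReal hfin)
  have h2 := tendsto_measure_iUnion_atTop (μ := volume) hmono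
  rw [← e] at h2
  have h3 := h1.comp h2
  simpa only [Function.comp_def, volume_cellUnion] using h3

/-- A computable level after which the state changes only on a set of small measure. -/
theorem exists_computable_level (hc : Computable₂ c)
    (hG : ∀ m, G m = Icc (0 : ℝ) 1 ∩ ⋃ i, Ioo ((c m i).1.val : ℝ) ((c m i).2.val : ℝ))
    (hvol : ∀ m, volume (G m) ≤ (2 : ℝ≥0∞)⁻¹ ^ m)
    (hcomp : UniformlyComputableReals fun m => (volume (G m)).toReal) :
    ∃ s : ℕ → ℕ, Computable s ∧ ∀ n, volume (changeSet c (s n)) ≤ (2 : ℝ≥0∞)⁻¹ ^ n := by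
  obtain ⟨a, ha, hname⟩ := hcomp
  have ha' : Computable fun x : ℕ × ℕ => a x.1 x.2 := ha
  have hc' : Computable fun x : ℕ × ℕ => c x.1 x.2 := hc
  -- The approximation `a r (2 * R + 2)` is within 2^(-(2R+2)) of the measure of `G r`. So the
  -- decidable condition holds for late `s`, and it implies that less than 2^(-2R) of `G r` is
  -- uncovered.
  obtain ⟨s, hs, hspec⟩ := ComputablePred.exists_choice (α := ℕ) (β := ℕ)
    (P := fun R s => ∀ r < R, (a r (2 * R + 2)).val - cellVolume (c r) s s ≤ (1 / 2) ^ (2 * R + 1))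
    (by
      refine ComputablePred.forall_lt (α := ℕ × ℕ) (n := fun x => x.1)
        (P := fun x r => (a r (2 * x.1 + 2)).val - cellVolume (c r) x.2 x.2 ≤
          (1 / 2) ^ (2 * x.1 + 1)) ?_ (by fun_prop)
      refine ComputableRat.le (ComputableRat.sub ?_ ?_) (by fun_prop)
      · exact ComputableRat.val (ha'.comp (f := fun x : ℕ × ℕ => a x.1 x.2)
          (g := fun x : (ℕ × ℕ) × ℕ => (x.2, 2 * x.1.1 + 2)) (by fun_prop))
      · exact computableRat_cellVolume (c := fun x : (ℕ × ℕ) × ℕ => c x.2)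
          (hc'.comp (f := fun x : ℕ × ℕ => c x.1 x.2)
            (g := fun x : ((ℕ × ℕ) × ℕ) × ℕ => (x.1.2, x.2)) (by fun_prop)) (by fun_prop)
          (by fun_prop))
    (by
      intro R
      have h1 : ∀ r ∈ Finset.range R, ∀ᶠ s in atTop,
          (volume (G r)).toReal - (2 : ℝ)⁻¹ ^ (2 * R + 2) < cellVolume (c r) s s := fun r _ =>
        (tendsto_volume_cellUnion hG r).eventually_const_lt (by
          have : (0 : ℝ) < (2 : ℝ)⁻¹ ^ (2 * R + 2) := by positivity
          linarith)
      obtain ⟨s, hs⟩ := ((Filter.eventually_all_finset _).2 h1).exists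
      refine ⟨s, fun r hr => ?_⟩
      have h2 := hs r (Finset.mem_range.2 hr)
      have h3 := (abs_le.1 ((hname r).abs_sub_le (2 * R + 2))).2
      have e : (2 : ℝ)⁻¹ ^ (2 * R + 1) = (2 : ℝ)⁻¹ ^ (2 * R + 2) + (2 : ℝ)⁻¹ ^ (2 * R + 2) := by
        ring
      rw [← Rat.cast_le (K := ℝ)]
      push_cast
      rw [one_div, e]
      linarith)
  -- The shift by 2 absorbs the factor 3 of `volume_changeSet_le`.
  refine ⟨fun n => s (n + 2), by fun_prop, fun n => ?_⟩
  refine (volume_changeSet_le hG hvol (R := n + 2) fun r hr => ?_).trans ?_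
  · have h1 := hspec (n + 2) r hr
    rw [← Rat.cast_le (K := ℝ)] at h1
    push_cast at h1
    have h3 := (abs_le.1 ((hname r).abs_sub_le (2 * (n + 2) + 2))).1
    have hsub : cellUnion (c r) (s (n + 2)) (s (n + 2)) ⊆ G r := fun x hx =>
      hx.2.mem_iUnion hG hx.1
    have hfin : volume (cellUnion (c r) (s (n + 2)) (s (n + 2))) ≠ ∞ :=
      ne_top_of_le_ne_top (by simp) (measure_mono (t := Icc (0 : ℝ) 1) fun x hx => hx.1)
    have hfinG : volume (G r) ≠ ∞ := ne_top_of_le_ne_top (by simp) (hvol r)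
    rw [measure_sdiff hsub (measurableSet_cellUnion _ _ _).nullMeasurableSet hfin,
      inv_two_pow_eq_ofReal, ← ENNReal.ofReal_toReal hfinG, ← ENNReal.ofReal_toReal hfin,
      ← ENNReal.ofReal_sub _ ENNReal.toReal_nonneg, volume_cellUnion]
    refine ENNReal.ofReal_le_ofReal ?_
    rw [one_div] at h1
    have e : (2 : ℝ)⁻¹ ^ (2 * (n + 2)) = (2 : ℝ)⁻¹ ^ (2 * (n + 2) + 1) +
      2 * (2 : ℝ)⁻¹ ^ (2 * (n + 2) + 2) := by ring
    rw [e]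
    have : (0 : ℝ) < (2 : ℝ)⁻¹ ^ (2 * (n + 2) + 2) := by positivity
    linarith
  · rw [inv_two_pow_eq_ofReal, inv_two_pow_eq_ofReal, ← ENNReal.ofReal_ofNat,
      ← ENNReal.ofReal_mul (by norm_num)]
    refine ENNReal.ofReal_le_ofReal ?_
    have e : (2 : ℝ)⁻¹ ^ n = 4 * (2 : ℝ)⁻¹ ^ (n + 2) := by ring
    rw [e]
    have : (0 : ℝ) < (2 : ℝ)⁻¹ ^ (n + 2) := by positivity
    linarith

end Test

/-! ### A Lipschitz function that is not differentiable at the points caught by a Schnorr test -/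

/-- The numerical value of a sign. -/
def signVal (b : Bool) : ℚ := if b then 1 else 0

theorem signVal_mem (b : Bool) : (signVal b : ℝ) ∈ Icc (0 : ℝ) 1 := by
  cases b <;> simp [signVal]

/-- The points at which the sign is eventually positive. -/
def limSet (c : ℕ → ℕ → RatCode × RatCode) : Set ℝ :=
  {x | ∃ s, ∀ t, s ≤ t → (pointState c t x).2 = true}

/-- The indicator function of `limSet`. -/
def limFun (c : ℕ → ℕ → RatCode × RatCode) : ℝ → ℝ := (limSet c).indicator 1

/-- The integral of `limFun`. -/
def limIntegral (c : ℕ → ℕ → RatCode × RatCode) (x : ℝ) : ℝ := ∫ t in (0 : ℝ)..x, limFun c t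

section

variable {c : ℕ → ℕ → RatCode × RatCode}

theorem measurable_limFun (c : ℕ → ℕ → RatCode × RatCode) : Measurable (limFun c) := by
  have e : limSet c = ⋃ s, ⋂ t, ⋂ (_ : s ≤ t), {x | (cellState c t (dyadicIndex t x)).2 = true} := by
    ext x
    simp [limSet, pointState_eq_cellState]
  refine measurable_one.indicator ?_
  rw [e]
  exact .iUnion fun s => .iInter fun t => .iInter fun _ =>
    measurableSet_dyadicIndex t fun j => (cellState c t j).2 = true

theorem limFun_mem (c : ℕ → ℕ → RatCode × RatCode) (x : ℝ) : limFun c x ∈ Icc (0 : ℝ) 1 := by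
  unfold limFun
  by_cases h : x ∈ limSet c <;> simp [h]

theorem intervalIntegrable_limFun (c : ℕ → ℕ → RatCode × RatCode) (a b : ℝ) :
    IntervalIntegrable (limFun c) volume a b := by
  refine (intervalIntegrable_const (c := (1 : ℝ))).mono_fun
    (measurable_limFun c).aestronglyMeasurable (Eventually.of_forall fun x => ?_)
  simpa [abs_of_nonneg (limFun_mem c x).1] using (limFun_mem c x).2

theorem limFun_eq_of_notMem_changeSet {s : ℕ} {x : ℝ} (hx : x ∈ Icc (0 : ℝ) 1)
    (h : x ∉ changeSet c s) : limFun c x = signVal (pointState c s x).2 := by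
  have hconst : ∀ t, s ≤ t → pointState c t x = pointState c s x := fun t hst => by
    by_contra hne
    exact h ⟨hx, t, hst, hne⟩
  cases hb : (pointState c s x).2 with
  | true =>
    have : x ∈ limSet c := ⟨s, fun t ht => by rw [hconst t ht, hb]⟩
    simp [limFun, this, signVal]
  | false =>
    have : x ∉ limSet c := fun ⟨u, hu⟩ => by
      have h1 := hu (max u s) (le_max_left _ _)
      rw [hconst _ (le_max_right _ _), hb] at h1
      exact absurd h1 (by simp)
    simp [limFun, this, signVal]

theorem enorm_limFun_sub_le (c : ℕ → ℕ → RatCode × RatCode) (x : ℝ) (b : Bool) :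
    ‖limFun c x - signVal b‖ₑ ≤ 1 := by
  rw [Real.enorm_eq_ofReal_abs, ← ENNReal.ofReal_one]
  refine ENNReal.ofReal_le_ofReal (abs_le.2 ?_)
  have h1 := limFun_mem c x
  have h2 := signVal_mem b
  constructor <;> linarith [h1.1, h1.2, h2.1, h2.2]

/-- Off `changeSet c s` the sign at level `s` is final; on it the two values in `[0,1]` differ by at
most 1. -/
theorem lintegral_limFun_sub_le (c : ℕ → ℕ → RatCode × RatCode) (s : ℕ) :
    ∫⁻ x in Icc (0 : ℝ) 1, ‖limFun c x - signVal (cellState c s (dyadicIndex s x)).2‖ₑ ≤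
      volume (changeSet c s) := by
  calc _ ≤ ∫⁻ x in Icc (0 : ℝ) 1, (changeSet c s).indicator (fun _ => 1) x := by
        refine setLIntegral_mono' measurableSet_Icc fun x hx => ?_
        by_cases h : x ∈ changeSet c s
        · rw [indicator_of_mem h]
          exact enorm_limFun_sub_le _ _ _
        · rw [limFun_eq_of_notMem_changeSet hx h, pointState_eq_cellState]
          simp
    _ ≤ 1 * (volume.restrict (Icc (0 : ℝ) 1)) (changeSet c s) := lintegral_indicator_const_le _ _
    _ ≤ volume (changeSet c s) := by
        rw [one_mul]
        exact Measure.restrict_apply_le _ _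

theorem limIntegral_sub (c : ℕ → ℕ → RatCode × RatCode) (x y : ℝ) :
    limIntegral c y - limIntegral c x = ∫ t in x..y, limFun c t :=
  intervalIntegral.integral_interval_sub_left (intervalIntegrable_limFun c 0 y)
    (intervalIntegrable_limFun c 0 x)

theorem lipschitzWith_limIntegral (c : ℕ → ℕ → RatCode × RatCode) :
    LipschitzWith 1 (limIntegral c) := by
  refine LipschitzWith.of_dist_le_mul fun x y => ?_
  rw [Real.dist_eq, limIntegral_sub, Real.dist_eq, ← Real.norm_eq_abs]
  refine intervalIntegral.norm_integral_le_of_norm_le_const fun t _ => ?_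
  rw [Real.norm_eq_abs, abs_of_nonneg (limFun_mem c t).1]
  exact (limFun_mem c t).2

/-- On a cell that has just been reached by a change of the state, the average of `limFun` is close
to the current sign. -/
theorem abs_limIntegral_sub_le {G : ℕ → Set ℝ}
    (hG : ∀ m, G m = Icc (0 : ℝ) 1 ∩ ⋃ i, Ioo ((c m i).1.val : ℝ) ((c m i).2.val : ℝ))
    (hvol : ∀ m, volume (G m) ≤ (2 : ℝ≥0∞)⁻¹ ^ m) {t : ℕ} {z : ℝ} {b : Bool}
    (hz : pointState c t z = (t + 3, b)) :
    |limIntegral c (((dyadicIndex t z : ℝ) + 1) / 2 ^ t) -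
      limIntegral c ((dyadicIndex t z : ℝ) / 2 ^ t) - signVal b * (1 / 2 ^ t)| ≤
        1 / 8 * (1 / 2 ^ t) := by
  set j := dyadicIndex t z with hj
  set x : ℝ := (j : ℝ) / 2 ^ t
  set y : ℝ := ((j : ℝ) + 1) / 2 ^ t
  have hyx : y - x = 1 / 2 ^ t := by simp only [x, y]; ring
  have hxy : x ≤ y := by
    have : (0 : ℝ) < 1 / 2 ^ t := by positivity
    linarith
  have e : limIntegral c y - limIntegral c x - signVal b * (1 / 2 ^ t) =
      ∫ u in Ioo x y, (limFun c u - signVal b) := by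
    rw [limIntegral_sub, ← integral_Ioc_eq_integral_Ioo, ← intervalIntegral.integral_of_le hxy,
      intervalIntegral.integral_sub (intervalIntegrable_limFun c x y) intervalIntegrable_const,
      intervalIntegral.integral_const, hyx, smul_eq_mul, mul_comm (1 / (2 : ℝ) ^ t)]
  have h1 : ‖∫ u in Ioo x y, (limFun c u - signVal b)‖ₑ ≤ ENNReal.ofReal (1 / 8 * (1 / 2 ^ t)) := by
    calc _ ≤ ∫⁻ u in Ioo x y, ‖limFun c u - signVal b‖ₑ := enorm_integral_le_lintegral_enorm _
      _ ≤ ∫⁻ u in Ioo x y, (G (t + 3)).indicator (fun _ => 1) u := by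
          refine setLIntegral_mono' measurableSet_Ioo fun u hu => ?_
          -- Interior points of the cell share the state of `z`, and they can leave it only inside
          -- `G (t + 3)`, of measure at most an eighth of the cell.
          have huc : u ∈ dyadicCell t j :=
            Ico_subset_dyadicCell (dyadicIndex_lt t z) ⟨hu.1.le, hu.2⟩
          have hus : pointState c t u = (t + 3, b) := by
            rw [pointState_eq_cellState, huc.2, hj, ← pointState_eq_cellState, hz]
          by_cases h : u ∈ G (t + 3)
          · rw [indicator_of_mem h]
            exact enorm_limFun_sub_le _ _ _
          · have hnc : u ∉ changeSet c t := fun hc => h (by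
              have := (changeSet_subset hG hvol hc).1
              rwa [hus] at this)
            rw [limFun_eq_of_notMem_changeSet huc.1 hnc, hus]
            simp
      _ ≤ 1 * (volume.restrict (Ioo x y)) (G (t + 3)) := lintegral_indicator_const_le _ _
      _ ≤ volume (G (t + 3)) := by
          rw [one_mul]
          exact Measure.restrict_apply_le _ _
      _ ≤ _ := by
          refine (hvol _).trans_eq ?_
          rw [inv_two_pow_eq_ofReal]
          congr 1
          rw [pow_add, inv_pow]
          norm_num
          ring
  rw [e]
  rw [Real.enorm_eq_ofReal_abs] at h1
  exact (ENNReal.ofReal_le_ofReal_iff (by positivity)).1 h1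

theorem exists_pointState_eq {G : ℕ → Set ℝ}
    (hG : ∀ m, G m = Icc (0 : ℝ) 1 ∩ ⋃ i, Ioo ((c m i).1.val : ℝ) ((c m i).2.val : ℝ))
    {z : ℝ} (hz : ∀ m, z ∈ G m) (b : Bool) (s : ℕ) :
    ∃ t, s ≤ t ∧ pointState c t z = (t + 3, b) := by
  have hstep : ∀ s, ∃ t, s ≤ t ∧ pointState c t z = (t + 3, !(pointState c s z).2) := by
    intro s
    have hex : ∃ t, s ≤ t ∧ pointState c t z ≠ pointState c s z := by
      -- If the state were constant, `z` would still reach a cell well inside the watched component,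
      -- and the next step would flip the sign.
      by_contra! hcon
      have hzG := hz (pointState c s z).1
      rw [hG] at hzG
      obtain ⟨i, hi⟩ := mem_iUnion.1 hzG.2
      obtain ⟨s₀, hs₀⟩ := exists_inCell hzG.1 hi
      have h1 := hcon (max s s₀) (le_max_left _ _)
      have h2 := hcon (max s s₀ + 1) (by omega)
      rw [pointState_succ, h1, if_pos (hs₀ _ (by omega))] at h2
      have h3 := congrArg Prod.snd h2
      simp at h3
    obtain ⟨u, hu, -, -, h⟩ := exists_change hex
    exact ⟨u + 1, by omega, h⟩
  obtain ⟨t, hst, ht⟩ := hstep s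
  -- Each change flips the sign, so one or two changes reach `b`.
  by_cases hb : (!(pointState c s z).2) = b
  · exact ⟨t, hst, hb ▸ ht⟩
  · obtain ⟨t', htt', ht'⟩ := hstep t
    refine ⟨t', hst.trans htt', ?_⟩
    rw [ht', ht]
    congr 1
    revert hb
    cases (pointState c s z).2 <;> cases b <;> simp

theorem not_differentiableOnUnitAt_limIntegral {G : ℕ → Set ℝ}
    (hG : ∀ m, G m = Icc (0 : ℝ) 1 ∩ ⋃ i, Ioo ((c m i).1.val : ℝ) ((c m i).2.val : ℝ))
    (hvol : ∀ m, volume (G m) ≤ (2 : ℝ≥0∞)⁻¹ ^ m) {z : ℝ} (hz : ∀ m, z ∈ G m) :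
    ¬ DifferentiableOnUnitAt (limIntegral c) z := by
  intro hd
  have hz01 : z ∈ Icc (0 : ℝ) 1 := by
    have := hz 0
    rw [hG] at this
    exact this.1
  have hder := hd.hasDerivWithinAt
  set D := derivWithin (limIntegral c) (Icc 0 1) z
  -- As `z` lies between the ends of its cell, the errors at the two ends add up to 1/8 of its
  -- length. With the 1/8 of `abs_limIntegral_sub_le`, `D` would be within 1/4 of both 0 and 1.
  have ho := (hasDerivWithinAt_iff_isLittleO.1 hder).def (by norm_num : (0 : ℝ) < 1 / 8)
  rw [eventually_nhdsWithin_iff, Metric.eventually_nhds_iff] at ho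
  obtain ⟨ε, hε, ho⟩ := ho
  obtain ⟨n, hn⟩ := exists_pow_lt_of_lt_one hε (by norm_num : (2 : ℝ)⁻¹ < 1)
  have key : ∀ b, |D - signVal b| ≤ 1 / 4 := by
    intro b
    obtain ⟨t, hnt, ht⟩ := exists_pointState_eq hG hz b n
    have h1 := abs_limIntegral_sub_le hG hvol ht
    have hlt := dyadicIndex_lt t z
    have hzx := dyadicIndex_le (T := t) hz01
    have hzy := le_dyadicIndex (T := t) hz01
    have hx01 := div_two_pow_mem (T := t) (j := dyadicIndex t z) hlt.le
    have hy01 := div_two_pow_mem (T := t) (j := dyadicIndex t z + 1) hlt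
    push_cast at hy01
    set x : ℝ := (dyadicIndex t z : ℝ) / 2 ^ t
    set y : ℝ := ((dyadicIndex t z : ℝ) + 1) / 2 ^ t
    have hyx : y - x = 1 / 2 ^ t := by simp only [x, y]; ring
    have hd0 : (0 : ℝ) < 1 / 2 ^ t := by positivity
    have hsmall : y - x < ε := by
      rw [hyx, one_div, ← inv_pow]
      exact (pow_le_pow_of_le_one (by norm_num) (by norm_num) hnt).trans_lt hn
    have h2 := ho (y := x) (by rw [Real.dist_eq, abs_lt]; constructor <;> linarith) hx01
    have h3 := ho (y := y) (by rw [Real.dist_eq, abs_lt]; constructor <;> linarith) hy01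
    simp only [Real.norm_eq_abs, smul_eq_mul] at h2 h3
    rw [abs_of_nonpos (by linarith : x - z ≤ 0)] at h2
    rw [abs_of_nonneg (by linarith : 0 ≤ y - z)] at h3
    have h4 : |(D - signVal b) * (1 / 2 ^ t)| ≤ 1 / 4 * (1 / 2 ^ t) := by
      rw [abs_le] at h1 h2 h3 ⊢
      rw [← hyx] at h1 ⊢
      constructor <;> nlinarith [h1.1, h1.2, h2.1, h2.2, h3.1, h3.2]
    rw [abs_mul, abs_of_pos hd0] at h4
    exact le_of_mul_le_mul_right h4 hd0
  have h1 := abs_le.1 (key true)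
  have h2 := abs_le.1 (key false)
  simp only [signVal, if_true] at h1 h2
  norm_num at h1 h2
  linarith [h1.1, h2.2]

theorem computableInPVarNorm_limIntegral {p : ℝ} (hp : 1 ≤ p) (hc : Computable₂ c) {G : ℕ → Set ℝ}
    (hG : ∀ m, G m = Icc (0 : ℝ) 1 ∩ ⋃ i, Ioo ((c m i).1.val : ℝ) ((c m i).2.val : ℝ))
    (hvol : ∀ m, volume (G m) ≤ (2 : ℝ≥0∞)⁻¹ ^ m)
    (hcomp : UniformlyComputableReals fun m => (volume (G m)).toReal) :
    ComputableInPVarNorm p (limIntegral c) := by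
  classical
  obtain ⟨P, hP⟩ := exists_nat_ge p
  obtain ⟨s, hs, hsvol⟩ := exists_computable_level hc hG hvol hcomp
  let e : ℕ → ℕ := fun n => (n + 2) * P
  have he : Computable e := by fun_prop
  -- The sign at the fixed level `s (e n + 1)`, read off at a finer level `T` from the ancestor
  -- cell.
  let v : ℕ → ℕ → ℕ → ℚ := fun n T j =>
    signVal (cellState c (s (e n + 1)) (j / 2 ^ (T - s (e n + 1)))).2
  have hv : ComputableRat fun x : (ℕ × ℕ) × ℕ => v x.1.1 x.1.2 x.2 := by
    refine ComputableRat.ite (P := fun x : (ℕ × ℕ) × ℕ =>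
      (cellState c (s (e x.1.1 + 1)) (x.2 / 2 ^ (x.1.2 - s (e x.1.1 + 1)))).2 = true)
      (ComputablePred.bool_eq ?_) (by fun_prop) (by fun_prop)
    have := computable_cellState hc (s := fun x : (ℕ × ℕ) × ℕ => s (e x.1.1 + 1))
      (j := fun x => x.2 / 2 ^ (x.1.2 - s (e x.1.1 + 1))) (by fun_prop) (by fun_prop)
    fun_prop
  have hvx : ∀ n T x, s (e n + 1) ≤ T → v n T (dyadicIndex T x) =
      signVal (cellState c (s (e n + 1)) (dyadicIndex (s (e n + 1)) x)).2 := by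
    intro n T x h
    have := dyadicIndex_div_two_pow (s (e n + 1)) (T - s (e n + 1)) x
    rw [Nat.add_sub_cancel' h] at this
    simp only [v, this]
  have hcons : Computable fun l : List RatCode => (0, 0, 0) :: l :=
    Computable.list_cons.comp (Computable.const _) Computable.id
  -- A polynomial and a level are found by search. All conditions are decidable: the grid is fine
  -- enough, the derivative is at most 2 on every cell (difference with the empty list), and the
  -- Riemann sum for the L¹ distance is small.
  obtain ⟨w, hw, hspec⟩ := ComputablePred.exists_choice (α := ℕ) (β := List RatCode × ℕ)
    (P := fun n y => s (e n + 1) ≤ y.2 ∧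
      (∀ j < 2 ^ y.2, slopeBound ((0, 0, 0) :: y.1) [] y.2 j ≤ 2) ∧
      stepDist (v n y.2) ((0, 0, 0) :: y.1) y.2 ≤ (1 / 2) ^ (e n + 1))
    (by
      refine (ComputablePred.nat_le (by fun_prop) (by fun_prop)).and (ComputablePred.and ?_ ?_)
      · refine ComputablePred.forall_lt (α := ℕ × List RatCode × ℕ) (n := fun x => 2 ^ x.2.2)
          (P := fun x j => slopeBound ((0, 0, 0) :: x.2.1) [] x.2.2 j ≤ 2) ?_ (by fun_prop)
        exact ComputableRat.le (computableRat_slopeBound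
          (l := fun x : (ℕ × List RatCode × ℕ) × ℕ => (0, 0, 0) :: x.1.2.1) (l' := fun _ => [])
          (hcons.comp (by fun_prop)) (by fun_prop) (by fun_prop) (by fun_prop)) (by fun_prop)
      · refine ComputableRat.le ?_ (by fun_prop)
        unfold stepDist
        refine ComputableRat.div_pow (ComputableRat.sum ?_ (by fun_prop)) (by fun_prop) 2
        have h1 : ComputableRat fun x : (ℕ × List RatCode × ℕ) × ℕ => v x.1.1 x.1.2.2 x.2 :=
          hv.comp (f := fun x : (ℕ × ℕ) × ℕ => v x.1.1 x.1.2 x.2)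
            (g := fun x : (ℕ × List RatCode × ℕ) × ℕ => ((x.1.1, x.1.2.2), x.2)) (by fun_prop)
        have h2 : Computable fun x : (ℕ × List RatCode × ℕ) × ℕ => (0, 0, 0) :: x.1.2.1 :=
          hcons.comp (by fun_prop)
        exact (h1.sub (by fun_prop)).abs.add (by fun_prop))
    (by
      intro n
      set r := s (e n + 1) with hr
      have hmeas : Measurable fun x => (signVal (cellState c r (dyadicIndex r x)).2 : ℝ) :=
        (measurable_from_top (f := fun j => (signVal (cellState c r j).2 : ℝ))).comp
          (measurable_dyadicIndex r)
      obtain ⟨l, hl, hl'⟩ := exists_lintegral_sub_polyDeriv_le hmeas (fun x => signVal_mem _)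
        (η := (2 : ℝ)⁻¹ ^ (e n + 2)) (by positivity)
      have hB : (0 : ℝ) ≤ ratLip ((0, 0, 0) :: l) := by exact_mod_cast ratLip_nonneg _
      obtain ⟨T₀, hT₀⟩ := pow_unbounded_of_one_lt
        (2 * (ratLip ((0, 0, 0) :: l) : ℝ) / (2 : ℝ)⁻¹ ^ (e n + 2)) one_lt_two
      set T := max r T₀ with hT
      have hBT : 2 * (ratLip ((0, 0, 0) :: l) / 2 ^ T : ℝ) ≤ (2 : ℝ)⁻¹ ^ (e n + 2) := by
        have h1 : (2 : ℝ) ^ T₀ ≤ 2 ^ T := pow_le_pow_right₀ one_le_two (le_max_right _ _)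
        rw [← mul_div_assoc, div_le_iff₀ (by positivity)]
        exact ((div_le_iff₀' (by positivity)).1 (hT₀.le.trans h1))
      refine ⟨(l, T), le_max_left _ _, fun j hj => ?_, ?_⟩
      -- The derivative is at most 3/2 and `hBT` bounds the Lipschitz error of a cell by 1/2, in
      -- total 2.
      · have h1 := hl _ (div_two_pow_mem hj.le)
        have h2 : (2 : ℝ)⁻¹ ^ (e n + 2) ≤ 1 := pow_le_one₀ (by norm_num) (by norm_num)
        rw [← Rat.cast_le (K := ℝ)]
        unfold slopeBound
        push_cast [ratDeriv_cast]
        simp only [polyDeriv, ratLip] at h1 hBT ⊢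
        simp only [List.length_nil, Finset.range_zero, Finset.sum_empty, sub_zero, Rat.cast_zero,
          add_zero] at h1 hBT ⊢
        push_cast at h1 hBT ⊢
        linarith
      · have h1 := stepDist_le (v n T) ((0, 0, 0) :: l) T (η := (2 : ℝ)⁻¹ ^ (e n + 2))
          (by positivity) (by
            simp only [hvx n T _ (le_max_left _ _)]
            exact hl')
        rw [← Rat.cast_le (K := ℝ)]
        push_cast
        rw [one_div]
        have h2 : (2 : ℝ)⁻¹ ^ (e n + 1) = (2 : ℝ)⁻¹ ^ (e n + 2) + (2 : ℝ)⁻¹ ^ (e n + 2) := by ring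
        rw [h2]
        linarith)
  refine ⟨fun n => (0, 0, 0) :: (w n).1, hcons.comp (by fun_prop), fun n => ?_⟩
  obtain ⟨h1, h2, h3⟩ := hspec n
  set l := (0, 0, 0) :: (w n).1 with hl
  set T := (w n).2
  have hbd : ∀ x ∈ Icc (0 : ℝ) 1, |polyDeriv l x| ≤ 2 := by
    intro x hx
    obtain ⟨j, hj, hxj⟩ := exists_cell (N := 2 ^ T) (by positivity) hx
    have h4 := abs_deriv_polyDiff_le_slopeBound l [] hj hxj
    have h5 : (slopeBound l [] T j : ℝ) ≤ 2 := by exact_mod_cast h2 j hj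
    have h6 : polyDeriv [] x = 0 := by simp [polyDeriv]
    rw [h6, sub_zero] at h4
    exact h4.trans h5
  have hq0 : Polynomial.aeval (0 : ℝ) (ratPoly l) = 0 := by simp [hl, ratPoly, RatCode.val]
  have hqint : ∀ x, IntervalIntegrable (polyDeriv l) volume 0 x := fun x =>
    (continuous_polyDeriv l).intervalIntegrable _ _
  refine pVarNorm_le_of_lintegral_le hp hP (h := fun x => limFun c x - polyDeriv l x)
    ((intervalIntegrable_limFun c 0 1).sub (hqint 1)) (fun x hx => ?_) (fun x hx => ?_) ?_
  -- The difference is at most 1 + 2, within the bound 4 required.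
  · have h4 := abs_le.1 (hbd x hx)
    have h5 := limFun_mem c x
    rw [abs_le]
    constructor <;> linarith [h4.1, h4.2, h5.1, h5.2]
  · rw [intervalIntegral.integral_sub (intervalIntegrable_limFun c 0 x) (hqint x),
      intervalIntegral.integral_eq_sub_of_hasDerivAt (fun y _ => hasDerivAt_ratPoly l y) (hqint x),
      hq0, sub_zero]
    rfl
  · set r := s (e n + 1)
    have h4 := lintegral_step_sub_polyDeriv_le (v n T) l T
    simp only [hvx n T _ h1] at h4
    have h5 : ENNReal.ofReal (stepDist (v n T) l T) ≤ (2 : ℝ≥0∞)⁻¹ ^ (e n + 1) := by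
      rw [inv_two_pow_eq_ofReal]
      refine ENNReal.ofReal_le_ofReal ?_
      have := (Rat.cast_le (K := ℝ)).2 h3
      push_cast at this
      rwa [one_div] at this
    have h6 := (lintegral_limFun_sub_le c r).trans (hsvol (e n + 1))
    have hmeas : Measurable fun x =>
        ‖limFun c x - (signVal (cellState c r (dyadicIndex r x)).2 : ℝ)‖ₑ :=
      ((measurable_limFun c).sub
        ((measurable_from_top (f := fun j => (signVal (cellState c r j).2 : ℝ))).comp
          (measurable_dyadicIndex r))).enorm
    -- Two errors of 2^(-(e n + 1)), one for freezing the sign and one for the polynomial, add up to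
    -- 2^(-e n).
    calc ∫⁻ x in Icc (0 : ℝ) 1, ‖limFun c x - polyDeriv l x‖ₑ
        ≤ ∫⁻ x in Icc (0 : ℝ) 1,
          (‖limFun c x - (signVal (cellState c r (dyadicIndex r x)).2 : ℝ)‖ₑ +
            ‖(signVal (cellState c r (dyadicIndex r x)).2 : ℝ) - polyDeriv l x‖ₑ) := by
          refine lintegral_mono fun x => ?_
          rw [← sub_add_sub_cancel (limFun c x)
            (signVal (cellState c r (dyadicIndex r x)).2 : ℝ) (polyDeriv l x)]
          exact enorm_add_le _ _
      _ ≤ (2 : ℝ≥0∞)⁻¹ ^ (e n + 1) + (2 : ℝ≥0∞)⁻¹ ^ (e n + 1) := by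
          rw [lintegral_add_left hmeas]
          exact add_le_add h6 (h4.trans h5)
      _ = ENNReal.ofReal ((2 : ℝ)⁻¹ ^ ((n + 2) * P)) := by
          rw [inv_two_pow_eq_ofReal, ← ENNReal.ofReal_add (by positivity) (by positivity)]
          congr 1
          simp only [e]
          ring

end

end

theorem corollary5p2 (p : ℝ) (hp : 1 ≤ p) (hpc : ComputableReal p)
    (z : ℝ) (hz : z ∈ Set.Icc (0 : ℝ) 1) :
    List.TFAE
      [SchnorrRandom z,
       ∀ f ∈ rieszClass p, ComputableInPVarNorm p f → DifferentiableOnUnitAt f z,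
       ∀ f : ℝ → ℝ, (∃ K : ℝ≥0, LipschitzOnWith K f (Set.Icc 0 1)) →
         ComputableInPVarNorm p f → DifferentiableOnUnitAt f z] := by
  tfae_have 1 → 2 := fun h f _ hf => h.differentiableOnUnitAt hp hz hf
  -- Functions in the Riesz class vanish at 0, so the constant `f 0` is subtracted first and
  -- restored afterwards.
  tfae_have 2 → 3 := fun h f ⟨_, hK⟩ hf =>
    (h _ (sub_apply_zero_mem_rieszClass hp hK) hf.sub_apply_zero).of_sub_const
  tfae_have 3 → 1 := by
    intro h G hGtest hzG
    obtain ⟨⟨c, hc, hG⟩, hvol, hcomp⟩ := hGtest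
    exact not_differentiableOnUnitAt_limIntegral hG hvol (mem_iInter.1 hzG)
      (h _ ⟨1, (lipschitzWith_limIntegral c).lipschitzOnWith⟩
        (computableInPVarNorm_limIntegral hp hc hG hvol hcomp))
  tfae_finish
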